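/- **Virtual curve diagrams.** A virtual curve diagram (vcd) $D$ with $n$ curves consists of a finite set of upper points on a horizontal line (the upper line), ordered from left to right, of $n$ base points ordered from left to right, and of $n$ curves. Every curve is a sequence $a_0,a_1,\dots,a_r$ with $r\ge 1$, where $a_0$ is a base point and $a_1,\dots,a_r$ are upper points; every point lies on exactly one curve, exactly once. Diagrams are considered up to order-preserving relabelling of their points. The pairs $(a_{k-1},a_k)$ are the arcs; $(a_0,a_1)$ is the base arc, the arcs $(a_{2k-1},a_{2k})$, $k\ge1$, are the over arcs, the arcs $(a_{2k},a_{2k+1})$, $k\ge 1$, are the under arcs; $(a_{r-1},a_r)$ is the terminal arc and $a_r$ the terminal point. It is required that no two over arcs $(x,y)$, $(z,w)$ satisfy $\min\{x,y\}<\min\{z,w\}<\max\{x,y\}<\max\{z,w\}$ (that is, the over arcs can be drawn above the upper line without crossings). The terminal points are denoted $t_1<t_2<\dots<t_n$. **Equivalence.** Two upper points are adjacent if no upper point lies strictly between them. A $T$-move deletes the terminal point $b$ of a terminal arc $(a,b)$ with $a,b$ adjacent upper points; a $B$-move deletes $b$ and $c$ if $(a,b),(b,c),(c,d)$ are consecutive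 arcs of a curve and $b,c$ are adjacent. Let $\sim$ be the equivalence relation generated by relabellings, $T$-moves and $B$-moves, and $[D]$ the class of $D$. A diagram is simplified if it has the least number of points in its class. Every class contains a simplified diagram. **Action of the braid generators.** For $1\le i\le n-1$, $\sigma_i\cdot D$ is obtained by moving the terminal point $a=t_i$ above the upper line, over $b=t_{i+1}$, to a new position $t$ immediately to the right of $b$, pulling along the over arcs in the way. Explicitly: * if the curve ending at $a$ has a terminal over arc $(x,a)$, this arc is replaced by the over arc $(x,t)$; otherwise $a$ is kept as a non-terminal point and a terminal over arc $(a,t)$ is appended; * every over arc not ending at $a$ with exactly one end $u$ in the interval $(a,b]$ and other end $v$ is replaced by an over arc from $u$ to a new point $p_u$, an under arc from $p_u$ to a new point $q_u$, and an over arc from $q_u$ to $v$ (traversed in the direction of the curve); * the new points lie between $b$ and the next upper point to the right of $b$, with $b<p_u<t<q_u$ and, for $u<u'$, $p_{u'}<p_u$ and $q_u<q_{u'}$. Everything else is unchanged. The diagram $\sigma_i^{-1}\cdot D$ is obtained in the mirror-symmetric way, by moving $t_{i+1}$ above the upper line, over $t_i$, to a new position immediately to the left of $t_i$. **Types and reductions.**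 Let $D$ be simplified. A terminal over arc $(x,t_{i+1})$ of $D$ is of type $(i,i+1)$ if $t_i$ lies strictly between its ends; a terminal over arc $(x,t_i)$ is of type $(i+1,i)$ if $t_{i+1}$ lies strictly between its ends. A class is said to have a terminal over arc of some type if its simplified representative has. Define a relation $\to$ on classes: for a simplified diagram $D$ and $1\le i\le n-1$, $[D]\to[\sigma_i^{-1}\cdot D]$ if $D$ has a terminal over arc of type $(i,i+1)$, and $[D]\to[\sigma_i\cdot D]$ if $D$ has a terminal over arc of type $(i+1,i)$. **Proposition.** Let $1\le i\le n-1$. 1. If $D$ is a simplified vcd with $n$ curves that has no terminal over arc of type $(i+1,i)$, then every simplified representative of $[\sigma_i\cdot D]$ has a terminal over arc of type $(i,i+1)$. 2. If $D$ is a simplified vcd with $n$ curves that has no terminal over arc of type $(i,i+1)$, then every simplified representative of $[\sigma_i^{-1}\cdot D]$ has a terminal over arc of type $(i+1,i)$. 3. Hence, for every vcd $D$ with $n$ curves, $[D]\to[\sigma_i\cdot D]$ or $[\sigma_i\cdot D]\to[D]$; and $[D]\to[\sigma_i^{-1}\cdot D]$ or $[\sigma_i^{-1}\cdot D]\to[D]$.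 -/

import Mathlib

namespace VirtualBraid

/-- The over arcs of a curve whose upper points are, in the order of the curve,
`a₁, a₂, …, a_r` (the base point `a₀` is not in the list): these are the arcs
`(a₁, a₂), (a₃, a₄), …`. -/
def overArcs : List ℤ → List (ℤ × ℤ)
  | x :: y :: l => (x, y) :: overArcs l
  | _ => []

/-- The forbidden position of two arcs:
`min e < min f < max e < max f`. -/
def Crosses (e f : ℤ × ℤ) : Prop :=
  min e.1 e.2 < min f.1 f.2 ∧ min f.1 f.2 < max e.1 e.2 ∧ max e.1 e.2 < max f.1 f.2

/-- The arc `e` encloses the point `c`. -/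
def Encloses (e : ℤ × ℤ) (c : ℤ) : Prop :=
  (e.1 < c ∧ c < e.2) ∨ (e.2 < c ∧ c < e.1)

/-- A virtual curve diagram with `n` curves. The upper points are finitely many integers, placed
on the upper line `ℤ`, whose order is the order `<_P` on the upper points. The base points are the
elements of `Fin n`, in their usual order. The `k`-th curve starts at the base point `k` and then
runs through the upper points listed in `curve k`; the order of that list is the order `<_C`, and
its last entry is the terminal point. Every upper point lies on exactly one curve, exactly once.
Up to relabelling of points, every virtual curve diagram has this form. -/
@[ext]
structure VCD (n : ℕ) where
  curve : Fin n → List ℤ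
  curve_ne_nil : ∀ k, curve k ≠ []
  curve_nodup : ∀ k, (curve k).Nodup
  curve_disjoint : ∀ j k, j ≠ k → (curve j).Disjoint (curve k)
  over_noncrossing : ∀ j k, ∀ e ∈ overArcs (curve j), ∀ f ∈ overArcs (curve k), ¬ Crosses e f

/-! ### Pushing a puncture above the upper line -/

/-- Room for the moved puncture is made by translating everything to the right of `b`. -/
def shift (a b z : ℤ) : ℤ := if b < z then z + 3 * (b - a) else z

/-- What becomes of an over arc `(x, y)` when the terminal point `a` travels above the upper line,
over the terminal point `b` (`a < b`), and lands at `t = b + 2 * (b - a)`, immediately to the right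
of `b`. The path of the puncture is a semicircle from `a` to `t`.
If the arc ends at `a`, its end follows the puncture.
If exactly one end `u` of the arc lies in `(a, b]`, the arc meets the path; it is pulled along, and
now consists of an over arc (inside the path) from `u` to `t - (u - a)`, an under arc around the
puncture from `t - (u - a)` to `t + (u - a)`, and an over arc (outside the path) from `t + (u - a)`
to its other end.
Any other over arc is unchanged. -/
def pushOver (a b x y : ℤ) : List ℤ :=
  if y = a then [shift a b x, b + 2 * (b - a)]
  else if (a < x ∧ x ≤ b) ∧ ¬ (a < y ∧ y ≤ b) then
    [x, b + 2 * (b - a) - (x - a), b + 2 * (b - a) + (x - a), shift a b y]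
  else if (a < y ∧ y ≤ b) ∧ ¬ (a < x ∧ x ≤ b) then
    [shift a b x, b + 2 * (b - a) + (y - a), b + 2 * (b - a) - (y - a), y]
  else [shift a b x, shift a b y]

/-- The effect of the same motion on a whole curve. If the curve arrives at the puncture `a` along
a base arc or an under arc, then `a` becomes an ordinary point, followed by a new terminal over arc
from `a` to the new position `b + 2 * (b - a)` of the puncture. -/
def pushCurve (a b : ℤ) : List ℤ → List ℤ
  | x :: y :: l => pushOver a b x y ++ pushCurve a b l
  | [x] => if x = a then [a, b + 2 * (b - a)] else [shift a b x]
  | [] => []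

/-- The old point from which a point of a pushed curve comes. -/
def origin (a b z : ℤ) : ℤ :=
  if z ≤ b then z
  else if z ≤ b + 2 * (b - a) then a + (b + 2 * (b - a) - z)
  else if z ≤ b + 3 * (b - a) then a + (z - (b + 2 * (b - a)))
  else z - 3 * (b - a)

theorem origin_pushOver {a b x y z : ℤ} (hab : a < b) (hz : z ∈ pushOver a b x y) :
    origin a b z = x ∨ origin a b z = y := by
  unfold pushOver shift at hz
  unfold origin
  split_ifs at hz <;> simp only [List.mem_cons, List.not_mem_nil, or_false] at hz <;>
    split_ifs <;> omega

theorem origin_pushCurve {a b z : ℤ} (hab : a < b) :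
    ∀ {l : List ℤ}, z ∈ pushCurve a b l → origin a b z ∈ l
  | [], h => by simp [pushCurve] at h
  | [x], h => by
      have : origin a b z = x := by
        simp only [pushCurve, shift] at h
        unfold origin
        split_ifs at h <;> simp only [List.mem_cons, List.not_mem_nil, or_false] at h <;>
          split_ifs <;> omega
      simp [this]
  | x :: y :: l, h => by
      simp only [pushCurve, List.mem_append] at h
      rcases h with h | h
      · rcases origin_pushOver hab h with h | h <;> simp [h]
      · have := origin_pushCurve hab h
        simp [this]

theorem pushOver_nodup {a b x y : ℤ} (hab : a < b) (hxy : x ≠ y) : (pushOver a b x y).Nodup := by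
  unfold pushOver shift
  split_ifs <;> simp only [List.nodup_cons, List.mem_cons, List.not_mem_nil, or_false,
    not_false_eq_true, List.nodup_nil, and_true] <;> omega

theorem pushCurve_nodup {a b : ℤ} (hab : a < b) :
    ∀ {l : List ℤ}, l.Nodup → (pushCurve a b l).Nodup
  | [], _ => by simp [pushCurve]
  | [x], _ => by
      simp only [pushCurve]
      split_ifs <;> simp only [List.nodup_cons, List.mem_cons, List.not_mem_nil, or_false,
        not_false_eq_true, List.nodup_nil, and_true]
      omega
  | x :: y :: l, h => by
      simp only [List.nodup_cons, List.mem_cons, not_or] at h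
      obtain ⟨⟨hxy, hx⟩, hy, hl⟩ := h
      simp only [pushCurve]
      refine List.Nodup.append (pushOver_nodup hab hxy) (pushCurve_nodup hab hl) ?_
      intro z hz hz'
      have h2 := origin_pushCurve hab hz'
      rcases origin_pushOver hab hz with h | h <;> rw [h] at h2 <;> contradiction

theorem pushCurve_ne_nil {a b : ℤ} : ∀ {l : List ℤ}, l ≠ [] → pushCurve a b l ≠ []
  | [], h => absurd rfl h
  | [x], _ => by simp only [pushCurve]; split_ifs <;> simp
  | x :: y :: l, _ => by
      simp only [pushCurve, pushOver]; split_ifs <;> simp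

theorem mem_of_mem_overArcs {e : ℤ × ℤ} :
    ∀ {l : List ℤ}, e ∈ overArcs l → e.1 ∈ l ∧ e.2 ∈ l
  | [], h => by simp [overArcs] at h
  | [x], h => by simp [overArcs] at h
  | x :: y :: l, h => by
      simp only [overArcs, List.mem_cons] at h
      rcases h with rfl | h
      · simp
      · have := mem_of_mem_overArcs h
        simp [this.1, this.2]

/-- Two arcs have no common end. -/
def Apart (e f : ℤ × ℤ) : Prop := e.1 ≠ f.1 ∧ e.1 ≠ f.2 ∧ e.2 ≠ f.1 ∧ e.2 ≠ f.2

theorem overArcs_apart {e f : ℤ × ℤ} :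
    ∀ {l : List ℤ}, l.Nodup → e ∈ overArcs l → f ∈ overArcs l → e = f ∨ Apart e f
  | [], _, h, _ => by simp [overArcs] at h
  | [x], _, h, _ => by simp [overArcs] at h
  | x :: y :: l, hl, he, hf => by
      simp only [List.nodup_cons, List.mem_cons, not_or] at hl
      obtain ⟨⟨hxy, hx⟩, hy, hl⟩ := hl
      simp only [overArcs, List.mem_cons] at he hf
      have key : ∀ g ∈ overArcs l, Apart (x, y) g ∧ Apart g (x, y) := by
        intro g hg
        obtain ⟨h1, h2⟩ := mem_of_mem_overArcs hg
        refine ⟨⟨?_, ?_, ?_, ?_⟩, ?_, ?_, ?_, ?_⟩ <;> rintro h <;> simp_all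
      rcases he with rfl | he <;> rcases hf with rfl | hf
      · exact Or.inl rfl
      · exact Or.inr (key f hf).1
      · exact Or.inr (key e he).2
      · exact overArcs_apart hl he hf

theorem overArcs_ne {e : ℤ × ℤ} : ∀ {l : List ℤ}, l.Nodup → e ∈ overArcs l → e.1 ≠ e.2
  | [], _, h => by simp [overArcs] at h
  | [x], _, h => by simp [overArcs] at h
  | x :: y :: l, hl, he => by
      simp only [List.nodup_cons, List.mem_cons, not_or] at hl
      simp only [overArcs, List.mem_cons] at he
      rcases he with rfl | he
      · exact hl.1.1
      · exact overArcs_ne hl.2.2 he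

theorem overArcs_pushCurve {a b : ℤ} {e : ℤ × ℤ} :
    ∀ {l : List ℤ}, e ∈ overArcs (pushCurve a b l) →
      (∃ f ∈ overArcs l, e ∈ overArcs (pushOver a b f.1 f.2)) ∨ e = (a, b + 2 * (b - a))
  | [], h => by simp [overArcs, pushCurve] at h
  | [x], h => by
      simp only [pushCurve] at h
      split_ifs at h with hx <;> simp [overArcs] at h
      exact Or.inr h
  | x :: y :: l, h => by
      have h' : e ∈ overArcs (pushOver a b x y) ∨ e ∈ overArcs (pushCurve a b l) := by
        simp only [pushCurve] at h
        unfold pushOver at h ⊢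
        split_ifs at h ⊢ <;> simp [overArcs] at h ⊢ <;> tauto
      rcases h' with h' | h'
      · exact Or.inl ⟨(x, y), by simp [overArcs], h'⟩
      · rcases overArcs_pushCurve h' with ⟨f, hf, hef⟩ | h1
        · exact Or.inl ⟨f, by simp [overArcs, hf], hef⟩
        · exact Or.inr h1

theorem pushOver_noncrossing_self {a b x y : ℤ}
    {e f : ℤ × ℤ} (he : e ∈ overArcs (pushOver a b x y)) (hf : f ∈ overArcs (pushOver a b x y)) :
    ¬ Crosses e f := by
  unfold pushOver shift at he hf
  unfold Crosses
  split_ifs at he hf <;> simp only [overArcs, List.mem_cons, List.not_mem_nil, or_false] at he hf <;>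
    (try rcases he with rfl | rfl) <;> (try rcases hf with rfl | rfl) <;> dsimp only <;> omega

/-- The left end `l` and the right end `r` of an over arc of a pushed over arc, in terms of the left
end `p` and the right end `q` of the old one. -/
def PushedEnds (a b p q l r : ℤ) : Prop :=
  (p < a ∧ q = a ∧ l = p ∧ r = b + 2 * (b - a)) ∨
  (p = a ∧ q ≤ b ∧ l = q ∧ r = b + 2 * (b - a)) ∨
  (p = a ∧ b < q ∧ l = b + 2 * (b - a) ∧ r = q + 3 * (b - a)) ∨
  (q < a ∧ l = p ∧ r = q) ∨
  (p < a ∧ b < q ∧ l = p ∧ r = q + 3 * (b - a)) ∨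
  (b < p ∧ l = p + 3 * (b - a) ∧ r = q + 3 * (b - a)) ∨
  (a < p ∧ q ≤ b ∧ l = p ∧ r = q) ∨
  (p < a ∧ a < q ∧ q ≤ b ∧ l = q ∧ r = b + 2 * (b - a) - (q - a)) ∨
  (p < a ∧ a < q ∧ q ≤ b ∧ l = p ∧ r = b + 2 * (b - a) + (q - a)) ∨
  (a < p ∧ p ≤ b ∧ b < q ∧ l = p ∧ r = b + 2 * (b - a) - (p - a)) ∨
  (a < p ∧ p ≤ b ∧ b < q ∧ l = b + 2 * (b - a) + (p - a) ∧ r = q + 3 * (b - a))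

theorem pushedEnds_of_unchanged {a b p q : ℤ} (hab : a < b) (hp : p ≠ a) (hq : q ≠ a) (hpq : p < q)
    (h : (a < p ∧ p ≤ b) ↔ (a < q ∧ q ≤ b)) :
    shift a b p < shift a b q ∧ PushedEnds a b p q (shift a b p) (shift a b q) := by
  unfold shift
  rcases lt_or_gt_of_ne hp with h1 | h1
  · rcases lt_or_gt_of_ne hq with h2 | h2
    · rw [if_neg (by omega), if_neg (by omega)]
      exact ⟨hpq, .inr <| .inr <| .inr <| .inl ⟨h2, rfl, rfl⟩⟩
    · rw [if_neg (by omega), if_pos (by omega)]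
      exact ⟨by omega, .inr <| .inr <| .inr <| .inr <| .inl ⟨h1, by omega, rfl, rfl⟩⟩
  · by_cases h2 : q ≤ b
    · rw [if_neg (by omega), if_neg (by omega)]
      exact ⟨hpq, .inr <| .inr <| .inr <| .inr <| .inr <| .inr <| .inl ⟨h1, h2, rfl, rfl⟩⟩
    · rw [if_pos (by omega), if_pos (by omega)]
      exact ⟨by omega, .inr <| .inr <| .inr <| .inr <| .inr <| .inl ⟨by omega, rfl, rfl⟩⟩

theorem pushOver_ends {a b x y : ℤ} (hab : a < b) (hx : x ≠ a) (hxy : x ≠ y)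
    {e : ℤ × ℤ} (he : e ∈ overArcs (pushOver a b x y)) :
    PushedEnds a b (min x y) (max x y) (min e.1 e.2) (max e.1 e.2) := by
  unfold pushOver at he
  split_ifs at he with h1 h2 h3
  case neg =>
    simp only [overArcs, List.mem_cons, List.not_mem_nil, or_false] at he
    subst he
    rcases lt_or_gt_of_ne hxy with c | c
    · have := pushedEnds_of_unchanged hab hx h1 c (by omega)
      rw [min_eq_left c.le, max_eq_right c.le, min_eq_left this.1.le, max_eq_right this.1.le]
      exact this.2
    · have := pushedEnds_of_unchanged hab h1 hx c (by omega)
      rw [min_eq_right c.le, max_eq_left c.le, min_eq_right this.1.le, max_eq_left this.1.le]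
      exact this.2
  all_goals
    unfold shift at he
    split_ifs at he <;> simp only [overArcs, List.mem_cons, List.not_mem_nil, or_false] at he <;>
    (try rcases he with rfl | rfl) <;> dsimp only <;>
    rcases lt_or_gt_of_ne hxy with c | c <;>
    simp only [min_eq_left c.le, min_eq_right c.le, max_eq_left c.le, max_eq_right c.le] <;>
    (first
      | omega
      | (rw [min_eq_left (by omega), max_eq_right (by omega)])
      | (rw [min_eq_right (by omega), max_eq_left (by omega)])) <;>
    (unfold PushedEnds; repeat (first | (left; omega) | right)) <;> omega

theorem pushedEnds_noncrossing {a b p q p' q' l r l' r' : ℤ} (hab : a < b) (hpq : p < q)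
    (hpq' : p' < q')
    (h : q < p' ∨ q' < p ∨ (p < p' ∧ q' < q) ∨ (p' < p ∧ q < q'))
    (he : PushedEnds a b p q l r) (hf : PushedEnds a b p' q' l' r') :
    ¬ (l < l' ∧ l' < r ∧ r < r') := by
  rintro ⟨c1, c2, c3⟩
  rcases h with h | h | ⟨h, h'⟩ | ⟨h, h'⟩ <;>
    rcases he with he | he | he | he | he | he | he | he | he | he | he <;>
    rcases hf with hf | hf | hf | hf | hf | hf | hf | hf | hf | hf | hf <;> omega

theorem pushOver_noncrossing {a b x y z w : ℤ} (hab : a < b) (hx : x ≠ a) (hz : z ≠ a)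
    (hxy : x ≠ y) (hzw : z ≠ w) (hap : Apart (x, y) (z, w))
    (h1 : ¬ Crosses (x, y) (z, w)) (h2 : ¬ Crosses (z, w) (x, y))
    {e f : ℤ × ℤ} (he : e ∈ overArcs (pushOver a b x y)) (hf : f ∈ overArcs (pushOver a b z w)) :
    ¬ Crosses e f := by
  refine pushedEnds_noncrossing hab (by omega) (by omega) ?_ (pushOver_ends hab hx hxy he)
    (pushOver_ends hab hz hzw hf)
  obtain ⟨n1, n2, n3, n4⟩ := hap
  unfold Crosses at h1 h2
  dsimp only at *
  omega

theorem pushOver_noncrossing_new {a b x y : ℤ} (hab : a < b)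
    {e : ℤ × ℤ} (he : e ∈ overArcs (pushOver a b x y)) :
    ¬ Crosses e (a, b + 2 * (b - a)) ∧ ¬ Crosses (a, b + 2 * (b - a)) e := by
  unfold pushOver shift at he
  unfold Crosses
  split_ifs at he <;> simp only [overArcs, List.mem_cons, List.not_mem_nil, or_false] at he <;>
    (try rcases he with rfl | rfl) <;> dsimp only <;> omega

namespace VCD

variable {n : ℕ}

/-- `x` is an upper point of `D`. -/
def IsPoint (D : VCD n) (x : ℤ) : Prop := ∃ k, x ∈ D.curve k

/-- The terminal point of the `k`-th curve. -/
def terminal (D : VCD n) (k : Fin n) : ℤ := (D.curve k).getLast (D.curve_ne_nil k)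

theorem terminal_mem (D : VCD n) (k : Fin n) : D.terminal k ∈ D.curve k := List.getLast_mem _

theorem eq_of_mem (D : VCD n) {j k : Fin n} {x : ℤ} (hj : x ∈ D.curve j) (hk : x ∈ D.curve k) :
    j = k := by
  by_contra h
  exact D.curve_disjoint j k h hj hk

theorem terminal_injective (D : VCD n) : Function.Injective D.terminal := fun j k h =>
  D.eq_of_mem (D.terminal_mem j) (h ▸ D.terminal_mem k)

/-- The set of terminal points. -/
def terminals (D : VCD n) : Finset ℤ := Finset.univ.image D.terminal

theorem card_terminals (D : VCD n) : D.terminals.card = n := by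
  simp [terminals, Finset.card_image_of_injective _ D.terminal_injective]

/-- The terminal points `t 0 < t 1 < … < t (n - 1)` in their order on the upper line. -/
def t (D : VCD n) : Fin n ↪o ℤ := D.terminals.orderEmbOfFin D.card_terminals

theorem exists_terminal_eq (D : VCD n) (i : Fin n) : ∃ k, D.terminal k = D.t i := by
  have h := D.terminals.orderEmbOfFin_mem D.card_terminals i
  obtain ⟨k, _, hk⟩ := Finset.mem_image.1 h
  exact ⟨k, hk⟩

/-- The first end of an over arc is not a terminal point. -/
theorem overArc_fst_ne_terminal (D : VCD n) {j k : Fin n} {e : ℤ × ℤ}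
    (he : e ∈ overArcs (D.curve j)) : e.1 ≠ D.terminal k := by
  have aux : ∀ (l : List ℤ) (hl : l ≠ []), l.Nodup → e ∈ overArcs l → e.1 ≠ l.getLast hl := by
    intro l
    induction l using overArcs.induct with
    | case1 x y l ih =>
      intro hl hn he h
      simp only [List.nodup_cons, List.mem_cons, not_or] at hn
      simp only [overArcs, List.mem_cons] at he
      by_cases hl' : l = []
      · subst hl'
        simp [overArcs] at he
        subst he
        exact hn.1.1 (by simpa using h)
      · rw [List.getLast_cons (by simp), List.getLast_cons hl'] at h
        rcases he with rfl | he
        · exact hn.1.2 (by rw [show x = _ from h]; exact List.getLast_mem hl')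
        · exact ih hl' hn.2.2 he h
    | case2 l h =>
      intro hl hn he
      match l, h with
      | [], _ => simp [overArcs] at he
      | [x], _ => simp [overArcs] at he
      | x :: y :: l, h => exact absurd rfl (h x y l)
  intro h
  have hjk : j = k := D.eq_of_mem (mem_of_mem_overArcs he).1 (h ▸ D.terminal_mem k)
  subst hjk
  exact aux _ (D.curve_ne_nil j) (D.curve_nodup j) he h

theorem overArcs_eq_or_apart (D : VCD n) {j k : Fin n} {e f : ℤ × ℤ}
    (he : e ∈ overArcs (D.curve j)) (hf : f ∈ overArcs (D.curve k)) : e = f ∨ Apart e f := by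
  by_cases h : j = k
  · subst h
    exact overArcs_apart (D.curve_nodup j) he hf
  · right
    obtain ⟨h1, h2⟩ := mem_of_mem_overArcs he
    obtain ⟨h3, h4⟩ := mem_of_mem_overArcs hf
    exact ⟨fun q => h (D.eq_of_mem h1 (q ▸ h3)), fun q => h (D.eq_of_mem h1 (q ▸ h4)),
      fun q => h (D.eq_of_mem h2 (q ▸ h3)), fun q => h (D.eq_of_mem h2 (q ▸ h4))⟩

/-- The diagram obtained from `D` by moving the terminal point `a` above the upper line, over `b`,
to a new position immediately to the right of `b`, pulling along all over arcs in the way. -/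
def push (D : VCD n) (a b : ℤ) (hab : a < b) (ha : ∃ k, D.terminal k = a) : VCD n where
  curve k := pushCurve a b (D.curve k)
  curve_ne_nil k := pushCurve_ne_nil (D.curve_ne_nil k)
  curve_nodup k := pushCurve_nodup hab (D.curve_nodup k)
  curve_disjoint j k hjk z hj hk :=
    D.curve_disjoint j k hjk (origin_pushCurve hab hj) (origin_pushCurve hab hk)
  over_noncrossing j k e he f hf := by
    obtain ⟨m, rfl⟩ := ha
    rcases overArcs_pushCurve he with ⟨e', he', h1⟩ | rfl <;>
      rcases overArcs_pushCurve hf with ⟨f', hf', h2⟩ | rfl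
    · have hx := D.overArc_fst_ne_terminal (k := m) he'
      have hz := D.overArc_fst_ne_terminal (k := m) hf'
      have hxy := overArcs_ne (D.curve_nodup j) he'
      have hzw := overArcs_ne (D.curve_nodup k) hf'
      rcases D.overArcs_eq_or_apart he' hf' with rfl | hap
      · exact pushOver_noncrossing_self h1 h2
      · exact pushOver_noncrossing hab hx hz hxy hzw hap (D.over_noncrossing j k _ he' _ hf')
          (D.over_noncrossing k j _ hf' _ he') h1 h2
    · exact (pushOver_noncrossing_new hab h1).1
    · exact (pushOver_noncrossing_new hab h2).2
    · unfold Crosses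
      omega

theorem overArcs_map (g : ℤ → ℤ) : ∀ l : List ℤ,
    overArcs (l.map g) = (overArcs l).map (fun e => (g e.1, g e.2))
  | [] => rfl
  | [_] => rfl
  | x :: y :: l => by simp [overArcs, overArcs_map g l]

/-- The mirror image of `D`: the upper line is reflected. -/
def mirror (D : VCD n) : VCD n where
  curve k := (D.curve k).map (fun z => -z)
  curve_ne_nil k := by simpa using D.curve_ne_nil k
  curve_nodup k := (D.curve_nodup k).map neg_injective
  curve_disjoint j k hjk z hj hk := by
    simp only [List.mem_map] at hj hk
    obtain ⟨x, hx, rfl⟩ := hj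
    obtain ⟨y, hy, hxy⟩ := hk
    obtain rfl : y = x := neg_injective hxy
    exact D.curve_disjoint j k hjk hx hy
  over_noncrossing j k e he f hf := by
    simp only [overArcs_map, List.mem_map] at he hf
    obtain ⟨e, he, rfl⟩ := he
    obtain ⟨f, hf, rfl⟩ := hf
    have := D.over_noncrossing k j f hf e he
    unfold Crosses at *
    dsimp only at *
    omega

theorem terminal_mirror (D : VCD n) (k : Fin n) : D.mirror.terminal k = -D.terminal k := by
  simp [terminal, mirror, List.getLast_map]

/-- The action of the braid generator `σ` on diagrams (indices from `0`): the terminal point `t i`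
travels above the upper line, over `t (i + 1)`, to the right of it. -/
def sigma (D : VCD n) (i : ℕ) (hi : i + 1 < n) : VCD n :=
  D.push (D.t ⟨i, by omega⟩) (D.t ⟨i + 1, hi⟩) (D.t.lt_iff_lt.2 (by simp))
    (D.exists_terminal_eq _)

/-- The action of the inverse of the braid generator `σ` on diagrams (indices from `0`): the
terminal point `t (i + 1)` travels above the upper line, over `t i`, to the left of it. -/
def sigmaInv (D : VCD n) (i : ℕ) (hi : i + 1 < n) : VCD n :=
  (D.mirror.push (-D.t ⟨i + 1, hi⟩) (-D.t ⟨i, by omega⟩)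
    (neg_lt_neg (D.t.lt_iff_lt.2 (by simp)))
    (by
      obtain ⟨k, hk⟩ := D.exists_terminal_eq ⟨i + 1, hi⟩
      exact ⟨k, by rw [terminal_mirror, hk]⟩)).mirror

/-! ### Equivalence of diagrams -/

/-- No point of `D` lies strictly between `x` and `y`. -/
def Adjacent (D : VCD n) (x y : ℤ) : Prop := ∀ z, D.IsPoint z → ¬ Encloses (x, y) z

/-- Relabelling: an order-preserving bijection of the points. -/
def Relabel (D E : VCD n) : Prop :=
  ∃ g : ℤ → ℤ, (∀ x y, D.IsPoint x → D.IsPoint y → x < y → g x < g y) ∧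
    ∀ k, E.curve k = (D.curve k).map g

/-- A `T`-move: a terminal arc `(x, y)` with adjacent ends is retracted by deleting `y`. -/
def TMove (D E : VCD n) : Prop :=
  ∃ k l x y, D.curve k = l ++ [x, y] ∧ D.Adjacent x y ∧
    E.curve = Function.update D.curve k (l ++ [x])

/-- A `B`-move: two adjacent points `x`, `y` that are joined by an arc which is neither a base arc
nor a terminal arc are deleted. (The point before `x` may be the base point, then `l = []`.) -/
def BMove (D E : VCD n) : Prop :=
  ∃ k l x y z r, D.curve k = l ++ x :: y :: z :: r ∧ D.Adjacent x y ∧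
    E.curve = Function.update D.curve k (l ++ z :: r)

/-- Equivalence of virtual curve diagrams: generated by relabellings, `T`-moves, `B`-moves. -/
def setoid (n : ℕ) : Setoid (VCD n) :=
  Relation.EqvGen.setoid (fun D E : VCD n => Relabel D E ∨ TMove D E ∨ BMove D E)

/-- `D ∼ E`. -/
def Equivalent (D E : VCD n) : Prop := (setoid n).r D E

/-- The number of upper points. (The number of all points is `D.size + n`.) -/
def size (D : VCD n) : ℕ := ∑ k, (D.curve k).length

/-- `D` has the least number of points in its equivalence class. -/
def Simplified (D : VCD n) : Prop := ∀ E, Equivalent D E → D.size ≤ E.size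

/-- Every diagram has a simplified representative. -/
theorem exists_simplified (D : VCD n) : ∃ E, Equivalent D E ∧ Simplified E := by
  classical
  have hex : ∃ m, ∃ E, Equivalent D E ∧ E.size = m := ⟨_, D, (setoid n).refl D, rfl⟩
  obtain ⟨E, hE, hm⟩ := Nat.find_spec hex
  refine ⟨E, hE, fun F hF => ?_⟩
  rw [hm]
  exact Nat.find_min' hex ⟨F, (setoid n).trans hE hF, rfl⟩

/-! ### Terminal over arcs and reductions -/

/-- `D` has a terminal over arc of type `(i, j)`, for consecutive indices `i`, `j` in either order:
a curve of `D` whose terminal arc is an over arc, ends at `t j` and encloses `t i`. -/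
def HasTerminalOverArc (D : VCD n) (i j : Fin n) : Prop :=
  ∃ k x, (x, D.terminal k) ∈ overArcs (D.curve k) ∧ D.terminal k = D.t j ∧
    Encloses (x, D.terminal k) (D.t i)

/-- The reduction relation `X → Y` on equivalence classes: for a simplified diagram `D`, reduce
`D → σ_i⁻¹ · D` if `D` has a terminal over arc of type `(i, i + 1)`, and `D → σ_i · D` if `D` has a
terminal over arc of type `(i + 1, i)`. -/
def Reduces (X Y : Quotient (setoid n)) : Prop :=
  ∃ (D : VCD n) (i : ℕ) (hi : i + 1 < n), D.Simplified ∧ X = Quotient.mk (setoid n) D ∧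
    ((D.HasTerminalOverArc ⟨i, by omega⟩ ⟨i + 1, hi⟩ ∧
        Y = Quotient.mk (setoid n) (D.sigmaInv i hi)) ∨
      (D.HasTerminalOverArc ⟨i + 1, hi⟩ ⟨i, by omega⟩ ∧
        Y = Quotient.mk (setoid n) (D.sigma i hi)))

end VCD

end VirtualBraid

/-!
# Pushing a puncture of a simplified virtual curve diagram

The equivalence of diagrams is governed by a confluent rewriting system. Its steps (`VCD.Step`)
contract a non-base arc with adjacent ends; the contraction of a terminal arc keeps the label of
the terminal point, so that no step changes the set of terminal points. Steps commute up to
relabelling (`Step.diamond`), and they decrease the number of points; hence simplified diagrams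
are irreducible, and equivalent irreducible diagrams are relabellings of each other
(`Irreducible.relabel`). To find the type of a terminal over arc of the simplified representative
of a class, it is therefore enough to exhibit any irreducible representative.

That `σ` acts on classes is proved through the *uniform* push (`VCD.spread`), which pulls along
the end `x` of an over arc for every `x` in `(a, b]`, whether or not the other end lies in `(a,
b]` too. It differs from the push by superfluous turning points (`equivalent_spread_push`), and it
acts on the ends of the over arcs separately, so that it is compatible with steps (`Step.spread`)
and with relabellings (`Relabel.spread`). Moreover, the landing place of the puncture may be moved
to the right as long as no terminal point is passed (`equivalent_push_of_le`). This is also how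
`σ⁻¹` and `σ` are seen to be inverse to each other: after a push from `a`, pushing back to the
place immediately to the right of `a` meets no over arc, and the turning points that remain are
nested around the puncture (`equivalent_push_back`).

For the first assertion, let `D` be irreducible, `a = t i`, `b = t (i + 1)`. Every over arc of `D`
encloses a terminal point (`Irreducible.separated`). An over arc `(u, v)` with `a < u < b < v`
that encloses no terminal point but `b` is called tight; the puncture is landed at the last end `c
≥ b` of a tight arc that is not a terminal point (`VCD.Landing`). Then, after at most one
contraction, all over arcs of the pushed diagram enclose terminal points again
(`Landing.exists_tidy`), so that only under arcs can be contracted. The under arcs are the new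
ones, which are separated by the puncture, and the shifted under arcs of `D`. If `a` is not the
end of an over arc of `D`, then it is still a point of the pushed diagram, which is irreducible
and ends with the over arc from `a` to the new position of the puncture (`Tidy.irreducible`).
Otherwise `D` has a terminal over arc `(x, a)`. As it is not of type `(i + 1, i)`, and encloses a
terminal point, `x < c₀ < a` for the terminal point `c₀` before `a`. Now the under arcs that
straddle the former position of `a`, and only these, may be contracted one after another
(`Reduct.straddles`). The over arcs at their ends lead beyond `c₀` on the left and beyond `b` on
the right, so that merging them does not produce an over arc that encloses no terminal point
(`Reduct.step`), and the terminal over arc from `x` to the new position of the puncture survives.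
In both cases it encloses `b`.

The second assertion is the mirror image of the first one, and the third one follows, because the
two actions are inverse to each other.
-/

namespace VirtualBraid

/-! ### Over arcs and under arcs of a list of points -/

theorem overArcs_append : ∀ {l r : List ℤ}, Even l.length →
    overArcs (l ++ r) = overArcs l ++ overArcs r
  | [], _, _ => by simp [overArcs]
  | [x], _, h => by simp at h
  | x :: y :: l, r, h => by
      have h' : Even l.length := by simpa [Nat.even_add_one] using h
      simp [overArcs, overArcs_append h']

theorem mem_overArcs_iff {x y : ℤ} : ∀ {l : List ℤ}, (x, y) ∈ overArcs l ↔
    ∃ p s, l = p ++ x :: y :: s ∧ Even p.length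
  | [] => by simp [overArcs]
  | [z] => by
      simp only [overArcs, List.not_mem_nil, false_iff, not_exists, not_and]
      intro p s h
      have := congrArg List.length h
      simp at this
      omega
  | z :: w :: l => by
      simp only [overArcs, List.mem_cons, mem_overArcs_iff (l := l)]
      constructor
      · rintro (h | ⟨p, s, rfl, hp⟩)
        · simp only [Prod.mk.injEq] at h
          exact ⟨[], l, by simp [h.1, h.2], by simp⟩
        · exact ⟨z :: w :: p, s, by simp, by simpa [Nat.even_add_one] using hp⟩
      · rintro ⟨p, s, h, hp⟩
        match p, h, hp with
        | [], h, _ =>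
          simp only [List.nil_append, List.cons.injEq] at h
          exact Or.inl (by simp [h.1, h.2.1])
        | [_], _, hp => simp at hp
        | z' :: w' :: p, h, hp =>
          simp only [List.cons_append, List.cons.injEq] at h
          exact Or.inr ⟨p, s, h.2.2, by simpa [Nat.even_add_one] using hp⟩

/-- The under arcs `(a₂, a₃), (a₄, a₅), …` of a curve whose upper points are `a₁, a₂, …, a_r`. -/
def underArcs (l : List ℤ) : List (ℤ × ℤ) := overArcs l.tail

theorem mem_underArcs_iff {x y : ℤ} {l : List ℤ} : (x, y) ∈ underArcs l ↔
    ∃ p s, l = p ++ x :: y :: s ∧ Odd p.length := by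
  unfold underArcs
  rw [mem_overArcs_iff]
  constructor
  · rintro ⟨p, s, h, hp⟩
    cases l with
    | nil => simp at h
    | cons z l => exact ⟨z :: p, s, by simpa using h, by simpa using hp.add_one⟩
  · rintro ⟨p, s, rfl, hp⟩
    cases p with
    | nil => simp at hp
    | cons z p => exact ⟨p, s, by simp, by simpa [Nat.odd_add_one] using hp⟩

theorem mem_of_mem_underArcs {e : ℤ × ℤ} {l : List ℤ} (h : e ∈ underArcs l) :
    e.1 ∈ l ∧ e.2 ∈ l :=
  ⟨List.mem_of_mem_tail (mem_of_mem_overArcs h).1, List.mem_of_mem_tail (mem_of_mem_overArcs h).2⟩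

/-- A point that is not an end of an over arc is the terminal point of a curve with an odd
number of upper points. -/
theorem exists_overArc_or_eq_getLast {z : ℤ} : ∀ {l : List ℤ}, z ∈ l →
    (∃ e ∈ overArcs l, z = e.1 ∨ z = e.2) ∨ (∃ p, l = p ++ [z] ∧ Even p.length)
  | [], h => by simp at h
  | [x], h => Or.inr ⟨[], by simp at h; simp [h], by simp⟩
  | x :: y :: l, h => by
      simp only [List.mem_cons] at h
      rcases h with rfl | rfl | h
      · exact Or.inl ⟨(z, y), by simp [overArcs], by simp⟩
      · exact Or.inl ⟨(x, z), by simp [overArcs], by simp⟩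
      · rcases exists_overArc_or_eq_getLast h with ⟨e, he, hz⟩ | ⟨p, rfl, hp⟩
        · exact Or.inl ⟨e, by simp [overArcs, he], hz⟩
        · exact Or.inr ⟨x :: y :: p, by simp, by simpa [Nat.even_add_one] using hp⟩

/-- In a list without repetitions, a decomposition is determined by the point where it is cut. -/
theorem append_cons_inj {z : ℤ} {l l' r r' : List ℤ} (hn : (l ++ z :: r).Nodup)
    (h : l ++ z :: r = l' ++ z :: r') : l = l' ∧ r = r' := by
  induction l generalizing l' with
  | nil =>
    cases l' with
    | nil => simpa using h
    | cons w l' =>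
      simp only [List.nil_append, List.cons_append, List.cons.injEq] at h
      obtain ⟨rfl, rfl⟩ := h
      simp at hn
  | cons w l ih =>
    cases l' with
    | nil =>
      simp only [List.nil_append, List.cons_append, List.cons.injEq] at h
      obtain ⟨rfl, rfl⟩ := h
      simp at hn
    | cons w' l' =>
      simp only [List.cons_append, List.cons.injEq] at h
      obtain ⟨rfl, h⟩ := h
      have := ih (by simp at hn ⊢; tauto) h
      simp [this.1, this.2]

/-- A curve `l ++ x :: y :: r` after the removal of the arc `(x, y)`: both ends are deleted if the
arc is not terminal; if it is, only `x` is deleted, so that the terminal point keeps its label. -/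
def contract (y : ℤ) (l r : List ℤ) : List ℤ := if r = [] then l ++ [y] else l ++ r

theorem contract_nil (y : ℤ) (l : List ℤ) : contract y l [] = l ++ [y] := by simp [contract]

theorem contract_cons (y z : ℤ) (l r : List ℤ) : contract y l (z :: r) = l ++ z :: r := by
  simp [contract]

theorem contract_ne_nil (y : ℤ) (l r : List ℤ) : contract y l r ≠ [] := by
  unfold contract; split_ifs <;> simp_all

theorem contract_sublist (x y : ℤ) (l r : List ℤ) :
    (contract y l r).Sublist (l ++ x :: y :: r) := by
  unfold contract
  split_ifs with h
  · subst h
    exact List.Sublist.append_left (by simp) _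
  · exact List.Sublist.append_left ((List.sublist_cons_self _ _).trans (List.sublist_cons_self _ _)) _

theorem getLast_contract (x y : ℤ) (l r : List ℤ) :
    (contract y l r).getLast (contract_ne_nil y l r) =
      (l ++ x :: y :: r).getLast (by simp) := by
  cases r with
  | nil => simp [contract]
  | cons z r => simp [contract]

theorem overArcs_contract {x y : ℤ} {l r : List ℤ} {e : ℤ × ℤ}
    (he : e ∈ overArcs (contract y l r)) :
    e ∈ overArcs (l ++ x :: y :: r) ∨ (Odd l.length ∧ (e.1, x) ∈ overArcs (l ++ x :: y :: r) ∧
      (r = [] ∧ e.2 = y ∨ (y, e.2) ∈ overArcs (l ++ x :: y :: r))) := by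
  rcases Nat.even_or_odd l.length with hl | hl
  · left
    rw [overArcs_append hl]
    cases r with
    | nil => rw [contract_nil, overArcs_append hl] at he; simp [overArcs] at he ⊢; tauto
    | cons z r => rw [contract_cons, overArcs_append hl] at he; simp [overArcs] at he ⊢; tauto
  · obtain ⟨l, s, rfl⟩ : ∃ l' s, l = l' ++ [s] := by
      rcases List.eq_nil_or_concat l with rfl | ⟨l', s, rfl⟩
      · simp at hl
      · exact ⟨l', s, by simp⟩
    have hl' : Even l.length := by simpa [Nat.odd_add_one] using hl
    cases r with
    | nil =>
      rw [contract_nil] at he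
      simp only [List.append_assoc, List.cons_append, List.nil_append] at he ⊢
      rw [overArcs_append hl'] at he ⊢
      simp only [overArcs, List.mem_append, List.mem_cons, List.not_mem_nil, or_false] at he ⊢
      rcases he with he | rfl
      · tauto
      · right; simp; simpa using hl
    | cons z r =>
      rw [contract_cons] at he
      simp only [List.append_assoc, List.cons_append, List.nil_append] at he ⊢
      rw [overArcs_append hl'] at he ⊢
      simp only [overArcs, List.mem_append, List.mem_cons] at he ⊢
      rcases he with he | rfl | he
      · tauto
      · right; simp; simpa using hl
      · tauto

theorem underArcs_contract {x y : ℤ} {l r : List ℤ} {e : ℤ × ℤ} (hl : Odd l.length)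
    (he : e ∈ underArcs (contract y l r)) : e ∈ underArcs (l ++ x :: y :: r) := by
  cases l with
  | nil => simp at hl
  | cons w l =>
    have hl' : Even l.length := by simpa [Nat.odd_add_one] using hl
    unfold underArcs contract at *
    split_ifs at he <;> simp only [List.cons_append, List.tail_cons] at he ⊢ <;>
      rw [overArcs_append hl'] at he ⊢
    · simp [overArcs] at he ⊢; tauto
    · simp [overArcs] at he ⊢; tauto

/-- The curve after the removal of an arc, written as the sublist of the remaining points. -/
theorem contract_eq_filter {x y : ℤ} {l r : List ℤ} (hn : (l ++ x :: y :: r).Nodup) :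
    contract y l r = (l ++ x :: y :: r).filter
      (fun z => (z ≠ x ∧ z ≠ y) ∨ z = (l ++ x :: y :: r).getLast (by simp)) := by
  have hl : ∀ z ∈ l, z ≠ x ∧ z ≠ y := by
    rintro z hz
    constructor <;> rintro rfl <;> simp [List.nodup_append] at hn <;> grind
  have hr : ∀ z ∈ r, z ≠ x ∧ z ≠ y := by
    rintro z hz
    constructor <;> rintro rfl <;> simp [List.nodup_append] at hn <;> grind
  have hxy : x ≠ y := by rintro rfl; simp [List.nodup_append] at hn
  rw [List.filter_append, List.filter_eq_self.2 (fun z hz => by simp [hl z hz])]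
  cases r with
  | nil =>
    simp [contract, hxy]
  | cons z r =>
    rw [contract_cons]
    have hx : x ≠ (l ++ x :: y :: z :: r).getLast (by simp) := by
      have := (hr _ (List.getLast_mem (l := z :: r) (by simp))).1.symm
      simpa using this
    have hy : y ≠ (l ++ x :: y :: z :: r).getLast (by simp) := by
      have := (hr _ (List.getLast_mem (l := z :: r) (by simp))).2.symm
      simpa using this
    rw [List.filter_cons_of_neg (by simpa using hx), List.filter_cons_of_neg (by simpa using hy),
      List.filter_eq_self.2 (fun w hw => by simp [hr w hw])]

namespace VCD

variable {n : ℕ}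

/-! ### Relabelling -/

theorem exists_relabel (D : VCD n) (g : ℤ → ℤ)
    (hg : ∀ x y, D.IsPoint x → D.IsPoint y → x < y → g x < g y) :
    ∃ E : VCD n, ∀ k, E.curve k = (D.curve k).map g := by
  have inj : ∀ x y, D.IsPoint x → D.IsPoint y → g x = g y → x = y := by
    intro x y hx hy h
    rcases lt_trichotomy x y with c | c | c
    · exact absurd h (hg x y hx hy c).ne
    · exact c
    · exact absurd h (hg y x hy hx c).ne'
  have mono : ∀ x y, D.IsPoint x → D.IsPoint y → (g x < g y ↔ x < y) := by
    intro x y hx hy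
    refine ⟨fun h => ?_, hg x y hx hy⟩
    by_contra hc
    rcases (not_lt.1 hc).lt_or_eq with c | c
    · exact absurd (hg y x hy hx c) (by omega)
    · subst c; omega
  refine ⟨⟨fun k => (D.curve k).map g, fun k => by simpa using D.curve_ne_nil k, fun k => ?_,
    fun j k hjk z hj hk => ?_, fun j k e he f hf => ?_⟩, fun k => rfl⟩
  · exact (D.curve_nodup k).map_on (fun x hx y hy h => inj x y ⟨k, hx⟩ ⟨k, hy⟩ h)
  · simp only [List.mem_map] at hj hk
    obtain ⟨x, hx, rfl⟩ := hj
    obtain ⟨y, hy, hxy⟩ := hk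
    obtain rfl := inj y x ⟨k, hy⟩ ⟨j, hx⟩ hxy
    exact D.curve_disjoint j k hjk hx hy
  · simp only [overArcs_map, List.mem_map] at he hf
    obtain ⟨e, he, rfl⟩ := he
    obtain ⟨f, hf, rfl⟩ := hf
    have := D.over_noncrossing j k e he f hf
    obtain ⟨h1, h2⟩ := mem_of_mem_overArcs he
    obtain ⟨h3, h4⟩ := mem_of_mem_overArcs hf
    have hmin : ∀ u v, D.IsPoint u → D.IsPoint v →
        (min (g u) (g v) = g (min u v) ∧ max (g u) (g v) = g (max u v)) ∧
          D.IsPoint (min u v) ∧ D.IsPoint (max u v) := by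
      intro u v hu hv
      rcases lt_trichotomy u v with c | rfl | c
      · have := hg u v hu hv c
        rw [min_eq_left c.le, max_eq_right c.le, min_eq_left this.le, max_eq_right this.le]
        exact ⟨⟨rfl, rfl⟩, hu, hv⟩
      · simp [hu]
      · have := hg v u hv hu c
        rw [min_eq_right c.le, max_eq_left c.le, min_eq_right this.le, max_eq_left this.le]
        exact ⟨⟨rfl, rfl⟩, hv, hu⟩
    obtain ⟨⟨m1, m2⟩, p1, p2⟩ := hmin _ _ ⟨j, h1⟩ ⟨j, h2⟩
    obtain ⟨⟨m3, m4⟩, p3, p4⟩ := hmin _ _ ⟨k, h3⟩ ⟨k, h4⟩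
    unfold Crosses at *
    dsimp only
    rw [m1, m2, m3, m4, mono _ _ p1 p3, mono _ _ p3 p2, mono _ _ p2 p4]
    exact this

theorem Relabel.refl (D : VCD n) : Relabel D D := ⟨id, fun _ _ _ _ h => h, by simp⟩

theorem Relabel.symm {D E : VCD n} (h : Relabel D E) : Relabel E D := by
  obtain ⟨g, hg, hE⟩ := h
  have inj : Set.InjOn g {x | D.IsPoint x} := by
    intro x hx y hy h
    rcases lt_trichotomy x y with c | c | c
    · exact absurd h (hg x y hx hy c).ne
    · exact c
    · exact absurd h (hg y x hy hx c).ne'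
  have inv := inj.leftInvOn_invFunOn
  refine ⟨Function.invFunOn g {x | D.IsPoint x}, ?_, fun k => ?_⟩
  · rintro x y ⟨j, hx⟩ ⟨k, hy⟩ hxy
    rw [hE, List.mem_map] at hx hy
    obtain ⟨x, hx, rfl⟩ := hx
    obtain ⟨y, hy, rfl⟩ := hy
    rw [inv ⟨j, hx⟩, inv ⟨k, hy⟩]
    by_contra hc
    rcases (not_lt.1 hc).lt_or_eq with c | c
    · exact absurd (hg y x ⟨k, hy⟩ ⟨j, hx⟩ c) (by omega)
    · subst c; omega
  · rw [hE, List.map_map]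
    conv_lhs => rw [← List.map_id (D.curve k)]
    refine List.map_congr_left fun z hz => ?_
    exact (inv (show z ∈ {x | D.IsPoint x} from ⟨k, hz⟩)).symm

theorem Relabel.trans {D E F : VCD n} (h : Relabel D E) (h' : Relabel E F) : Relabel D F := by
  obtain ⟨g, hg, hE⟩ := h
  obtain ⟨g', hg', hF⟩ := h'
  refine ⟨g' ∘ g, ?_, fun k => by rw [hF, hE, List.map_map]⟩
  rintro x y ⟨j, hx⟩ ⟨k, hy⟩ hxy
  exact hg' _ _ ⟨j, by rw [hE]; exact List.mem_map_of_mem hx⟩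
    ⟨k, by rw [hE]; exact List.mem_map_of_mem hy⟩ (hg x y ⟨j, hx⟩ ⟨k, hy⟩ hxy)

theorem Relabel.terminal {D E : VCD n} {g : ℤ → ℤ}
    (h : ∀ k, E.curve k = (D.curve k).map g) (k : Fin n) : E.terminal k = g (D.terminal k) := by
  have : E.curve k ≠ [] := E.curve_ne_nil k
  unfold VCD.terminal
  simp only [h k]
  rw [List.getLast_map]

theorem Relabel.equivalent {D E : VCD n} (h : Relabel D E) : Equivalent D E :=
  Relation.EqvGen.rel _ _ (Or.inl h)

theorem Equivalent.refl (D : VCD n) : Equivalent D D := (setoid n).refl D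

theorem Equivalent.symm {D E : VCD n} (h : Equivalent D E) : Equivalent E D := (setoid n).symm h

theorem Equivalent.trans {D E F : VCD n} (h : Equivalent D E) (h' : Equivalent E F) :
    Equivalent D F := (setoid n).trans h h'

/-! ### Contracting an arc with adjacent ends -/

theorem Adjacent.symm {D : VCD n} {x y : ℤ} (h : D.Adjacent x y) : D.Adjacent y x := by
  intro z hz
  have := h z hz
  unfold Encloses at *
  tauto

/-- `E` arises from `D` by contracting the non-base arc `(x, y)` of the `k`-th curve, whose ends
are adjacent. This is a `B`-move if the arc is not terminal, and a `T`-move followed by a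
relabelling if it is; with this choice of labels the terminal points are the same in `D` and `E`. -/
def StepAt (D E : VCD n) (k : Fin n) (x y : ℤ) (l r : List ℤ) : Prop :=
  D.curve k = l ++ x :: y :: r ∧ D.Adjacent x y ∧
    E.curve = Function.update D.curve k (contract y l r)

/-- `E` arises from `D` by contracting an arc. -/
def Step (D E : VCD n) : Prop := ∃ k x y l r, StepAt D E k x y l r

/-- Merging the arcs `(s, x)` and `(y, u)` along adjacent `x`, `y` creates no crossing. -/
theorem not_crosses_merge {s x y u : ℤ} {f : ℤ × ℤ} (h1 : ¬ Crosses (s, x) f)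
    (h1' : ¬ Crosses f (s, x)) (h2 : ¬ Crosses (y, u) f) (h2' : ¬ Crosses f (y, u))
    (hx1 : f.1 ≠ x) (hx2 : f.2 ≠ x) (hy1 : f.1 ≠ y) (hy2 : f.2 ≠ y)
    (e1 : ¬ Encloses (x, y) f.1) (e2 : ¬ Encloses (x, y) f.2) :
    ¬ Crosses (s, u) f ∧ ¬ Crosses f (s, u) := by
  obtain ⟨p, q⟩ := f
  unfold Crosses Encloses at *
  dsimp only at *
  rcases le_total p q with c | c <;>
    simp only [min_eq_left c, max_eq_right c, min_eq_right c, max_eq_left c] at * <;> omega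

theorem not_crosses_move {s x y : ℤ} {f : ℤ × ℤ} (h1 : ¬ Crosses (s, x) f)
    (h1' : ¬ Crosses f (s, x)) (hx1 : f.1 ≠ x) (hx2 : f.2 ≠ x)
    (e1 : ¬ Encloses (x, y) f.1) (e2 : ¬ Encloses (x, y) f.2) :
    ¬ Crosses (s, y) f ∧ ¬ Crosses f (s, y) := by
  obtain ⟨p, q⟩ := f
  unfold Crosses Encloses at *
  dsimp only at *
  rcases le_total p q with c | c <;>
    simp only [min_eq_left c, max_eq_right c, min_eq_right c, max_eq_left c] at * <;> omega

theorem mem_contract {D : VCD n} {k : Fin n} {x y : ℤ} {l r : List ℤ}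
    (h : D.curve k = l ++ x :: y :: r) {z : ℤ} (hz : z ∈ contract y l r) :
    z ∈ D.curve k ∧ z ≠ x ∧ (z ≠ y ∨ r = []) := by
  have hn := D.curve_nodup k
  have hx : x ≠ (l ++ x :: y :: r).getLast (by simp) := by
    have : x ∉ y :: r := by rw [h] at hn; simp [List.nodup_append] at hn ⊢; tauto
    intro hc
    apply this
    rw [hc]
    simp
  have hy : r ≠ [] → y ≠ (l ++ x :: y :: r).getLast (by simp) := by
    intro hr
    have : y ∉ r := by rw [h] at hn; simp [List.nodup_append] at hn ⊢; tauto
    intro hc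
    apply this
    rw [hc]
    simp [hr]
  refine ⟨h ▸ (contract_sublist x y l r).subset hz, ?_⟩
  rw [contract_eq_filter (x := x) (h ▸ hn), List.mem_filter] at hz
  have h2 := hz.2
  simp only [decide_eq_true_eq] at h2
  constructor
  · rintro rfl
    tauto
  · by_cases hr : r = []
    · exact Or.inr hr
    · left
      rintro rfl
      have := hy hr
      tauto

theorem exists_stepAt {D : VCD n} {k : Fin n} {x y : ℤ} {l r : List ℤ}
    (h : D.curve k = l ++ x :: y :: r) (ha : D.Adjacent x y) : ∃ E, StepAt D E k x y l r := by
  have hsub : ∀ j, (Function.update D.curve k (contract y l r) j).Sublist (D.curve j) := by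
    intro j
    by_cases hj : j = k
    · subst hj; rw [Function.update_self, h]; exact contract_sublist x y l r
    · rw [Function.update_of_ne hj]
  have hmem : ∀ j, ∀ z ∈ Function.update D.curve k (contract y l r) j,
      z ≠ x ∧ (z ≠ y ∨ r = []) := by
    intro j z hz
    by_cases hj : j = k
    · subst hj; rw [Function.update_self] at hz; exact (mem_contract h hz).2
    · rw [Function.update_of_ne hj] at hz
      constructor
      · rintro rfl; exact D.curve_disjoint j k hj hz (by simp [h])
      · left; rintro rfl; exact D.curve_disjoint j k hj hz (by simp [h])
  have harc : ∀ j, ∀ e ∈ overArcs (Function.update D.curve k (contract y l r) j),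
      e ∈ overArcs (D.curve j) ∨ ((e.1, x) ∈ overArcs (D.curve k) ∧
      (r = [] ∧ e.2 = y ∨ (y, e.2) ∈ overArcs (D.curve k))) := by
    intro j e he
    by_cases hj : j = k
    · subst hj
      rw [Function.update_self] at he
      rw [h]
      rcases overArcs_contract (x := x) he with h1 | ⟨_, h2, h3⟩
      · exact Or.inl h1
      · exact Or.inr ⟨h2, h3⟩
    · rw [Function.update_of_ne hj] at he; exact Or.inl he
  have hold : ∀ i j, ∀ e ∈ overArcs (Function.update D.curve k (contract y l r) i),
      e ∈ overArcs (D.curve i) →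
      ∀ f ∈ overArcs (Function.update D.curve k (contract y l r) j),
      ¬ Crosses e f ∧ ¬ Crosses f e := by
    intro i j e he heD f hf
    rcases harc j f hf with hf' | ⟨h1, h2⟩
    · exact ⟨D.over_noncrossing i j e heD f hf', D.over_noncrossing j i f hf' e heD⟩
    · have m := mem_of_mem_overArcs he
      have mD := mem_of_mem_overArcs heD
      have a1 := hmem i _ m.1
      have a2 := hmem i _ m.2
      have n1 := ha _ ⟨i, mD.1⟩
      have n2 := ha _ ⟨i, mD.2⟩
      have c1 := D.over_noncrossing k i _ h1 _ heD
      have c2 := D.over_noncrossing i k _ heD _ h1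
      rw [and_comm]
      rcases h2 with ⟨hr, h2⟩ | h2
      · have := not_crosses_move c1 c2 a1.1 a2.1 n1 n2
        rw [← h2] at this
        exact this
      · have hr : r ≠ [] := by
          rintro rfl
          have hn := D.curve_nodup k
          rw [h] at h2 hn
          obtain ⟨p, s, hps, _⟩ := mem_overArcs_iff.1 h2
          have := append_cons_inj (l := l ++ [x]) (z := y) (r := []) (l' := p) (r' := f.2 :: s)
            (by simpa using hn) (by simpa using hps)
          simp at this
        exact not_crosses_merge c1 c2 (D.over_noncrossing k i _ h2 _ heD)
          (D.over_noncrossing i k _ heD _ h2) a1.1 a2.1 (a1.2.resolve_right hr)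
          (a2.2.resolve_right hr) n1 n2
  have hmerge : ∀ e f : ℤ × ℤ, ((e.1, x) ∈ overArcs (D.curve k) ∧
      (r = [] ∧ e.2 = y ∨ (y, e.2) ∈ overArcs (D.curve k))) → ((f.1, x) ∈ overArcs (D.curve k) ∧
      (r = [] ∧ f.2 = y ∨ (y, f.2) ∈ overArcs (D.curve k))) → ¬ Crosses e f := by
    rintro e f ⟨h1, _⟩ ⟨h2, _⟩
    rcases overArcs_apart (D.curve_nodup k) h1 h2 with h | h
    · have : e.1 = f.1 := (Prod.mk.inj h).1
      unfold Crosses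
      omega
    · exact absurd rfl h.2.2.2
  refine ⟨⟨Function.update D.curve k (contract y l r), fun j => ?_, fun j => ?_,
    fun i j hij z hi hj => ?_, fun i j e he f hf => ?_⟩, h, ha, rfl⟩
  · by_cases hj : j = k
    · subst hj; rw [Function.update_self]; exact contract_ne_nil _ _ _
    · rw [Function.update_of_ne hj]; exact D.curve_ne_nil j
  · exact (D.curve_nodup j).sublist (hsub j)
  · exact D.curve_disjoint i j hij ((hsub i).subset hi) ((hsub j).subset hj)
  · rcases harc i e he with h1 | h1
    · exact (hold i j e he h1 f hf).1
    · rcases harc j f hf with h2 | h2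
      · exact (hold j i f hf h2 e he).2
      · exact hmerge e f h1 h2

section StepAt

variable {D E : VCD n} {k : Fin n} {x y : ℤ} {l r : List ℤ}

theorem StepAt.step (h : StepAt D E k x y l r) : Step D E := ⟨k, x, y, l, r, h⟩

theorem StepAt.curve_self (h : StepAt D E k x y l r) : E.curve k = contract y l r := by
  rw [h.2.2, Function.update_self]

theorem StepAt.curve_of_ne (h : StepAt D E k x y l r) {j : Fin n} (hj : j ≠ k) :
    E.curve j = D.curve j := by
  rw [h.2.2, Function.update_of_ne hj]

theorem StepAt.mem (h : StepAt D E k x y l r) {j : Fin n} {z : ℤ} (hz : z ∈ E.curve j) :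
    z ∈ D.curve j := by
  by_cases hj : j = k
  · subst hj; rw [h.curve_self] at hz; exact (mem_contract h.1 hz).1
  · rwa [h.curve_of_ne hj] at hz

theorem StepAt.terminal (h : StepAt D E k x y l r) (j : Fin n) : E.terminal j = D.terminal j := by
  unfold VCD.terminal
  by_cases hj : j = k
  · subst hj
    simp only [h.curve_self, h.1]
    exact getLast_contract x y l r
  · simp only [h.curve_of_ne hj]

theorem StepAt.curve_eq_filter (h : StepAt D E k x y l r) (j : Fin n) :
    E.curve j = (D.curve j).filter (fun z => (z ≠ x ∧ z ≠ y) ∨ z = D.terminal k) := by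
  by_cases hj : j = k
  · subst hj
    rw [h.curve_self, contract_eq_filter (x := x) (h.1 ▸ D.curve_nodup j)]
    simp only [VCD.terminal, h.1]
  · rw [h.curve_of_ne hj, eq_comm, List.filter_eq_self]
    intro z hz
    have : ∀ w ∈ D.curve k, z ≠ w := by
      rintro w hw rfl; exact D.curve_disjoint j k hj hz hw
    have h1 := this x (by simp [h.1])
    have h2 := this y (by simp [h.1])
    simp [h1, h2]

theorem StepAt.size_lt (h : StepAt D E k x y l r) : E.size < D.size := by
  unfold size
  refine Finset.sum_lt_sum (fun j _ => ?_) ⟨k, Finset.mem_univ _, ?_⟩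
  · rw [h.curve_eq_filter]; exact List.length_filter_le _ _
  · rw [h.curve_self, h.1]
    unfold contract
    split_ifs with hr
    · simp [hr]
    · simp

/-- The contraction of a terminal arc agrees with the corresponding `T`-move up to the position of
the terminal point. -/
theorem StepAt.exists_relabel_tMove (h : StepAt D E k x y l []) :
    ∃ g : ℤ → ℤ, (∀ z w, E.IsPoint z → E.IsPoint w → z < w → g z < g w) ∧
      ∀ j, Function.update D.curve k (l ++ [x]) j = (E.curve j).map g := by
  have hn := D.curve_nodup k
  rw [h.1] at hn
  have hx : ∀ j, x ∉ E.curve j := by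
    intro j hj
    by_cases hjk : j = k
    · subst hjk; rw [h.curve_self] at hj; exact (mem_contract h.1 hj).2.1 rfl
    · rw [h.curve_of_ne hjk] at hj
      exact D.curve_disjoint j k hjk hj (by simp [h.1])
  have hid : ∀ l' : List ℤ, y ∉ l' → l'.map (fun z => if z = y then x else z) = l' := by
    intro l' hy
    conv_rhs => rw [← List.map_id l']
    refine List.map_congr_left fun z hz => ?_
    have : z ≠ y := by rintro rfl; exact hy hz
    simp [this]
  refine ⟨fun z => if z = y then x else z, ?_, fun j => ?_⟩
  · rintro z w ⟨i, hz⟩ ⟨j, hw⟩ hzw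
    have az := h.2.1 z ⟨i, h.mem hz⟩
    have aw := h.2.1 w ⟨j, h.mem hw⟩
    have bz : z ≠ x := by rintro rfl; exact hx _ hz
    have bw : w ≠ x := by rintro rfl; exact hx _ hw
    unfold Encloses at az aw
    dsimp only at az aw ⊢
    split_ifs <;> omega
  · by_cases hjk : j = k
    · subst hjk
      rw [Function.update_self, h.curve_self, contract_nil, List.map_append,
        hid l (by simp [List.nodup_append] at hn; grind)]
      simp
    · rw [Function.update_of_ne hjk, h.curve_of_ne hjk,
        hid _ (fun hy => D.curve_disjoint j k hjk hy (by simp [h.1]))]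

theorem StepAt.equivalent (h : StepAt D E k x y l r) : Equivalent D E := by
  cases r with
  | nil =>
    obtain ⟨g, hg, hgE⟩ := h.exists_relabel_tMove
    obtain ⟨F, hF⟩ := E.exists_relabel g hg
    have hEF : Relabel E F := ⟨g, hg, hF⟩
    refine Equivalent.trans (E := F) (Relation.EqvGen.rel _ _ (Or.inr (Or.inl ?_)))
      hEF.symm.equivalent
    refine ⟨k, l, x, y, h.1, h.2.1, ?_⟩
    ext1 j
    rw [hgE, hF]
  | cons z r =>
    refine Relation.EqvGen.rel _ _ (Or.inr (Or.inr ⟨k, l, x, y, z, r, h.1, h.2.1, ?_⟩))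
    rw [h.2.2, contract_cons]

end StepAt

theorem Step.equivalent {D E : VCD n} (h : Step D E) : Equivalent D E := by
  obtain ⟨k, x, y, l, r, h⟩ := h
  exact h.equivalent

theorem Step.size_lt {D E : VCD n} (h : Step D E) : E.size < D.size := by
  obtain ⟨k, x, y, l, r, h⟩ := h
  exact h.size_lt

theorem BMove.step {D E : VCD n} (h : BMove D E) : Step D E := by
  obtain ⟨k, l, x, y, z, r, h1, h2, h3⟩ := h
  exact ⟨k, x, y, l, z :: r, h1, h2, by rw [h3, contract_cons]⟩

theorem TMove.exists_step_relabel {D E : VCD n} (h : TMove D E) :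
    ∃ F, Step D F ∧ Relabel F E := by
  obtain ⟨k, l, x, y, h1, h2, h3⟩ := h
  obtain ⟨F, hF⟩ := exists_stepAt h1 h2
  obtain ⟨g, hg, hgF⟩ := hF.exists_relabel_tMove
  exact ⟨F, hF.step, g, hg, fun j => by rw [h3, hgF]⟩

end VCD

namespace VCD

variable {n : ℕ}

/-! ### Confluence of contractions -/

theorem Adjacent.of_subset {D E : VCD n} {x y : ℤ} (h : D.Adjacent x y)
    (hE : ∀ z, E.IsPoint z → D.IsPoint z) : E.Adjacent x y := fun z hz => h z (hE z hz)

theorem StepAt.isPoint {D E : VCD n} {k : Fin n} {x y : ℤ} {l r : List ℤ}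
    (h : StepAt D E k x y l r) {z : ℤ} (hz : E.IsPoint z) : D.IsPoint z := by
  obtain ⟨j, hj⟩ := hz
  exact ⟨j, h.mem hj⟩

/-- An arc that survives a contraction can be contracted afterwards. -/
theorem StepAt.exists_stepAt_after {D E E' : VCD n} {k k' : Fin n} {x y x' y' : ℤ}
    {l r l' r' : List ℤ} (h : StepAt D E k x y l r) (h' : StepAt D E' k' x' y' l' r')
    (hx : x' ∈ E.curve k') (hy : y' ∈ E.curve k') :
    ∃ F, Step E F ∧ ∀ j, F.curve j = (D.curve j).filter
      (fun z => ((z ≠ x ∧ z ≠ y) ∨ z = D.terminal k) ∧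
        ((z ≠ x' ∧ z ≠ y') ∨ z = D.terminal k')) := by
  have hc := h.curve_eq_filter k'
  rw [hc, List.mem_filter] at hx hy
  rw [h'.1, List.filter_append, List.filter_cons, List.filter_cons, if_pos hx.2, if_pos hy.2] at hc
  obtain ⟨F, hF⟩ := exists_stepAt hc (h'.2.1.of_subset fun z hz => h.isPoint hz)
  refine ⟨F, hF.step, fun j => ?_⟩
  rw [hF.curve_eq_filter, h.curve_eq_filter, List.filter_filter, h.terminal]
  refine List.filter_congr fun z _ => ?_
  rw [← Bool.decide_and, decide_eq_decide, and_comm]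

/-- Two overlapping contractions `(x, y)` and `(y, u)`. -/
theorem StepAt.diamond_overlap {D E E' : VCD n} {k k' : Fin n} {x y u : ℤ} {l r l' r' : List ℤ}
    (h : StepAt D E k x y l r) (h' : StepAt D E' k' y u l' r') : Relabel E E' ∨ Step E' E := by
  obtain rfl : k = k' := D.eq_of_mem (x := y) (by simp [h.1]) (by simp [h'.1])
  have hn := D.curve_nodup k
  have h1 := h.1
  rw [h'.1] at hn
  have := append_cons_inj hn (l' := l ++ [x]) (r' := r) (by rw [← h'.1, h.1]; simp)
  obtain ⟨rfl, rfl⟩ := this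
  have hE := h.curve_self
  have hE' := h'.curve_self
  have hne : ∀ j, j ≠ k → E'.curve j = E.curve j := fun j hj => by
    rw [h.curve_of_ne hj, h'.curve_of_ne hj]
  have hadj : ∀ z, D.IsPoint z → z ≠ y → ¬ Encloses (x, u) z := by
    intro z hz hzy
    have a1 := h.2.1 z hz
    have a2 := h'.2.1 z hz
    unfold Encloses at *
    dsimp only at *
    omega
  rw [contract_cons] at hE
  cases r' with
  | nil =>
    right
    rw [contract_nil] at hE'
    refine ⟨k, x, u, l, [], by simpa using hE', fun z hz => hadj z (h'.isPoint hz) ?_, ?_⟩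
    · rintro rfl
      obtain ⟨j, hj⟩ := hz
      by_cases hjk : j = k
      · subst hjk
        rw [h'.curve_self] at hj
        exact (mem_contract h'.1 hj).2.1 rfl
      · rw [hne j hjk, h.curve_of_ne hjk] at hj
        exact D.curve_disjoint j k hjk hj (by simp [h1])
    · ext1 j
      by_cases hjk : j = k
      · subst hjk; rw [Function.update_self, contract_nil, hE]
      · rw [Function.update_of_ne hjk, hne j hjk]
  | cons w r' =>
    left
    rw [contract_cons] at hE'
    have hsub : ∀ z, E.IsPoint z → D.IsPoint z ∧ z ≠ y ∧ z ≠ x := by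
      intro z hz
      refine ⟨h.isPoint hz, ?_⟩
      obtain ⟨j, hj⟩ := hz
      by_cases hjk : j = k
      · subst hjk
        rw [h.curve_self] at hj
        have := mem_contract h.1 hj
        exact ⟨this.2.2.resolve_right (by simp), this.2.1⟩
      · rw [h.curve_of_ne hjk] at hj
        constructor <;> rintro rfl <;> exact D.curve_disjoint j k hjk hj (by simp [h1])
    have hid : ∀ l' : List ℤ, u ∉ l' → l'.map (fun z => if z = u then x else z) = l' := by
      intro l' hy
      conv_rhs => rw [← List.map_id l']
      refine List.map_congr_left fun z hz => ?_
      have : z ≠ u := by rintro rfl; exact hy hz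
      simp [this]
    refine ⟨fun z => if z = u then x else z, ?_, fun j => ?_⟩
    · intro z w hz hw hzw
      obtain ⟨pz, zy, zx⟩ := hsub z hz
      obtain ⟨pw, wy, wx⟩ := hsub w hw
      have az := hadj z pz zy
      have aw := hadj w pw wy
      unfold Encloses at az aw
      dsimp only at az aw ⊢
      split_ifs <;> omega
    · by_cases hjk : j = k
      · subst hjk
        rw [hE, hE', List.map_append, hid l, List.map_cons, hid]
        · simp
        · simp [List.nodup_append] at hn ⊢; tauto
        · simp [List.nodup_append] at hn; grind
      · rw [hne j hjk, hid]
        intro hy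
        rw [h.curve_of_ne hjk] at hy
        exact D.curve_disjoint j k hjk hy (by simp [h1])

theorem Step.diamond {D E E' : VCD n} (h : Step D E) (h' : Step D E') :
    Relabel E E' ∨ Step E E' ∨ Step E' E ∨ ∃ F, Step E F ∧ Step E' F := by
  obtain ⟨k, x, y, l, r, h⟩ := h
  obtain ⟨k', x', y', l', r', h'⟩ := h'
  by_cases hyx : y = x'
  · subst hyx
    rcases h.diamond_overlap h' with c | c
    · exact Or.inl c
    · exact Or.inr (Or.inr (Or.inl c))
  by_cases hxy : x = y'
  · subst hxy
    rcases h'.diamond_overlap h with c | c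
    · exact Or.inl c.symm
    · exact Or.inr (Or.inl c)
  have hn := D.curve_nodup k
  by_cases hxx : x = x'
  · subst hxx
    obtain rfl : k = k' := D.eq_of_mem (x := x) (by simp [h.1]) (by simp [h'.1])
    rw [h.1] at hn
    obtain ⟨rfl, h2⟩ := append_cons_inj hn (h.1.symm.trans h'.1)
    obtain ⟨rfl, rfl⟩ := List.cons.inj h2
    obtain rfl : E = E' := VCD.ext (h.2.2.trans h'.2.2.symm)
    exact Or.inl (Relabel.refl _)
  by_cases hyy : y = y'
  · subst hyy
    obtain rfl : k = k' := D.eq_of_mem (x := y) (by simp [h.1]) (by simp [h'.1])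
    have := append_cons_inj (l := l ++ [x]) (z := y) (r := r) (l' := l' ++ [x']) (r' := r')
      (by simpa [h.1] using hn) (by simpa using h.1.symm.trans h'.1)
    have := List.append_inj' this.1 rfl
    simp at this
    exact absurd this.2 hxx
  have mem : ∀ {E : VCD n} {k k' : Fin n} {x y : ℤ} {l r : List ℤ}, StepAt D E k x y l r →
      ∀ z ∈ D.curve k', z ≠ x → z ≠ y → z ∈ E.curve k' := by
    intro E k k' x y l r h z hz hx hy
    rw [h.curve_eq_filter, List.mem_filter]
    exact ⟨hz, by simp [hx, hy]⟩
  obtain ⟨F, hF, hF2⟩ := h.exists_stepAt_after h'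
    (mem h x' (by simp [h'.1]) (Ne.symm hxx) (Ne.symm hyx))
    (mem h y' (by simp [h'.1]) (Ne.symm hxy) (Ne.symm hyy))
  obtain ⟨F', hF', hF2'⟩ := h'.exists_stepAt_after h (mem h' x (by simp [h.1]) hxx hxy)
    (mem h' y (by simp [h.1]) hyx hyy)
  obtain rfl : F = F' := by
    apply VCD.ext
    ext1 j
    rw [hF2, hF2']
    refine List.filter_congr fun z _ => ?_
    rw [decide_eq_decide, and_comm]
  exact Or.inr (Or.inr (Or.inr ⟨F, hF, hF'⟩))

theorem Relabel.exists_step {D D' E : VCD n} (h : Relabel D D') (hE : Step D E) :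
    ∃ E', Step D' E' ∧ Relabel E E' := by
  obtain ⟨k, x, y, l, r, hE⟩ := hE
  obtain ⟨g, hg, hD'⟩ := h
  have hc : D'.curve k = l.map g ++ g x :: g y :: r.map g := by rw [hD', hE.1]; simp
  have hx : D.IsPoint x := ⟨k, by simp [hE.1]⟩
  have hy : D.IsPoint y := ⟨k, by simp [hE.1]⟩
  have ha : D'.Adjacent (g x) (g y) := by
    rintro z ⟨j, hz⟩ hc
    rw [hD', List.mem_map] at hz
    obtain ⟨z, hz, rfl⟩ := hz
    have hz : D.IsPoint z := ⟨j, hz⟩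
    have := hE.2.1 z hz
    have h1 := hg x z hx hz
    have h2 := hg z x hz hx
    have h3 := hg y z hy hz
    have h4 := hg z y hz hy
    unfold Encloses at *
    dsimp only at *
    have e1 : z = x → g z = g x := fun h => by rw [h]
    have e2 : z = y → g z = g y := fun h => by rw [h]
    omega
  obtain ⟨E', hE'⟩ := exists_stepAt hc ha
  refine ⟨E', hE'.step, g, fun z w hz hw => hg z w (hE.isPoint hz) (hE.isPoint hw), fun j => ?_⟩
  rw [hE'.2.2, hE.2.2]
  by_cases hjk : j = k
  · subst hjk
    simp only [Function.update_self, contract, List.map_eq_nil_iff]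
    split_ifs <;> simp
  · simp only [Function.update_of_ne hjk, hD']

/-- Diagrams up to relabelling. -/
def relabelSetoid (n : ℕ) : Setoid (VCD n) :=
  ⟨Relabel, ⟨Relabel.refl, Relabel.symm, Relabel.trans⟩⟩

/-- Contraction of an arc, for diagrams up to relabelling. -/
def QStep (X Y : Quotient (relabelSetoid n)) : Prop :=
  ∃ D E : VCD n, X = Quotient.mk _ D ∧ Y = Quotient.mk _ E ∧ Step D E

theorem qStep_mk {D : VCD n} {Y : Quotient (relabelSetoid n)}
    (h : QStep (Quotient.mk (relabelSetoid n) D) Y) :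
    ∃ E, Step D E ∧ Y = Quotient.mk _ E := by
  obtain ⟨D', E', h1, rfl, h2⟩ := h
  obtain ⟨E, hE, hE'⟩ := Relabel.exists_step (Relabel.symm (Quotient.exact h1)) h2
  exact ⟨E, hE, Quotient.sound hE'⟩

theorem qStep_diamond (X Y Z : Quotient (relabelSetoid n)) (h : QStep X Y) (h' : QStep X Z) :
    ∃ W, Relation.ReflGen QStep Y W ∧ Relation.ReflTransGen QStep Z W := by
  induction X using Quotient.inductionOn with
  | h D =>
  obtain ⟨E, hE, rfl⟩ := qStep_mk h
  obtain ⟨E', hE', rfl⟩ := qStep_mk h'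
  rcases hE.diamond hE' with c | c | c | ⟨F, c, c'⟩
  · have : (Quotient.mk (relabelSetoid n) E) = Quotient.mk _ E' := Quotient.sound c
    exact ⟨_, .refl, this ▸ .refl⟩
  · exact ⟨_, .single ⟨E, E', rfl, rfl, c⟩, .refl⟩
  · exact ⟨_, .refl, .single ⟨E', E, rfl, rfl, c⟩⟩
  · exact ⟨_, .single ⟨E, F, rfl, rfl, c⟩, .single ⟨E', F, rfl, rfl, c'⟩⟩

/-- Equivalent diagrams have a common reduct, up to relabelling (Church–Rosser). -/
theorem Equivalent.join {D E : VCD n} (h : Equivalent D E) :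
    Relation.Join (Relation.ReflTransGen QStep) (Quotient.mk (relabelSetoid n) D)
      (Quotient.mk (relabelSetoid n) E) := by
  have eqv := Relation.equivalence_join_reflTransGen (r := QStep (n := n)) qStep_diamond
  have of_step : ∀ {D E : VCD n}, Step D E → Relation.Join (Relation.ReflTransGen QStep)
      (Quotient.mk (relabelSetoid n) D) (Quotient.mk (relabelSetoid n) E) := fun {D E} h =>
    ⟨_, .single ⟨D, E, rfl, rfl, h⟩, .refl⟩
  induction h with
  | rel D E h =>
    rcases h with h | h | h
    · have : (Quotient.mk (relabelSetoid n) D) = Quotient.mk _ E := Quotient.sound h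
      rw [this]
      exact eqv.refl _
    · obtain ⟨F, hF, hFE⟩ := h.exists_step_relabel
      have : (Quotient.mk (relabelSetoid n) F) = Quotient.mk _ E := Quotient.sound hFE
      rw [← this]
      exact of_step hF
    · exact of_step h.step
  | refl D => exact eqv.refl _
  | symm D E _ ih => exact eqv.symm ih
  | trans D E F _ _ ih1 ih2 => exact eqv.trans ih1 ih2

/-- No arc can be contracted. -/
def Irreducible (D : VCD n) : Prop := ∀ E, ¬ Step D E

theorem Irreducible.eq_of_reflTransGen {D : VCD n} (h : D.Irreducible)
    {Y : Quotient (relabelSetoid n)}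
    (hY : Relation.ReflTransGen QStep (Quotient.mk (relabelSetoid n) D) Y) :
    Y = Quotient.mk _ D := by
  rcases Relation.ReflTransGen.cases_head hY with c | ⟨Z, c, _⟩
  · exact c.symm
  · obtain ⟨E, hE, _⟩ := qStep_mk c
    exact absurd hE (h E)

/-- Equivalent irreducible diagrams are the same up to relabelling. -/
theorem Irreducible.relabel {D E : VCD n} (hD : D.Irreducible) (hE : E.Irreducible)
    (h : Equivalent D E) : Relabel D E := by
  obtain ⟨Y, h1, h2⟩ := h.join
  exact Quotient.exact ((hD.eq_of_reflTransGen h1).symm.trans (hE.eq_of_reflTransGen h2))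

theorem exists_irreducible (D : VCD n) :
    ∃ E, Relation.ReflTransGen Step D E ∧ E.Irreducible := by
  induction h : D.size using Nat.strong_induction_on generalizing D with
  | _ m ih =>
    by_cases hD : D.Irreducible
    · exact ⟨D, .refl, hD⟩
    · unfold Irreducible at hD
      push Not at hD
      obtain ⟨E, hE⟩ := hD
      obtain ⟨F, hF, hF'⟩ := ih E.size (h ▸ hE.size_lt) E rfl
      exact ⟨F, .head hE hF, hF'⟩

theorem equivalent_of_reflTransGen {D E : VCD n} (h : Relation.ReflTransGen Step D E) :
    Equivalent D E := by
  induction h with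
  | refl => exact Equivalent.refl _
  | tail _ h ih => exact ih.trans h.equivalent

theorem Simplified.irreducible {D : VCD n} (h : D.Simplified) : D.Irreducible :=
  fun E hE => absurd (h E hE.equivalent) (not_le.2 hE.size_lt)

end VCD

namespace VCD

variable {n : ℕ}

/-! ### Terminal points and types of terminal over arcs -/

theorem terminal_eq_t (D : VCD n) (k : Fin n) : ∃ i, D.terminal k = D.t i := by
  have h : D.terminal k ∈ Set.range D.t := by
    rw [show Set.range D.t = (D.terminals : Set ℤ) from
      Finset.range_orderEmbOfFin _ D.card_terminals]
    simp [terminals]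
  obtain ⟨i, hi⟩ := h
  exact ⟨i, hi.symm⟩

theorem t_eq {D : VCD n} {f : Fin n → ℤ} (hf : StrictMono f)
    (h : ∀ i, ∃ k, D.terminal k = f i) (i : Fin n) : D.t i = f i := by
  have := Finset.orderEmbOfFin_unique D.card_terminals (f := f)
    (fun i => by
      obtain ⟨k, hk⟩ := h i
      rw [← hk]
      exact Finset.mem_image_of_mem _ (Finset.mem_univ _)) hf
  rw [this]
  rfl

theorem t_congr {D E : VCD n} (h : ∀ k, E.terminal k = D.terminal k) (i : Fin n) :
    E.t i = D.t i := by
  refine t_eq D.t.strictMono (fun j => ?_) i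
  obtain ⟨k, hk⟩ := D.exists_terminal_eq j
  exact ⟨k, by rw [h, hk]⟩

theorem isPoint_terminal (D : VCD n) (k : Fin n) : D.IsPoint (D.terminal k) :=
  ⟨k, D.terminal_mem k⟩

theorem isPoint_t (D : VCD n) (i : Fin n) : D.IsPoint (D.t i) := by
  obtain ⟨k, hk⟩ := D.exists_terminal_eq i
  exact hk ▸ D.isPoint_terminal k

theorem t_relabel {D E : VCD n} {g : ℤ → ℤ}
    (hg : ∀ x y, D.IsPoint x → D.IsPoint y → x < y → g x < g y)
    (h : ∀ k, E.curve k = (D.curve k).map g) (i : Fin n) : E.t i = g (D.t i) := by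
  refine t_eq (f := fun i => g (D.t i)) ?_ (fun j => ?_) i
  · intro i j hij
    exact hg _ _ (D.isPoint_t i) (D.isPoint_t j) (D.t.strictMono hij)
  · obtain ⟨k, hk⟩ := D.exists_terminal_eq j
    exact ⟨k, by rw [Relabel.terminal h, hk]⟩

theorem HasTerminalOverArc.relabel {D E : VCD n} {i j : Fin n} (h : D.HasTerminalOverArc i j)
    (hE : Relabel D E) : E.HasTerminalOverArc i j := by
  obtain ⟨k, x, h1, h2, h3⟩ := h
  obtain ⟨g, hg, hE⟩ := hE
  have ht := Relabel.terminal hE k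
  refine ⟨k, g x, ?_, ?_, ?_⟩
  · rw [ht, hE, overArcs_map]
    exact List.mem_map_of_mem (f := fun e : ℤ × ℤ => (g e.1, g e.2)) h1
  · rw [ht, h2, t_relabel hg hE]
  · rw [ht, t_relabel hg hE]
    have hx : D.IsPoint x := ⟨k, (mem_of_mem_overArcs h1).1⟩
    rcases h3 with h3 | h3
    · exact Or.inl ⟨hg _ _ hx (D.isPoint_t i) h3.1,
        hg _ _ (D.isPoint_t i) (D.isPoint_terminal k) h3.2⟩
    · exact Or.inr ⟨hg _ _ (D.isPoint_terminal k) (D.isPoint_t i) h3.1,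
        hg _ _ (D.isPoint_t i) hx h3.2⟩

/-! ### Contracting several arcs -/

theorem isPoint_update {D E : VCD n} {k : Fin n} {l : List ℤ}
    (hE : E.curve = Function.update D.curve k l) (hl : ∀ z ∈ l, z ∈ D.curve k) {z : ℤ}
    (hz : E.IsPoint z) : D.IsPoint z := by
  obtain ⟨j, hj⟩ := hz
  rw [hE] at hj
  by_cases hjk : j = k
  · subst hjk; rw [Function.update_self] at hj; exact ⟨j, hl z hj⟩
  · rw [Function.update_of_ne hjk] at hj; exact ⟨j, hj⟩

/-- A stretch of a curve that runs forth and back along adjacent points can be deleted. -/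
theorem exists_collapse : ∀ {D : VCD n} {k : Fin n} {xs ys l r : List ℤ},
    D.curve k = l ++ xs.reverse ++ ys ++ r → List.Forall₂ D.Adjacent xs ys → r ≠ [] →
    ∃ E : VCD n, Equivalent D E ∧ E.curve = Function.update D.curve k (l ++ r)
  | D, k, [], [], l, r, h, _, _ => ⟨D, Equivalent.refl D, by
      rw [Function.eq_update_iff]; simpa using h⟩
  | D, k, x :: xs, y :: ys, l, r, h, ha, hr => by
      obtain ⟨h1, h2⟩ := List.forall₂_cons.1 ha
      obtain ⟨E, hE⟩ := exists_stepAt (D := D) (k := k) (x := x) (y := y) (l := l ++ xs.reverse)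
        (r := ys ++ r) (by simpa using h) h1
      have hc := hE.curve_self
      rw [contract, if_neg (by simp [hr])] at hc
      obtain ⟨F, hF, hF'⟩ := exists_collapse (D := E) (k := k) (xs := xs) (ys := ys) (l := l)
        (r := r) (by simpa using hc)
        (h2.imp fun _ _ h => h.of_subset fun z hz => hE.isPoint hz) hr
      refine ⟨F, hE.equivalent.trans hF, ?_⟩
      rw [hF', hE.2.2, Function.update_idem]

/-- A final stretch of a curve that only visits points adjacent to its terminal point can be
deleted, up to the terminal point. -/
theorem exists_collapse_terminal {k : Fin n} {l xs : List ℤ} {c : ℤ} {D : VCD n}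
    (h : D.curve k = l ++ xs ++ [c]) (ha : ∀ x ∈ xs, D.Adjacent x c) :
    ∃ E : VCD n, Equivalent D E ∧ E.curve = Function.update D.curve k (l ++ [c]) := by
  induction xs using List.reverseRecOn generalizing D with
  | nil => exact ⟨D, Equivalent.refl D, by rw [Function.eq_update_iff]; simpa using h⟩
  | append_singleton xs x ih =>
    obtain ⟨E, hE⟩ := exists_stepAt (D := D) (k := k) (x := x) (y := c) (l := l ++ xs)
        (r := []) (by simpa using h) (ha x (by simp))
    have hc := hE.curve_self
    rw [contract_nil] at hc
    obtain ⟨F, hF, hF'⟩ := ih hc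
      (fun y hy => (ha y (by simp [hy])).of_subset fun z hz => hE.isPoint hz)
    exact ⟨F, hE.equivalent.trans hF, by rw [hF', hE.2.2, Function.update_idem]⟩

/-- A point may be moved to an adjacent free position. -/
theorem exists_move {D : VCD n} {k : Fin n} {l r : List ℤ} {x y : ℤ}
    (h : D.curve k = l ++ x :: r) (ha : D.Adjacent x y) (hy : ¬ D.IsPoint y) :
    ∃ E : VCD n, Equivalent D E ∧ E.curve = Function.update D.curve k (l ++ y :: r) := by
  have hn := D.curve_nodup k
  rw [h] at hn
  have hg : ∀ z w, D.IsPoint z → D.IsPoint w → z < w →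
      (if z = x then y else z) < (if w = x then y else w) := by
    intro z w hz hw hzw
    have az := ha z hz
    have aw := ha w hw
    have bz : z ≠ y := by rintro rfl; exact hy hz
    have bw : w ≠ y := by rintro rfl; exact hy hw
    unfold Encloses at az aw
    dsimp only at az aw
    split_ifs <;> omega
  have hid : ∀ l' : List ℤ, x ∉ l' → l'.map (fun z => if z = x then y else z) = l' := by
    intro l' hx
    conv_rhs => rw [← List.map_id l']
    refine List.map_congr_left fun z hz => ?_
    have : z ≠ x := by rintro rfl; exact hx hz
    simp [this]
  obtain ⟨E, hE⟩ := D.exists_relabel _ hg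
  refine ⟨E, Relabel.equivalent ⟨_, hg, hE⟩, ?_⟩
  ext1 j
  rw [hE]
  by_cases hjk : j = k
  · subst hjk
    rw [Function.update_self, h, List.map_append, List.map_cons, hid l, hid r]
    · simp
    · simp [List.nodup_append] at hn; tauto
    · simp [List.nodup_append] at hn; grind
  · rw [Function.update_of_ne hjk, hid]
    intro hx
    exact D.curve_disjoint j k hjk hx (by simp [h])

theorem StepAt.curve_eq_filter_of_ne_nil {D E : VCD n} {k : Fin n} {x y : ℤ} {l r : List ℤ}
    (h : StepAt D E k x y l r) (hr : r ≠ []) (j : Fin n) :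
    E.curve j = (D.curve j).filter (fun z => z ≠ x ∧ z ≠ y) := by
  have hn := D.curve_nodup k
  rw [h.1] at hn
  have ht : D.terminal k ∈ r := by
    unfold VCD.terminal
    simp [h.1, hr]
  rw [h.curve_eq_filter]
  refine List.filter_congr fun z _ => ?_
  have h1 : D.terminal k ≠ x := by
    intro hc; rw [hc] at ht; simp [List.nodup_append] at hn; tauto
  have h2 : D.terminal k ≠ y := by
    intro hc; rw [hc] at ht; simp [List.nodup_append] at hn; tauto
  have : z = D.terminal k → z ≠ x ∧ z ≠ y := by rintro rfl; exact ⟨h1, h2⟩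
  simp only [decide_eq_decide]
  tauto

/-- A family of arcs `(x, φ x)` can be deleted if any point between the ends of an arc of the family
is an end of another arc of the family between these ends. -/
theorem exists_delete_nested (φ : ℤ → ℤ) {S : Finset ℤ} {D : VCD n}
    (h0 : ∀ x ∈ S, ∀ k, D.terminal k ≠ x)
    (h1 : ∀ x ∈ S, ∃ k l r, D.curve k = l ++ x :: φ x :: r ∨ D.curve k = l ++ φ x :: x :: r)
    (h2 : ∀ x ∈ S, φ x ∈ S ∧ φ (φ x) = x)
    (h3 : ∀ x ∈ S, ∀ z, D.IsPoint z → Encloses (x, φ x) z → z ∈ S ∧ Encloses (x, φ x) (φ z)) :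
    ∃ E : VCD n, Equivalent D E ∧ ∀ j, E.curve j = (D.curve j).filter (· ∉ S) := by
  induction hS : S.card using Nat.strong_induction_on generalizing S D with
  | _ m ih =>
  rcases S.eq_empty_or_nonempty with rfl | hne
  · exact ⟨D, Equivalent.refl D, fun j => by simp⟩
  obtain ⟨x, hx, hmin⟩ := S.exists_min_image (fun x => |x - φ x|) hne
  have hadj : D.Adjacent x (φ x) := by
    intro z hz hc
    obtain ⟨hzS, hc'⟩ := h3 x hx z hz hc
    have := hmin z hzS
    unfold Encloses at hc hc'
    dsimp only at hc hc'
    rcases abs_cases (x - φ x) with h | h <;> rcases abs_cases (z - φ z) with h' | h' <;> omega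
  have key : ∃ E : VCD n, Equivalent D E ∧ (∀ k, E.terminal k = D.terminal k) ∧
      ∀ j, E.curve j = (D.curve j).filter (fun z => z ≠ x ∧ z ≠ φ x) := by
    obtain ⟨k, l, r, h | h⟩ := h1 x hx
    · obtain ⟨E, hE⟩ := exists_stepAt h hadj
      refine ⟨E, hE.equivalent, hE.terminal, fun j => hE.curve_eq_filter_of_ne_nil ?_ j⟩
      rintro rfl
      exact h0 _ (h2 x hx).1 k (by simp [VCD.terminal, h])
    · obtain ⟨E, hE⟩ := exists_stepAt h hadj.symm
      refine ⟨E, hE.equivalent, hE.terminal, fun j => ?_⟩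
      rw [hE.curve_eq_filter_of_ne_nil ?_ j]
      · exact List.filter_congr fun z _ => by simp [and_comm]
      · rintro rfl
        exact h0 _ hx k (by simp [VCD.terminal, h])
  obtain ⟨E, hDE, hEt, hE⟩ := key
  have hmem : ∀ z, z ∈ (S.erase x).erase (φ x) ↔ z ∈ S ∧ z ≠ x ∧ z ≠ φ x := by
    intro z; simp only [Finset.mem_erase]; tauto
  have hφ : ∀ z ∈ S, z ≠ x → z ≠ φ x → φ z ≠ x ∧ φ z ≠ φ x := by
    intro z hz hzx hzφ
    constructor
    · intro h
      apply hzφ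
      rw [← h, (h2 z hz).2]
    · intro h
      apply hzx
      rw [← (h2 z hz).2, h, (h2 x hx).2]
  obtain ⟨F, hF, hF'⟩ := ih ((S.erase x).erase (φ x)).card
    (by
      rw [← hS]
      exact (Finset.card_le_card (Finset.erase_subset _ _)).trans_lt (Finset.card_erase_lt_of_mem hx))
    (S := (S.erase x).erase (φ x)) (D := E)
    (fun z hz k => by rw [hEt]; exact h0 z ((hmem z).1 hz).1 k)
    (by
      intro z hz
      obtain ⟨hzS, hzx, hzφ⟩ := (hmem z).1 hz
      obtain ⟨h3, h4⟩ := hφ z hzS hzx hzφ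
      obtain ⟨k, l, r, h | h⟩ := h1 z hzS
      · exact ⟨k, _, _, Or.inl (by
          rw [hE, h, List.filter_append, List.filter_cons, List.filter_cons,
            if_pos (by simp [hzx, hzφ]), if_pos (by simp [h3, h4])])⟩
      · exact ⟨k, _, _, Or.inr (by
          rw [hE, h, List.filter_append, List.filter_cons, List.filter_cons,
            if_pos (by simp [h3, h4]), if_pos (by simp [hzx, hzφ])])⟩)
    (by
      intro z hz
      obtain ⟨hzS, hzx, hzφ⟩ := (hmem z).1 hz
      exact ⟨(hmem _).2 ⟨(h2 z hzS).1, hφ z hzS hzx hzφ⟩, (h2 z hzS).2⟩)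
    (by
      intro z hz w hw hc
      obtain ⟨hzS, hzx, hzφ⟩ := (hmem z).1 hz
      obtain ⟨j, hw⟩ := hw
      rw [hE, List.mem_filter] at hw
      obtain ⟨h4, h5⟩ := h3 z hzS w ⟨j, hw.1⟩ hc
      exact ⟨(hmem w).2 ⟨h4, by simpa using hw.2⟩, h5⟩)
    rfl
  refine ⟨F, hDE.trans hF, fun j => ?_⟩
  rw [hF', hE, List.filter_filter]
  refine List.filter_congr fun z _ => ?_
  by_cases c1 : z = x
  · subst c1; simp [hx]
  · by_cases c2 : z = φ x
    · simp [c2, (h2 x hx).1]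
    · simp [c1, c2]

end VCD

/-! ### The uniform push -/

/-- The beginning of an over arc at its end `x` after the uniform push: a point `x` of `(a, b]` is
pulled along, whether or not the other end of the arc lies in `(a, b]` as well. -/
def outward (a b x : ℤ) : List ℤ :=
  if x = a then [b + 2 * (b - a)]
  else if a < x ∧ x ≤ b then [x, b + 2 * (b - a) - (x - a), b + 2 * (b - a) + (x - a)]
  else [shift a b x]

/-- The variant of `pushCurve` in which each end of an over arc is treated without regard to the
other end. -/
def spreadCurve (a b : ℤ) : List ℤ → List ℤ
  | x :: y :: l => outward a b x ++ (outward a b y).reverse ++ spreadCurve a b l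
  | [x] => if x = a then [a, b + 2 * (b - a)] else [shift a b x]
  | [] => []

/-- The last point of `outward a b x`. -/
def outer (a b x : ℤ) : ℤ :=
  if a ≤ x ∧ x ≤ b then b + 2 * (b - a) + (x - a) else shift a b x

theorem outer_lt_outer {a b x y : ℤ} (hab : a < b) (h : x < y) : outer a b x < outer a b y := by
  unfold outer shift
  split_ifs <;> omega

theorem mem_outward {a b x z : ℤ} (hab : a < b) (h : z ∈ outward a b x) :
    (x < a ∧ z = x) ∨ (x = a ∧ z = b + 2 * (b - a)) ∨
    (a < x ∧ x ≤ b ∧ (z = x ∨ z = b + 2 * (b - a) - (x - a) ∨ z = b + 2 * (b - a) + (x - a))) ∨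
    (b < x ∧ z = x + 3 * (b - a)) := by
  unfold outward shift at h
  split_ifs at h <;> simp only [List.mem_cons, List.not_mem_nil, or_false] at h <;> omega

theorem outward_ne_nil (a b x : ℤ) : outward a b x ≠ [] := by
  unfold outward; split_ifs <;> simp

theorem odd_length_outward (a b x : ℤ) : Odd (outward a b x).length := by
  unfold outward
  split_ifs
  · exact ⟨0, rfl⟩
  · exact ⟨1, rfl⟩
  · exact ⟨0, rfl⟩

theorem even_length_outward (a b x y : ℤ) :
    Even (outward a b x ++ (outward a b y).reverse).length := by
  rw [List.length_append, List.length_reverse]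
  exact (odd_length_outward a b x).add_odd (odd_length_outward a b y)

theorem spreadCurve_append {a b : ℤ} : ∀ {l r : List ℤ}, Even l.length →
    spreadCurve a b (l ++ r) = spreadCurve a b l ++ spreadCurve a b r
  | [], _, _ => by simp [spreadCurve]
  | [x], _, h => by simp at h
  | x :: y :: l, r, h => by
      have h' : Even l.length := by simpa [Nat.even_add_one] using h
      simp [spreadCurve, spreadCurve_append h']

theorem spreadCurve_ne_nil {a b : ℤ} : ∀ {l : List ℤ}, l ≠ [] → spreadCurve a b l ≠ []
  | [], h => absurd rfl h
  | [x], _ => by simp only [spreadCurve]; split_ifs <;> simp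
  | x :: y :: l, _ => by simp [spreadCurve, outward_ne_nil]

theorem mem_spreadCurve {a b z : ℤ} : ∀ {l : List ℤ}, z ∈ spreadCurve a b l →
    ∃ u ∈ l, z ∈ outward a b u ∨ (z = a ∧ u = a ∧ ∃ p, l = p ++ [a] ∧ Even p.length)
  | [], h => by simp [spreadCurve] at h
  | [x], h => by
      refine ⟨x, by simp, ?_⟩
      unfold spreadCurve at h
      unfold outward
      split_ifs at h with hx
      · subst hx
        simp only [List.mem_cons, List.not_mem_nil, or_false] at h
        rcases h with rfl | h
        · exact Or.inr ⟨rfl, rfl, [], by simp, by simp⟩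
        · left; simp [h]
      · left
        simp only [List.mem_cons, List.not_mem_nil, or_false] at h
        rw [if_neg hx]
        subst h
        unfold shift
        split_ifs <;> first | omega | simp
  | x :: y :: l, h => by
      simp only [spreadCurve, List.mem_append, List.mem_reverse] at h
      rcases h with (h | h) | h
      · exact ⟨x, by simp, Or.inl h⟩
      · exact ⟨y, by simp, Or.inl h⟩
      · obtain ⟨u, hu, h | ⟨h1, h2, p, rfl, h4⟩⟩ := mem_spreadCurve h
        · exact ⟨u, by simp [hu], Or.inl h⟩
        · exact ⟨u, by simp [h2], Or.inr ⟨h1, h2, x :: y :: p, by simp,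
            by simpa [Nat.even_add_one] using h4⟩⟩

theorem origin_outward {a b x z : ℤ} (hab : a < b) (h : z ∈ outward a b x) : origin a b z = x := by
  have := mem_outward hab h
  unfold origin
  split_ifs <;> omega

theorem origin_spreadCurve {a b z : ℤ} (hab : a < b) {l : List ℤ} (h : z ∈ spreadCurve a b l) :
    origin a b z ∈ l := by
  obtain ⟨u, hu, h | ⟨rfl, rfl, _⟩⟩ := mem_spreadCurve h
  · rwa [origin_outward hab h]
  · unfold origin; rwa [if_pos hab.le]

theorem outward_nodup {a b x : ℤ} : (outward a b x).Nodup := by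
  unfold outward
  split_ifs <;> simp
  omega

theorem spreadCurve_nodup {a b : ℤ} (hab : a < b) :
    ∀ {l : List ℤ}, l.Nodup → (spreadCurve a b l).Nodup
  | [], _ => by simp [spreadCurve]
  | [x], _ => by
      simp only [spreadCurve]
      split_ifs <;> simp
      omega
  | x :: y :: l, h => by
      simp only [List.nodup_cons, List.mem_cons, not_or] at h
      obtain ⟨⟨hxy, hx⟩, hy, hl⟩ := h
      simp only [spreadCurve]
      refine List.Nodup.append (List.Nodup.append outward_nodup
        (List.nodup_reverse.2 outward_nodup) ?_) (spreadCurve_nodup hab hl) ?_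
      · intro z hz hz'
        rw [List.mem_reverse] at hz'
        exact hxy ((origin_outward hab hz).symm.trans (origin_outward hab hz'))
      · intro z hz hz'
        have h2 := origin_spreadCurve hab hz'
        rw [List.mem_append, List.mem_reverse] at hz
        rcases hz with h | h <;> rw [origin_outward hab h] at h2 <;> contradiction

/-- The inner over arcs of a spread diagram. They are nested around `b`. -/
def IsInner (a b : ℤ) (e : ℤ × ℤ) : Prop :=
  a ≤ min e.1 e.2 ∧ min e.1 e.2 ≤ b ∧ max e.1 e.2 = b + 2 * (b - a) - (min e.1 e.2 - a)

theorem overArcs_outward {a b x y : ℤ} (hab : a < b) {e : ℤ × ℤ}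
    (h : e ∈ overArcs (outward a b x ++ (outward a b y).reverse)) :
    IsInner a b e ∨ e = (outer a b x, outer a b y) := by
  unfold outward at h
  unfold IsInner
  by_cases h1 : x = a <;> by_cases h2 : y = a <;> by_cases h3 : a < x ∧ x ≤ b <;>
    by_cases h4 : a < y ∧ y ≤ b <;>
    simp only [h1, h2, h3, h4, if_true, if_false, List.reverse_cons, List.reverse_nil,
      List.nil_append, List.cons_append, overArcs, List.mem_cons, List.not_mem_nil, or_false,
      and_self] at h <;>
    first
      | (exfalso; omega)
      | (subst h; right; unfold outer shift; ext <;> dsimp only <;> split_ifs <;> omega)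
      | (rcases h with rfl | rfl <;> first
          | (left; dsimp only; omega)
          | (right; unfold outer shift; ext <;> dsimp only <;> split_ifs <;> omega))
      | (rcases h with rfl | rfl | rfl <;> first
          | (left; dsimp only; omega)
          | (right; unfold outer shift; ext <;> dsimp only <;> split_ifs <;> omega))

theorem overArcs_spreadCurve {a b : ℤ} (hab : a < b) {e : ℤ × ℤ} :
    ∀ {l : List ℤ}, e ∈ overArcs (spreadCurve a b l) →
      IsInner a b e ∨ ∃ f ∈ overArcs l, e = (outer a b f.1, outer a b f.2)
  | [], h => by simp [overArcs, spreadCurve] at h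
  | [x], h => by
      simp only [spreadCurve] at h
      split_ifs at h with hx <;> simp [overArcs] at h
      left
      subst h
      unfold IsInner
      dsimp only
      omega
  | x :: y :: l, h => by
      rw [spreadCurve, overArcs_append (even_length_outward a b x y), List.mem_append] at h
      rcases h with h | h
      · rcases overArcs_outward hab h with h | h
        · exact Or.inl h
        · exact Or.inr ⟨(x, y), by simp [overArcs], h⟩
      · rcases overArcs_spreadCurve hab h with h | ⟨f, hf, h⟩
        · exact Or.inl h
        · exact Or.inr ⟨f, by simp [overArcs, hf], h⟩

theorem getLast_spreadCurve {a b : ℤ} : ∀ {l : List ℤ} (hl : l ≠ []),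
    (spreadCurve a b l).getLast (spreadCurve_ne_nil hl) =
      if l.getLast hl = a then b + 2 * (b - a) else shift a b (l.getLast hl)
  | [x], _ => by
      by_cases h : x = a <;> simp [spreadCurve, h]
  | [x, y], _ => by
      unfold spreadCurve spreadCurve outward
      unfold shift
      split_ifs <;> simp_all
  | x :: y :: z :: l, _ => by
      have := getLast_spreadCurve (a := a) (b := b) (l := z :: l) (by simp)
      unfold spreadCurve
      rw [List.getLast_append_of_ne_nil _ (spreadCurve_ne_nil (by simp)), this]
      simp

namespace VCD

variable {n : ℕ}

/-- The uniform variant of `push`; it is equivalent to `push`, but commutes with contractions of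
arcs more directly, because it acts on each end of an over arc separately. -/
def spread (D : VCD n) (a b : ℤ) (hab : a < b) : VCD n where
  curve k := spreadCurve a b (D.curve k)
  curve_ne_nil k := spreadCurve_ne_nil (D.curve_ne_nil k)
  curve_nodup k := spreadCurve_nodup hab (D.curve_nodup k)
  curve_disjoint j k hjk z hj hk :=
    D.curve_disjoint j k hjk (origin_spreadCurve hab hj) (origin_spreadCurve hab hk)
  over_noncrossing j k e he f hf := by
    rcases overArcs_spreadCurve hab he with h1 | ⟨e', he', rfl⟩ <;>
      rcases overArcs_spreadCurve hab hf with h2 | ⟨f', hf', rfl⟩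
    · unfold IsInner at h1 h2
      unfold Crosses
      omega
    · unfold IsInner at h1
      unfold Crosses outer shift
      dsimp only
      split_ifs <;> omega
    · unfold IsInner at h2
      unfold Crosses outer shift
      dsimp only
      split_ifs <;> omega
    · have := D.over_noncrossing j k e' he' f' hf'
      have mono : StrictMono (outer a b) := fun x y h => outer_lt_outer hab h
      unfold Crosses at *
      dsimp only
      rwa [← mono.monotone.map_min, ← mono.monotone.map_min, ← mono.monotone.map_max,
        ← mono.monotone.map_max, mono.lt_iff_lt, mono.lt_iff_lt, mono.lt_iff_lt]

theorem spread_curve (D : VCD n) (a b : ℤ) (hab : a < b) (k : Fin n) :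
    (D.spread a b hab).curve k = spreadCurve a b (D.curve k) := rfl

theorem isPoint_spread {D : VCD n} {a b : ℤ} {hab : a < b} {z : ℤ}
    (h : (D.spread a b hab).IsPoint z) : ∃ u, D.IsPoint u ∧
      ((u < a ∧ z = u) ∨ (u = a ∧ z = b + 2 * (b - a)) ∨ (u = a ∧ z = a) ∨
      (a < u ∧ u ≤ b ∧ z = u) ∨ (a < u ∧ u ≤ b ∧ z = b + 2 * (b - a) - (u - a)) ∨
      (a < u ∧ u ≤ b ∧ z = b + 2 * (b - a) + (u - a)) ∨ (b < u ∧ z = u + 3 * (b - a))) := by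
  obtain ⟨k, h⟩ := h
  obtain ⟨u, hu, h | ⟨h1, h2, _⟩⟩ := mem_spreadCurve h
  · have := mem_outward hab h
    exact ⟨u, ⟨k, hu⟩, by omega⟩
  · exact ⟨u, ⟨k, hu⟩, by omega⟩

theorem terminal_spread (D : VCD n) (a b : ℤ) (hab : a < b) (k : Fin n) :
    (D.spread a b hab).terminal k =
      if D.terminal k = a then b + 2 * (b - a) else shift a b (D.terminal k) :=
  getLast_spreadCurve (D.curve_ne_nil k)

end VCD

namespace VCD

variable {n : ℕ}

/-! ### The uniform push commutes with contractions -/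

theorem ne_terminal_of_curve_eq {D : VCD n} {k : Fin n} {x : ℤ} {l r : List ℤ}
    (h : D.curve k = l ++ x :: r) (hr : r ≠ []) (j : Fin n) : D.terminal j ≠ x := by
  rintro rfl
  obtain rfl := D.eq_of_mem (D.terminal_mem j) (k := k) (by rw [h]; simp)
  have hn := D.curve_nodup j
  rw [h] at hn
  have ht : D.terminal j ∈ r := by
    rw [VCD.terminal]
    simp only [h]
    rw [List.getLast_append_of_ne_nil _ (by simp), List.getLast_cons hr]
    exact List.getLast_mem hr
  simp [List.nodup_append] at hn
  tauto

theorem terminal_eq_of_curve_eq {D : VCD n} {k : Fin n} {x : ℤ} {l : List ℤ}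
    (h : D.curve k = l ++ [x]) : D.terminal k = x := by
  simp [VCD.terminal, h]

theorem spread_eq_of_curve_eq {D E F : VCD n} {k : Fin n} {x y a b : ℤ} {l r : List ℤ}
    {hab : a < b} (h : StepAt D E k x y l r)
    (hF : F.curve = Function.update (D.spread a b hab).curve k (spreadCurve a b (contract y l r))) :
    F = E.spread a b hab := by
  apply VCD.ext
  rw [hF]
  ext1 j
  rw [spread_curve]
  by_cases hjk : j = k
  · subst hjk; rw [Function.update_self, h.curve_self]
  · rw [Function.update_of_ne hjk, h.curve_of_ne hjk, spread_curve]

section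

variable {D E : VCD n} {k : Fin n} {x y a b : ℤ} {l r : List ℤ} {hab : a < b}

theorem forall₂_adjacent_outward (ha : D.IsPoint a) (hb : D.IsPoint b) (hxa : x ≠ a)
    (hxb : x ≠ b) (hya : y ≠ a) (hyb : y ≠ b) (h : D.Adjacent x y) :
    List.Forall₂ (D.spread a b hab).Adjacent (outward a b x) (outward a b y) := by
  have h1 := h a ha
  have h2 := h b hb
  have hiff : (a < x ∧ x ≤ b) ↔ (a < y ∧ y ≤ b) := by
    unfold Encloses at h1 h2
    dsimp only at h1 h2
    omega
  unfold outward
  rw [if_neg hxa, if_neg hya]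
  by_cases hx : a < x ∧ x ≤ b
  · rw [if_pos hx, if_pos (hiff.1 hx)]
    have hy := hiff.1 hx
    refine .cons ?_ (.cons ?_ (.cons ?_ .nil)) <;> intro z hz <;>
      obtain ⟨u, hu, hz⟩ := isPoint_spread hz <;> have h3 := h u hu <;> unfold Encloses at * <;>
      dsimp only at * <;> omega
  · rw [if_neg hx, if_neg (hx ∘ hiff.2)]
    refine .cons ?_ .nil
    intro z hz
    have hy := hx ∘ hiff.2
    obtain ⟨u, hu, hz⟩ := isPoint_spread hz
    have h3 := h u hu
    unfold Encloses shift at *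
    dsimp only at *
    split_ifs <;> omega

/-- The case of an arc that is not terminal. -/
theorem StepAt.spread_of_ne_nil (h : StepAt D E k x y l r) (hr : r ≠ []) (ha : ∃ j, D.terminal j = a)
    (hb : ∃ j, D.terminal j = b) : Equivalent (D.spread a b hab) (E.spread a b hab) := by
  have hx := ne_terminal_of_curve_eq h.1 (by simp)
  have hy := ne_terminal_of_curve_eq (D := D) (k := k) (x := y) (l := l ++ [x]) (r := r)
    (by rw [h.1]; simp) hr
  have key : List.Forall₂ (D.spread a b hab).Adjacent (outward a b x) (outward a b y) := by
    obtain ⟨i, rfl⟩ := ha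
    obtain ⟨j, rfl⟩ := hb
    exact forall₂_adjacent_outward (D.isPoint_terminal i) (D.isPoint_terminal j) (hx i).symm
      (hx j).symm (hy i).symm (hy j).symm h.2.1
  rcases Nat.even_or_odd l.length with hl | hl
  · obtain ⟨F, hF, hF'⟩ := exists_collapse (D := D.spread a b hab) (k := k)
      (l := spreadCurve a b l) (xs := (outward a b x).reverse) (ys := (outward a b y).reverse)
      (r := spreadCurve a b r)
      (by rw [spread_curve, h.1, spreadCurve_append hl]; simp [spreadCurve])
      (List.forall₂_reverse_iff.2 key) (spreadCurve_ne_nil hr)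
    rw [← spread_eq_of_curve_eq (hab := hab) h (F := F)
      (by rw [hF', contract, if_neg hr, spreadCurve_append hl])]
    exact hF
  · obtain ⟨l, w, rfl⟩ : ∃ l' w, l = l' ++ [w] := by
      rcases List.eq_nil_or_concat l with rfl | ⟨l', s, rfl⟩
      · simp at hl
      · exact ⟨l', s, by simp⟩
    have hl' : Even l.length := by simpa [Nat.odd_add_one] using hl
    obtain ⟨z, r, rfl⟩ := List.exists_cons_of_ne_nil hr
    obtain ⟨F, hF, hF'⟩ := exists_collapse (D := D.spread a b hab) (k := k)
      (l := spreadCurve a b l ++ outward a b w) (xs := outward a b x) (ys := outward a b y)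
      (r := (outward a b z).reverse ++ spreadCurve a b r)
      (by
        rw [spread_curve, h.1, List.append_assoc, spreadCurve_append hl']
        simp [spreadCurve])
      key (by simp [outward_ne_nil])
    rw [← spread_eq_of_curve_eq (hab := hab) h (F := F)
      (by
        rw [hF', contract_cons, List.append_assoc l, spreadCurve_append hl']
        simp [spreadCurve])]
    exact hF

theorem adjacent_of_update {D E : VCD n} {k : Fin n} {l : List ℤ} {x y : ℤ} (h : D.Adjacent x y)
    (hE : E.curve = Function.update D.curve k l) (hl : ∀ z ∈ l, z ∈ D.curve k) : E.Adjacent x y :=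
  h.of_subset fun _ hz => isPoint_update hE hl hz

/-- The case of a terminal arc ending at the moving point `a`. -/
theorem StepAt.spread_terminal_left (h : StepAt D E k x a l []) (hb : ∃ j, D.terminal j = b) :
    Equivalent (D.spread a b hab) (E.spread a b hab) := by
  have hx := ne_terminal_of_curve_eq h.1 (by simp)
  have hta : D.terminal k = a := terminal_eq_of_curve_eq (l := l ++ [x]) (by simp [h.1])
  obtain ⟨jb, hb⟩ := hb
  have hxa : x ≠ a := hta ▸ (hx k).symm
  have hxb : x ≠ b := hb ▸ (hx jb).symm
  have hadj := h.2.1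
  have hbx := hadj b (hb ▸ D.isPoint_terminal jb)
  have hxlt : x < b := by unfold Encloses at hbx; dsimp only at hbx; omega
  have hc := h.1
  have close : ∀ {F : VCD n}, Equivalent (D.spread a b hab) F →
      F.curve = Function.update (D.spread a b hab).curve k (spreadCurve a b (l ++ [a])) →
      Equivalent (D.spread a b hab) (E.spread a b hab) := by
    intro F hF hF'
    rw [← spread_eq_of_curve_eq (hab := hab) h (F := F) (by rw [hF', contract_nil])]
    exact hF
  have adj1 : x < a → (D.spread a b hab).Adjacent x a := by
    intro hlt z hz
    obtain ⟨u, hu, hz⟩ := isPoint_spread hz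
    have h3 := hadj u hu
    unfold Encloses at *
    dsimp only at *
    omega
  have adj2 : a < x → (D.spread a b hab).Adjacent x a := by
    intro hlt z hz
    obtain ⟨u, hu, hz⟩ := isPoint_spread hz
    have h3 := hadj u hu
    unfold Encloses at *
    dsimp only at *
    omega
  have adj3 : a < x → ∀ y ∈ [b + 2 * (b - a) - (x - a), b + 2 * (b - a) + (x - a)],
      (D.spread a b hab).Adjacent y (b + 2 * (b - a)) := by
    intro hlt y hy z hz
    obtain ⟨u, hu, hz⟩ := isPoint_spread hz
    have h3 := hadj u hu
    unfold Encloses at *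
    simp only [List.mem_cons, List.not_mem_nil, or_false] at hy
    dsimp only at *
    omega
  rcases Nat.even_or_odd l.length with hl | hl
  · have hcs : (D.spread a b hab).curve k =
        spreadCurve a b l ++ outward a b x ++ [b + 2 * (b - a)] := by
      rw [spread_curve, hc, spreadCurve_append hl]
      simp [spreadCurve, outward]
    have ht : spreadCurve a b (l ++ [a]) = spreadCurve a b l ++ a :: [b + 2 * (b - a)] := by
      rw [spreadCurve_append hl]; simp [spreadCurve]
    -- `a` is the end of an over arc, hence not a point of the spread diagram
    have hna : ¬ (D.spread a b hab).IsPoint a := by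
      rintro ⟨j, hj⟩
      obtain ⟨u, hu, hz | ⟨_, _, p, hp, hpe⟩⟩ := mem_spreadCurve hj
      · have := mem_outward hab hz
        omega
      · obtain rfl := D.eq_of_mem (x := a) (j := k) (k := j) (by simp [hc]) (by simp [hp])
        rw [hc] at hp
        have := congrArg List.length hp
        simp at this
        rcases hl with ⟨m, hm⟩
        rcases hpe with ⟨m', hm'⟩
        omega
    rcases lt_or_gt_of_ne hxa with c | c
    · obtain ⟨F, hF, hF'⟩ := exists_move (D := D.spread a b hab) (k := k) (l := spreadCurve a b l)
        (x := x) (y := a) (r := [b + 2 * (b - a)])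
        (by rw [hcs]; simp [outward, shift, hxa, c.not_gt, hxlt.not_gt]) (adj1 c) hna
      exact close hF (by rw [hF', ht])
    · obtain ⟨F, hF, hF'⟩ := exists_collapse_terminal (D := D.spread a b hab) (k := k)
        (l := spreadCurve a b l ++ [x]) (c := b + 2 * (b - a))
        (xs := [b + 2 * (b - a) - (x - a), b + 2 * (b - a) + (x - a)])
        (by rw [hcs]; simp [outward, hxa, c, hxlt.le]) (adj3 c)
      have hsub : ∀ z ∈ spreadCurve a b l ++ [x] ++ [b + 2 * (b - a)],
          z ∈ (D.spread a b hab).curve k := by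
        rw [hcs]; simp [outward, hxa, c, hxlt.le]; tauto
      obtain ⟨G, hG, hG'⟩ := exists_move (D := F) (k := k) (l := spreadCurve a b l) (x := x)
        (y := a) (r := [b + 2 * (b - a)]) (by rw [hF', Function.update_self]; simp)
        (adjacent_of_update (adj2 c) hF' hsub)
        (fun h => hna (isPoint_update hF' hsub h))
      exact close (hF.trans hG) (by rw [hG', hF', ht, Function.update_idem])
  · obtain ⟨l, w, rfl⟩ : ∃ l' w, l = l' ++ [w] := by
      rcases List.eq_nil_or_concat l with rfl | ⟨l', s, rfl⟩
      · simp at hl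
      · exact ⟨l', s, by simp⟩
    have hl' : Even l.length := by simpa [Nat.odd_add_one] using hl
    have hcs : (D.spread a b hab).curve k = spreadCurve a b l ++ outward a b w ++
        (outward a b x).reverse ++ [a, b + 2 * (b - a)] := by
      rw [spread_curve, hc, List.append_assoc, spreadCurve_append hl']
      simp [spreadCurve]
    have ht : spreadCurve a b (l ++ [w] ++ [a]) =
        spreadCurve a b l ++ outward a b w ++ [b + 2 * (b - a)] := by
      rw [List.append_assoc, spreadCurve_append hl']; simp [spreadCurve, outward]
    rcases lt_or_gt_of_ne hxa with c | c
    · obtain ⟨F, hF, hF'⟩ := exists_collapse (D := D.spread a b hab) (k := k)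
        (l := spreadCurve a b l ++ outward a b w) (xs := [x]) (ys := [a]) (r := [b + 2 * (b - a)])
        (by rw [hcs]; simp [outward, shift, hxa, c.not_gt, hxlt.not_gt])
        (.cons (adj1 c) .nil) (by simp)
      exact close hF (by rw [hF', ht])
    · obtain ⟨F, hF, hF'⟩ := exists_collapse (D := D.spread a b hab) (k := k)
        (l := spreadCurve a b l ++ outward a b w ++
          [b + 2 * (b - a) + (x - a), b + 2 * (b - a) - (x - a)])
        (xs := [x]) (ys := [a]) (r := [b + 2 * (b - a)])
        (by rw [hcs]; simp [outward, hxa, c, hxlt.le])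
        (.cons (adj2 c) .nil) (by simp)
      have hsub : ∀ z ∈ spreadCurve a b l ++ outward a b w ++
          [b + 2 * (b - a) + (x - a), b + 2 * (b - a) - (x - a)] ++ [b + 2 * (b - a)],
          z ∈ (D.spread a b hab).curve k := by
        rw [hcs]; simp [outward, hxa, c, hxlt.le]; tauto
      obtain ⟨G, hG, hG'⟩ := exists_collapse_terminal (D := F) (k := k)
        (l := spreadCurve a b l ++ outward a b w)
        (xs := [b + 2 * (b - a) + (x - a), b + 2 * (b - a) - (x - a)])
        (by rw [hF', Function.update_self])
        (fun y hy => adjacent_of_update (adj3 c y (by simp at hy ⊢; tauto)) hF' hsub)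
      exact close (hF.trans hG) (by rw [hG', hF', ht, Function.update_idem])

theorem outward_right (hab : a < b) : outward a b b =
    [b, b + 2 * (b - a) - (b - a), b + 2 * (b - a) + (b - a)] := by
  simp [outward, hab, hab.ne']

theorem adjacent_spread_right :
    (D.spread a b hab).Adjacent (b + 2 * (b - a) - (b - a)) b := by
  intro z hz
  obtain ⟨u, hu, hz⟩ := isPoint_spread hz
  unfold Encloses at *
  dsimp only at *
  omega

theorem StepAt.spread_eq_right (h : StepAt D E k x b l []) {F : VCD n}
    (hF : Equivalent (D.spread a b hab) F)
    (hF' : F.curve = Function.update (D.spread a b hab).curve k (spreadCurve a b (l ++ [b]))) :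
    Equivalent (D.spread a b hab) (E.spread a b hab) := by
  rw [← spread_eq_of_curve_eq (hab := hab) h (F := F) (by rw [hF', contract_nil])]
  exact hF

/-- The case of a terminal over arc ending at the point `b` over which `a` moves. -/
theorem StepAt.spread_terminal_right_over (h : StepAt D E k x b l []) (hxa : a < x) (hxb : x ≠ b)
    (hl : Even l.length) : Equivalent (D.spread a b hab) (E.spread a b hab) := by
  have hadj := h.2.1
  have hc := h.1
  have hcs : (D.spread a b hab).curve k = spreadCurve a b l ++ outward a b x ++
      [b + 2 * (b - a) + (b - a), b + 2 * (b - a) - (b - a), b] := by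
    rw [spread_curve, hc, spreadCurve_append hl]
    simp [spreadCurve, outward_right hab]
  have ht : spreadCurve a b (l ++ [b]) = spreadCurve a b l ++ [b] := by
    rw [spreadCurve_append hl]; simp [spreadCurve, hab.ne', shift]
  rcases lt_or_gt_of_ne hxb with c | c
  · have houtx : outward a b x =
        [x, b + 2 * (b - a) - (x - a), b + 2 * (b - a) + (x - a)] := by
      simp [outward, hxa.ne', hxa, c.le]
    have adj : List.Forall₂ (D.spread a b hab).Adjacent
        [b + 2 * (b - a) + (x - a), b + 2 * (b - a) - (x - a), x]
        [b + 2 * (b - a) + (b - a), b + 2 * (b - a) - (b - a), b] := by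
      refine .cons ?_ (.cons ?_ (.cons ?_ .nil)) <;> intro z hz <;>
        obtain ⟨u, hu, hz⟩ := isPoint_spread hz <;> have h3 := hadj u hu <;>
        unfold Encloses at * <;> dsimp only at * <;> omega
    simp only [List.forall₂_cons] at adj
    obtain ⟨F, hF, hF'⟩ := exists_collapse (D := D.spread a b hab) (k := k)
      (l := spreadCurve a b l ++ [x])
      (xs := [b + 2 * (b - a) + (x - a), b + 2 * (b - a) - (x - a)])
      (ys := [b + 2 * (b - a) + (b - a), b + 2 * (b - a) - (b - a)]) (r := [b])
      (by rw [hcs, houtx]; simp) (.cons adj.1 (.cons adj.2.1 .nil)) (by simp)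
    have hsub : ∀ z ∈ spreadCurve a b l ++ [x] ++ [b], z ∈ (D.spread a b hab).curve k := by
      rw [hcs, houtx]; simp; tauto
    obtain ⟨G, hG, hG'⟩ := exists_collapse_terminal (D := F) (k := k)
      (l := spreadCurve a b l) (xs := [x]) (c := b) (by rw [hF', Function.update_self])
      (by simpa using adjacent_of_update adj.2.2.1 hF' hsub)
    exact h.spread_eq_right (hF.trans hG) (by rw [hG', hF', ht, Function.update_idem])
  · have houtx : outward a b x = [x + 3 * (b - a)] := by
      simp [outward, hxa.ne', c.not_ge, shift, c]
    have adj : (D.spread a b hab).Adjacent (x + 3 * (b - a)) (b + 2 * (b - a) + (b - a)) := by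
      intro z hz
      obtain ⟨u, hu, hz⟩ := isPoint_spread hz
      have h3 := hadj u hu
      unfold Encloses at *
      dsimp only at *
      omega
    obtain ⟨F, hF, hF'⟩ := exists_collapse (D := D.spread a b hab) (k := k)
      (l := spreadCurve a b l) (xs := [x + 3 * (b - a)])
      (ys := [b + 2 * (b - a) + (b - a)]) (r := [b + 2 * (b - a) - (b - a), b])
      (by rw [hcs, houtx]; simp) (.cons adj .nil) (by simp)
    have hsub : ∀ z ∈ spreadCurve a b l ++ [b + 2 * (b - a) - (b - a), b],
        z ∈ (D.spread a b hab).curve k := by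
      rw [hcs, houtx]; simp; tauto
    obtain ⟨G, hG, hG'⟩ := exists_collapse_terminal (D := F) (k := k)
      (l := spreadCurve a b l) (xs := [b + 2 * (b - a) - (b - a)]) (c := b)
      (by rw [hF', Function.update_self]; simp)
      (by simpa using adjacent_of_update adjacent_spread_right hF' hsub)
    exact h.spread_eq_right (hF.trans hG) (by rw [hG', hF', ht, Function.update_idem])

/-- The terminal point of an under arc or base arc is not an end of an over arc. -/
theorem overArcs_ne_of_curve_eq {c : ℤ} (hc : D.curve k = l ++ [c]) (hl : Even l.length)
    {j : Fin n} {e : ℤ × ℤ} (he : e ∈ overArcs (D.curve j)) : e.1 ≠ c ∧ e.2 ≠ c := by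
  have ht := terminal_eq_of_curve_eq hc
  refine ⟨ht ▸ D.overArc_fst_ne_terminal he, ?_⟩
  rintro rfl
  obtain rfl := D.eq_of_mem (mem_of_mem_overArcs he).2 (show e.2 ∈ D.curve k by rw [hc]; simp)
  obtain ⟨p, s, hp, hpe⟩ := mem_overArcs_iff.1 he
  have hn := D.curve_nodup j
  have := append_cons_inj (l := l) (r := []) (l' := p ++ [e.1]) (r' := s) (hc ▸ hn)
    (by rw [← hc, hp]; simp)
  rw [this.1] at hl
  simp [hpe, Nat.even_add_one] at hl

theorem mem_spreadCurve_of_overArcs_ne (hab : a < b) {z : ℤ} : ∀ {l : List ℤ},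
    z ∈ spreadCurve a b l → (∀ e ∈ overArcs l, e.1 ≠ b ∧ e.2 ≠ b) →
    ∃ u ∈ l, (u ≠ b ∧ z ∈ outward a b u) ∨ (u = a ∧ z = a) ∨ (u = b ∧ z = b)
  | [], h, _ => by simp [spreadCurve] at h
  | [x], h, _ => by
      refine ⟨x, by simp, ?_⟩
      unfold spreadCurve at h
      by_cases hx : x = a
      · subst hx
        simp only [if_true, List.mem_cons, List.not_mem_nil, or_false] at h
        rcases h with h | h
        · exact Or.inr (Or.inl ⟨rfl, h⟩)
        · exact Or.inl ⟨hab.ne, by simp [outward, h]⟩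
      · rw [if_neg hx, List.mem_singleton] at h
        by_cases hb : x = b
        · exact Or.inr (Or.inr ⟨hb, by rw [h, hb]; simp [shift]⟩)
        · refine Or.inl ⟨hb, ?_⟩
          unfold outward
          rw [if_neg hx, h]
          unfold shift
          split_ifs <;> first | omega | simp
  | x :: y :: l, h, hb => by
      simp only [spreadCurve, List.mem_append, List.mem_reverse] at h
      have hb1 := hb (x, y) (by simp [overArcs])
      rcases h with (h | h) | h
      · exact ⟨x, by simp, Or.inl ⟨hb1.1, h⟩⟩
      · exact ⟨y, by simp, Or.inl ⟨hb1.2, h⟩⟩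
      · obtain ⟨u, hu, h⟩ := mem_spreadCurve_of_overArcs_ne hab h
          (fun e he => hb e (by simp [overArcs, he]))
        exact ⟨u, by simp [hu], h⟩

theorem isPoint_move {F G : VCD n} {k : Fin n} {l r : List ℤ} {x y z : ℤ}
    (h : F.curve k = l ++ x :: r) (hG : G.curve = Function.update F.curve k (l ++ y :: r))
    (hz : G.IsPoint z) : z = y ∨ F.IsPoint z := by
  obtain ⟨j, hz⟩ := hz
  rw [hG] at hz
  by_cases hjk : j = k
  · subst hjk
    rw [Function.update_self] at hz
    by_cases hzy : z = y
    · exact Or.inl hzy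
    · refine Or.inr ⟨j, ?_⟩
      rw [h]
      simp at hz ⊢
      tauto
  · rw [Function.update_of_ne hjk] at hz
    exact Or.inr ⟨j, hz⟩

/-- The case of a terminal under arc ending at the point `b` over which `a` moves. -/
theorem StepAt.spread_terminal_right_under {w : ℤ} (h : StepAt D E k x b (l ++ [w]) [])
    (hxa : a < x) (hxb : x ≠ b) (hl : Even l.length) :
    Equivalent (D.spread a b hab) (E.spread a b hab) := by
  have hadj := h.2.1
  have hc := h.1
  have hcs : (D.spread a b hab).curve k = spreadCurve a b l ++ outward a b w ++
      (outward a b x).reverse ++ [b] := by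
    rw [spread_curve, hc, List.append_assoc, spreadCurve_append hl]
    simp [spreadCurve, hab.ne', shift]
  have ht : spreadCurve a b (l ++ [w] ++ [b]) = spreadCurve a b l ++ outward a b w ++
      [b + 2 * (b - a) + (b - a), b + 2 * (b - a) - (b - a), b] := by
    rw [List.append_assoc, spreadCurve_append hl]; simp [spreadCurve, outward_right hab]
  rcases lt_or_gt_of_ne hxb with c | c
  · have houtx : outward a b x =
        [x, b + 2 * (b - a) - (x - a), b + 2 * (b - a) + (x - a)] := by
      simp [outward, hxa.ne', hxa, c.le]
    have hb := fun {j : Fin n} {e : ℤ × ℤ} => overArcs_ne_of_curve_eq (D := D) (k := k)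
      (l := l ++ [w] ++ [x]) (c := b) (j := j) (e := e) (by simpa using hc)
      (by simpa [Nat.even_add_one] using hl)
    have hnb : ∀ z, (D.spread a b hab).IsPoint z →
        z ≠ b + 2 * (b - a) - (b - a) ∧ z ≠ b + 2 * (b - a) + (b - a) := by
      rintro z ⟨j, hz⟩
      obtain ⟨u, _, ⟨hu, hz⟩ | hz | hz⟩ := mem_spreadCurve_of_overArcs_ne hab hz
        (fun e he => hb he)
      · have := mem_outward hab hz
        omega
      · omega
      · omega
    have adj : List.Forall₂ (D.spread a b hab).Adjacent
        [b + 2 * (b - a) + (x - a), b + 2 * (b - a) - (x - a), x]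
        [b + 2 * (b - a) + (b - a), b + 2 * (b - a) - (b - a), b] := by
      refine .cons ?_ (.cons ?_ (.cons ?_ .nil)) <;> intro z hz <;>
        obtain ⟨u, hu, hz⟩ := isPoint_spread hz <;> have h3 := hadj u hu <;>
        unfold Encloses at * <;> dsimp only at * <;> omega
    simp only [List.forall₂_cons] at adj
    obtain ⟨F, hF, hF'⟩ := exists_collapse_terminal (D := D.spread a b hab) (k := k)
      (l := spreadCurve a b l ++ outward a b w ++
        [b + 2 * (b - a) + (x - a), b + 2 * (b - a) - (x - a)]) (xs := [x]) (c := b)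
      (by rw [hcs, houtx]; simp) (by simpa using adj.2.2.1)
    have hsub : ∀ z ∈ spreadCurve a b l ++ outward a b w ++
        [b + 2 * (b - a) + (x - a), b + 2 * (b - a) - (x - a)] ++ [b],
        z ∈ (D.spread a b hab).curve k := by
      rw [hcs, houtx]; simp; tauto
    have hFc := congrFun hF' k
    rw [Function.update_self] at hFc
    obtain ⟨G, hG, hG'⟩ := exists_move (D := F) (k := k)
      (l := spreadCurve a b l ++ outward a b w) (x := b + 2 * (b - a) + (x - a))
      (y := b + 2 * (b - a) + (b - a)) (r := [b + 2 * (b - a) - (x - a), b])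
      (by rw [hFc]; simp) (adjacent_of_update adj.1 hF' hsub)
      (fun hz => (hnb _ (isPoint_update hF' hsub hz)).2 rfl)
    have hGp : ∀ z, G.IsPoint z →
        z = b + 2 * (b - a) + (b - a) ∨ (D.spread a b hab).IsPoint z := fun z hz =>
      (isPoint_move (x := b + 2 * (b - a) + (x - a)) (by rw [hFc]; simp) hG' hz).imp id fun hz => isPoint_update hF' hsub hz
    obtain ⟨H, hH, hH'⟩ := exists_move (D := G) (k := k)
      (l := spreadCurve a b l ++ outward a b w ++ [b + 2 * (b - a) + (b - a)])
      (x := b + 2 * (b - a) - (x - a)) (y := b + 2 * (b - a) - (b - a)) (r := [b])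
      (by rw [hG', Function.update_self]; simp)
      (fun z hz => by
        rcases hGp z hz with rfl | hz
        · unfold Encloses; dsimp only; omega
        · exact adj.2.1 z hz)
      (fun hz => by
        rcases hGp _ hz with hz | hz
        · omega
        · exact (hnb _ hz).1 rfl)
    refine h.spread_eq_right (hF.trans (hG.trans hH)) ?_
    rw [hH', hG', hF', ht, Function.update_idem, Function.update_idem]
    simp
  · have houtx : outward a b x = [x + 3 * (b - a)] := by
      simp [outward, hxa.ne', c.not_ge, shift, c]
    have hE := h.curve_self
    rw [contract_nil] at hE
    have hx : ¬ E.IsPoint x := by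
      rintro ⟨j, hj⟩
      by_cases hjk : j = k
      · subst hjk; rw [h.curve_self] at hj; exact (mem_contract h.1 hj).2.1 rfl
      · rw [h.curve_of_ne hjk] at hj
        exact D.curve_disjoint j k hjk hj (by simp [hc])
    have adj : (E.spread a b hab).Adjacent (b + 2 * (b - a) + (b - a)) (x + 3 * (b - a)) := by
      intro z hz
      obtain ⟨u, hu, hz⟩ := isPoint_spread hz
      have h3 := hadj u (h.isPoint hu)
      unfold Encloses at *
      dsimp only at *
      omega
    have hnp : ¬ (E.spread a b hab).IsPoint (x + 3 * (b - a)) := by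
      intro hz
      obtain ⟨u, hu, hz⟩ := isPoint_spread hz
      have : u ≠ x := by rintro rfl; exact hx hu
      omega
    have hEc : (E.spread a b hab).curve k = spreadCurve a b l ++ outward a b w ++
        [b + 2 * (b - a) + (b - a), b + 2 * (b - a) - (b - a), b] := by
      rw [spread_curve, hE, ht]
    obtain ⟨F, hF, hF'⟩ := exists_collapse_terminal (D := E.spread a b hab) (k := k)
      (l := spreadCurve a b l ++ outward a b w ++ [b + 2 * (b - a) + (b - a)])
      (xs := [b + 2 * (b - a) - (b - a)]) (c := b)
      (by rw [hEc]; simp) (by simpa using adjacent_spread_right)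
    have hsub : ∀ z ∈ spreadCurve a b l ++ outward a b w ++
        [b + 2 * (b - a) + (b - a)] ++ [b], z ∈ (E.spread a b hab).curve k := by
      rw [hEc]; simp; tauto
    obtain ⟨G, hG, hG'⟩ := exists_move (D := F) (k := k)
      (l := spreadCurve a b l ++ outward a b w) (x := b + 2 * (b - a) + (b - a))
      (y := x + 3 * (b - a)) (r := [b])
      (by rw [hF', Function.update_self]; simp) (adjacent_of_update adj hF' hsub)
      (fun hz => hnp (isPoint_update hF' hsub hz))
    have : G = D.spread a b hab := by
      apply VCD.ext
      rw [hG', hF', Function.update_idem, Function.update_eq_iff]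
      refine ⟨by rw [hcs, houtx]; simp, fun j hj => ?_⟩
      rw [spread_curve, spread_curve, h.curve_of_ne hj]
    rw [← this]
    exact (hF.trans hG).symm

/-- The case of a terminal arc ending at the point `b` over which `a` moves. -/
theorem StepAt.spread_terminal_right (h : StepAt D E k x b l []) (ha : ∃ j, D.terminal j = a) :
    Equivalent (D.spread a b hab) (E.spread a b hab) := by
  have hx := ne_terminal_of_curve_eq h.1 (by simp)
  have htb : D.terminal k = b := terminal_eq_of_curve_eq (l := l ++ [x]) (by simp [h.1])
  obtain ⟨ja, ha⟩ := ha
  have hxb : x ≠ b := htb ▸ (hx k).symm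
  have hxa : x ≠ a := ha ▸ (hx ja).symm
  have hax := h.2.1 a (ha ▸ D.isPoint_terminal ja)
  have hxgt : a < x := by unfold Encloses at hax; dsimp only at hax; omega
  rcases Nat.even_or_odd l.length with hl | hl
  · exact h.spread_terminal_right_over hxgt hxb hl
  · obtain ⟨l, w, rfl⟩ : ∃ l' w, l = l' ++ [w] := by
      rcases List.eq_nil_or_concat l with rfl | ⟨l', s, rfl⟩
      · simp at hl
      · exact ⟨l', s, by simp⟩
    exact h.spread_terminal_right_under hxgt hxb (by simpa [Nat.odd_add_one] using hl)

/-- The case of a terminal arc that ends neither at `a` nor at `b`. -/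
theorem StepAt.spread_terminal_of_ne (h : StepAt D E k x y l []) (ha : ∃ j, D.terminal j = a)
    (hb : ∃ j, D.terminal j = b) (hT : ∀ j, ¬ (a < D.terminal j ∧ D.terminal j < b))
    (hya : y ≠ a) (hyb : y ≠ b) :
    Equivalent (D.spread a b hab) (E.spread a b hab) := by
  have hx := ne_terminal_of_curve_eq h.1 (by simp)
  have hty : D.terminal k = y := terminal_eq_of_curve_eq (l := l ++ [x]) (by simp [h.1])
  obtain ⟨ja, ha⟩ := ha
  obtain ⟨jb, hb⟩ := hb
  have hxb : x ≠ b := hb ▸ (hx jb).symm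
  have hxa : x ≠ a := ha ▸ (hx ja).symm
  have hadj := h.2.1
  have hax := hadj a (ha ▸ D.isPoint_terminal ja)
  have hbx := hadj b (hb ▸ D.isPoint_terminal jb)
  have hyT := hT k
  rw [hty] at hyT
  have hxy : (x < a ∧ y < a) ∨ (b < x ∧ b < y) := by
    unfold Encloses at hax hbx; dsimp only at hax hbx; omega
  have hox : outward a b x = [shift a b x] := by
    unfold outward; rw [if_neg hxa, if_neg (by omega)]
  have hoy : outward a b y = [shift a b y] := by
    unfold outward; rw [if_neg hya, if_neg (by omega)]
  have hc := h.1
  rcases Nat.even_or_odd l.length with hl | hl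
  · have adj : (D.spread a b hab).Adjacent (shift a b x) (shift a b y) := by
      intro z hz
      obtain ⟨u, hu, hz⟩ := isPoint_spread hz
      have h3 := hadj u hu
      unfold Encloses shift at *
      dsimp only at *
      split_ifs <;> omega
    obtain ⟨F, hF, hF'⟩ := exists_collapse_terminal (D := D.spread a b hab) (k := k)
      (l := spreadCurve a b l) (xs := [shift a b x]) (c := shift a b y)
      (by rw [spread_curve, hc, spreadCurve_append hl]; simp [spreadCurve, hox, hoy])
      (by simpa using adj)
    rw [← spread_eq_of_curve_eq (hab := hab) h (F := F)
      (by rw [hF', contract_nil, spreadCurve_append hl]; simp [spreadCurve, hya])]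
    exact hF
  · obtain ⟨l, w, rfl⟩ : ∃ l' w, l = l' ++ [w] := by
      rcases List.eq_nil_or_concat l with rfl | ⟨l', s, rfl⟩
      · simp at hl
      · exact ⟨l', s, by simp⟩
    have hl' : Even l.length := by simpa [Nat.odd_add_one] using hl
    have adj : (D.spread a b hab).Adjacent (shift a b x) (shift a b y) := by
      intro z hz
      obtain ⟨u, hu, hz⟩ := isPoint_spread hz
      have h3 := hadj u hu
      unfold Encloses shift at *
      dsimp only at *
      split_ifs <;> omega
    obtain ⟨F, hF, hF'⟩ := exists_collapse_terminal (D := D.spread a b hab) (k := k)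
      (l := spreadCurve a b l ++ outward a b w) (xs := [shift a b x]) (c := shift a b y)
      (by
        rw [spread_curve, hc, List.append_assoc, spreadCurve_append hl']
        simp [spreadCurve, hox, hya])
      (by simpa using adj)
    rw [← spread_eq_of_curve_eq (hab := hab) h (F := F)
      (by
        rw [hF', contract_nil, List.append_assoc l, spreadCurve_append hl']
        simp [spreadCurve, hoy])]
    exact hF

end

/-- The uniform push respects contractions. -/
theorem Step.spread {D E : VCD n} {a b : ℤ} {hab : a < b} (h : Step D E)
    (ha : ∃ j, D.terminal j = a) (hb : ∃ j, D.terminal j = b)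
    (hT : ∀ j, ¬ (a < D.terminal j ∧ D.terminal j < b)) :
    Equivalent (D.spread a b hab) (E.spread a b hab) := by
  obtain ⟨k, x, y, l, r, h⟩ := h
  by_cases hr : r = []
  · subst hr
    by_cases hya : y = a
    · subst hya; exact h.spread_terminal_left hb
    · by_cases hyb : y = b
      · subst hyb; exact h.spread_terminal_right ha
      · exact h.spread_terminal_of_ne ha hb hT hya hyb
  · exact h.spread_of_ne_nil hr ha hb

end VCD

theorem pushCurve_append {a b : ℤ} : ∀ {l r : List ℤ}, Even l.length →
    pushCurve a b (l ++ r) = pushCurve a b l ++ pushCurve a b r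
  | [], _, _ => by simp [pushCurve]
  | [x], _, h => by simp at h
  | x :: y :: l, r, h => by
      have h' : Even l.length := by simpa [Nat.even_add_one] using h
      simp [pushCurve, pushCurve_append h']

namespace VCD

variable {n : ℕ}

/-! ### Over arcs and their ends -/

/-- The points `u` and `v` are the ends of an over arc. -/
def Joined (D : VCD n) (u v : ℤ) : Prop :=
  ∃ k, (u, v) ∈ overArcs (D.curve k) ∨ (v, u) ∈ overArcs (D.curve k)

theorem Joined.symm {D : VCD n} {u v : ℤ} (h : D.Joined u v) : D.Joined v u := by
  obtain ⟨k, h⟩ := h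
  exact ⟨k, h.symm⟩

theorem Joined.unique {D : VCD n} {u v v' : ℤ} (h : D.Joined u v) (h' : D.Joined u v') :
    v = v' := by
  obtain ⟨j, h⟩ := h
  obtain ⟨k, h'⟩ := h'
  rcases h with h | h <;> rcases h' with h' | h' <;>
    rcases D.overArcs_eq_or_apart h h' with c | c <;>
    first
      | (simp only [Prod.mk.injEq] at c; omega)
      | exact absurd rfl c.1
      | exact absurd rfl c.2.1
      | exact absurd rfl c.2.2.1
      | exact absurd rfl c.2.2.2

theorem Joined.isPoint {D : VCD n} {u v : ℤ} (h : D.Joined u v) : D.IsPoint u := by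
  obtain ⟨k, h | h⟩ := h
  · exact ⟨k, (mem_of_mem_overArcs h).1⟩
  · exact ⟨k, (mem_of_mem_overArcs h).2⟩

theorem Joined.ne {D : VCD n} {u v : ℤ} (h : D.Joined u v) : u ≠ v := by
  obtain ⟨k, h | h⟩ := h
  · exact overArcs_ne (D.curve_nodup k) h
  · exact (overArcs_ne (D.curve_nodup k) h).symm

/-- An over arc with one end under another over arc lies entirely under it. -/
theorem Joined.encloses {D : VCD n} {x y u v : ℤ} (h : D.Joined x y) (h' : D.Joined u v)
    (he : Encloses (x, y) u) : Encloses (x, y) v := by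
  have aux : ∀ {e f : ℤ × ℤ} {j k : Fin n}, e ∈ overArcs (D.curve j) → f ∈ overArcs (D.curve k) →
      (Encloses e f.1 ↔ Encloses e f.2) := by
    intro e f j k he hf
    have c1 := D.over_noncrossing j k e he f hf
    have c2 := D.over_noncrossing k j f hf e he
    rcases D.overArcs_eq_or_apart he hf with rfl | ⟨a1, a2, a3, a4⟩
    · unfold Encloses; omega
    · unfold Crosses at c1 c2
      unfold Encloses
      rcases le_total e.1 e.2 with c | c <;> rcases le_total f.1 f.2 with c' | c' <;>
        simp only [min_eq_left c, min_eq_left c', max_eq_right c, max_eq_right c', min_eq_right c,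
          min_eq_right c', max_eq_left c, max_eq_left c'] at * <;> omega
  have swap : ∀ z, Encloses (x, y) z ↔ Encloses (y, x) z := fun z => by
    unfold Encloses; tauto
  obtain ⟨j, h⟩ := h
  obtain ⟨k, h'⟩ := h'
  rcases h with h | h
  · rcases h' with h' | h'
    · exact (aux h h').1 he
    · exact (aux h h').2 he
  · rw [swap] at he ⊢
    rcases h' with h' | h'
    · exact (aux h h').1 he
    · exact (aux h h').2 he

theorem exists_joined {D : VCD n} {u : ℤ} (hu : D.IsPoint u) (ht : ∀ k, D.terminal k ≠ u) :
    ∃ v, D.Joined u v := by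
  obtain ⟨k, hk⟩ := hu
  rcases exists_overArc_or_eq_getLast hk with ⟨e, he, rfl | rfl⟩ | ⟨p, hp, _⟩
  · exact ⟨e.2, k, Or.inl he⟩
  · exact ⟨e.1, k, Or.inr he⟩
  · exact absurd (terminal_eq_of_curve_eq hp) (ht k)

open Classical in
/-- The other end of the over arc at `u`, if there is one. -/
noncomputable def partner (D : VCD n) (u : ℤ) : ℤ :=
  if h : ∃ v, D.Joined u v then h.choose else u

theorem Joined.partner_eq {D : VCD n} {u v : ℤ} (h : D.Joined u v) : D.partner u = v := by
  have hex : ∃ v, D.Joined u v := ⟨v, h⟩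
  unfold partner
  rw [dif_pos hex]
  exact hex.choose_spec.unique h

/-! ### Comparison of the uniform push with the push -/

theorem mem_spreadCurve_or {a b z : ℤ} : ∀ {l : List ℤ}, z ∈ spreadCurve a b l →
    (∃ e ∈ overArcs l, z ∈ outward a b e.1 ∨ z ∈ outward a b e.2) ∨ z = a ∨
      z = b + 2 * (b - a) ∨ ∃ u, z = shift a b u
  | [], h => by simp [spreadCurve] at h
  | [x], h => by
      right
      unfold spreadCurve at h
      split_ifs at h
      · simp at h; tauto
      · simp only [List.mem_singleton] at h
        exact Or.inr (Or.inr ⟨x, h⟩)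
  | x :: y :: l, h => by
      simp only [spreadCurve, List.mem_append, List.mem_reverse] at h
      rcases h with h | h
      · exact Or.inl ⟨(x, y), by simp [overArcs], h⟩
      · rcases mem_spreadCurve_or h with ⟨e, he, h⟩ | h
        · exact Or.inl ⟨e, by simp [overArcs, he], h⟩
        · exact Or.inr h

theorem isPoint_spread_joined {D : VCD n} {a b : ℤ} {hab : a < b} {z : ℤ}
    (h : (D.spread a b hab).IsPoint z) (h1 : b < z) (h2 : z ≤ b + 3 * (b - a))
    (h3 : z ≠ b + 2 * (b - a)) : ∃ u v, D.Joined u v ∧ a < u ∧ u ≤ b ∧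
      (z = b + 2 * (b - a) - (u - a) ∨ z = b + 2 * (b - a) + (u - a)) := by
  obtain ⟨k, h⟩ := h
  rcases mem_spreadCurve_or h with ⟨e, he, h⟩ | h | h | ⟨u, h⟩
  · rcases h with h | h
    · have := mem_outward hab h
      exact ⟨e.1, e.2, ⟨k, Or.inl he⟩, by omega⟩
    · have := mem_outward hab h
      exact ⟨e.2, e.1, ⟨k, Or.inr he⟩, by omega⟩
  · omega
  · exact absurd h h3
  · unfold shift at h
    split_ifs at h <;> omega

/-- The points `u` of `(a, b]` that are joined to another point of `(a, b]` by an over arc. -/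
def Inside (D : VCD n) (a b u : ℤ) : Prop := (a < u ∧ u ≤ b) ∧ ∃ v, D.Joined u v ∧ a < v ∧ v ≤ b

theorem terminal_of_filter {D E : VCD n} {p : ℤ → Bool} {k : Fin n}
    (h : E.curve k = (D.curve k).filter p) (hp : p (D.terminal k) = true) :
    E.terminal k = D.terminal k := by
  refine terminal_eq_of_curve_eq (l := (D.curve k).dropLast.filter p) ?_
  rw [h]
  conv_lhs => rw [← List.dropLast_append_getLast (D.curve_ne_nil k)]
  rw [List.filter_append]
  congr 1
  exact List.filter_cons_of_pos hp

open Classical in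
/-- One of the two strands of turning points along the over arcs inside `(a, b]` is deleted. -/
theorem exists_delete_inside {D X : VCD n} {a b ε : ℤ} {hab : a < b} (hε : ε = 1 ∨ ε = -1)
    (hp : ∀ z, X.IsPoint z → (D.spread a b hab).IsPoint z)
    (ht : ∀ k, ∃ j, X.terminal k = (D.spread a b hab).terminal j)
    (hc : ∀ k x y, (x, y) ∈ overArcs (D.curve k) → a < x ∧ x ≤ b → a < y ∧ y ≤ b → ∃ l r,
      X.curve k = l ++ (b + 2 * (b - a) + ε * (x - a)) :: (b + 2 * (b - a) + ε * (y - a)) :: r ∨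
      X.curve k = l ++ (b + 2 * (b - a) + ε * (y - a)) :: (b + 2 * (b - a) + ε * (x - a)) :: r) :
    ∃ (E : VCD n) (P : ℤ → Bool), Equivalent X E ∧
      (∀ z, P z = true ↔ ∀ u, D.Inside a b u → z ≠ b + 2 * (b - a) + ε * (u - a)) ∧
      ∀ j, E.curve j = (X.curve j).filter P := by
  set S : Finset ℤ := ((Finset.Ioc a b).filter (D.Inside a b)).image
    (fun u => b + 2 * (b - a) + ε * (u - a)) with hS
  have hmem : ∀ z, z ∈ S ↔ ∃ u, D.Inside a b u ∧ b + 2 * (b - a) + ε * (u - a) = z := by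
    intro z
    simp only [hS, Finset.mem_image, Finset.mem_filter, Finset.mem_Ioc]
    constructor
    · rintro ⟨u, ⟨_, hu⟩, h⟩; exact ⟨u, hu, h⟩
    · rintro ⟨u, hu, h⟩; exact ⟨u, ⟨hu.1, hu⟩, h⟩
  set φ : ℤ → ℤ := fun z => b + 2 * (b - a) +
    ε * (D.partner (ε * (z - (b + 2 * (b - a))) + a) - a) with hφ
  have hφu : ∀ u v, D.Joined u v → φ (b + 2 * (b - a) + ε * (u - a)) =
      b + 2 * (b - a) + ε * (v - a) := by
    intro u v h
    have : ε * (b + 2 * (b - a) + ε * (u - a) - (b + 2 * (b - a))) + a = u := by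
      rcases hε with rfl | rfl <;> ring
    rw [hφ]
    dsimp only
    rw [this, h.partner_eq]
  obtain ⟨E, hE, hE'⟩ := exists_delete_nested φ (S := S) (D := X)
    (by
      intro z hz k
      obtain ⟨u, hu, rfl⟩ := (hmem z).1 hz
      obtain ⟨j, hj⟩ := ht k
      rw [hj, terminal_spread]
      have := hu.1
      unfold shift
      rcases hε with rfl | rfl <;> split_ifs <;> omega)
    (by
      intro z hz
      obtain ⟨u, ⟨hu, v, huv, hv⟩, rfl⟩ := (hmem z).1 hz
      rw [hφu u v huv]
      obtain ⟨k, h | h⟩ := huv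
      · obtain ⟨l, r, h⟩ := hc k u v h hu hv
        exact ⟨k, l, r, h⟩
      · obtain ⟨l, r, h⟩ := hc k v u h hv hu
        exact ⟨k, l, r, h.symm⟩)
    (by
      intro z hz
      obtain ⟨u, ⟨hu, v, huv, hv⟩, rfl⟩ := (hmem z).1 hz
      rw [hφu u v huv, hφu v u huv.symm]
      exact ⟨(hmem _).2 ⟨v, ⟨hv, u, huv.symm, hu⟩, rfl⟩, rfl⟩)
    (by
      intro z hz w hw hc
      obtain ⟨u, ⟨hu, v, huv, hv⟩, rfl⟩ := (hmem z).1 hz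
      rw [hφu u v huv] at hc ⊢
      have hw' : b < w ∧ w ≤ b + 3 * (b - a) ∧ w ≠ b + 2 * (b - a) ∧
          (ε = 1 → b + 2 * (b - a) < w) ∧ (ε = -1 → w < b + 2 * (b - a)) := by
        unfold Encloses at hc
        dsimp only at hc
        rcases hε with rfl | rfl <;> omega
      obtain ⟨u', v', hj, h1, h2, h3⟩ := isPoint_spread_joined (hp w hw) hw'.1 hw'.2.1 hw'.2.2.1
      have hw2 : w = b + 2 * (b - a) + ε * (u' - a) := by
        rcases hε with rfl | rfl <;> omega
      subst hw2
      have e1 : Encloses (u, v) u' := by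
        unfold Encloses at hc ⊢
        dsimp only at hc ⊢
        rcases hε with rfl | rfl <;> omega
      have e2 := huv.encloses hj e1
      have hv' : a < v' ∧ v' ≤ b := by
        unfold Encloses at e2
        dsimp only at e2
        omega
      rw [hφu u' v' hj]
      refine ⟨(hmem _).2 ⟨u', ⟨⟨h1, h2⟩, v', hj, hv'⟩, rfl⟩, ?_⟩
      unfold Encloses at e2 ⊢
      dsimp only at e2 ⊢
      rcases hε with rfl | rfl <;> omega)
  refine ⟨E, _, hE, fun z => ?_, hE'⟩
  rw [decide_eq_true_eq, hmem]
  push Not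
  exact forall_congr' fun u => forall_congr' fun _ => ne_comm

theorem filter_spreadCurve_eq_pushCurve {a b : ℤ} {P : ℤ → Bool} (ha : P a = true)
    (ht : P (b + 2 * (b - a)) = true) (hs : ∀ u, P (shift a b u) = true) : ∀ {l : List ℤ},
    (∀ e ∈ overArcs l, (outward a b e.1 ++ (outward a b e.2).reverse).filter P =
      pushOver a b e.1 e.2) → (spreadCurve a b l).filter P = pushCurve a b l
  | [], _ => by simp [spreadCurve, pushCurve]
  | [x], _ => by
      unfold spreadCurve pushCurve
      split_ifs <;> simp [ha, ht, hs]
  | x :: y :: l, h => by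
      rw [spreadCurve, pushCurve, List.filter_append, h (x, y) (by simp [overArcs]),
        filter_spreadCurve_eq_pushCurve ha ht hs fun e he => h e (by simp [overArcs, he])]

open Classical in
/-- The uniform push and the push give equivalent diagrams: the turning points on the over arcs
inside `(a, b]` can be deleted. -/
theorem equivalent_spread_push (D : VCD n) {a b : ℤ} (hab : a < b) (ha : ∃ k, D.terminal k = a) :
    Equivalent (D.spread a b hab) (D.push a b hab ha) := by
  have hsplit : ∀ k x y, (x, y) ∈ overArcs (D.curve k) → ∃ l r, D.curve k = l ++ x :: y :: r ∧
      Even l.length ∧ (D.spread a b hab).curve k =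
        spreadCurve a b l ++ (outward a b x ++ (outward a b y).reverse) ++ spreadCurve a b r := by
    intro k x y h
    obtain ⟨l, r, h, hl⟩ := mem_overArcs_iff.1 h
    exact ⟨l, r, h, hl, by rw [spread_curve, h, spreadCurve_append hl]; simp [spreadCurve]⟩
  have hout : ∀ x, a < x ∧ x ≤ b → outward a b x =
      [x, b + 2 * (b - a) - (x - a), b + 2 * (b - a) + (x - a)] := by
    intro x hx
    unfold outward
    rw [if_neg (by omega), if_pos hx]
  obtain ⟨X, P₁, hX, hP₁, hX'⟩ := exists_delete_inside (D := D) (X := D.spread a b hab) (a := a) (b := b)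
    (ε := 1) (hab := hab) (Or.inl rfl) (fun z hz => hz) (fun k => ⟨k, rfl⟩) (by
      intro k x y h hx hy
      obtain ⟨l, r, _, _, hc⟩ := hsplit k x y h
      refine ⟨spreadCurve a b l ++ [x, b + 2 * (b - a) - (x - a)],
        [b + 2 * (b - a) - (y - a), y] ++ spreadCurve a b r, Or.inl ?_⟩
      rw [hc, hout x hx, hout y hy]
      simp)
  have hXp : ∀ z, X.IsPoint z → (D.spread a b hab).IsPoint z := by
    rintro z ⟨j, hz⟩
    rw [hX'] at hz
    exact ⟨j, (List.mem_filter.1 hz).1⟩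
  have hXt : ∀ k, ∃ j, X.terminal k = (D.spread a b hab).terminal j := by
    intro k
    refine ⟨k, ?_⟩
    refine terminal_of_filter (hX' k) ?_
    rw [hP₁]
    intro u hu
    have := hu.1
    rw [terminal_spread]
    unfold shift
    split_ifs <;> omega
  obtain ⟨Y, P₂, hY, hP₂, hY'⟩ := exists_delete_inside (D := D) (X := X) (a := a) (b := b)
    (ε := -1) (hab := hab) (Or.inr rfl) hXp hXt (by
      intro k x y h hx hy
      obtain ⟨l, r, _, _, hc⟩ := hsplit k x y h
      have keep : ∀ z, z ≤ b + 2 * (b - a) →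
          P₁ z = true := by
        intro z hz
        rw [hP₁]
        intro u hu
        have := hu.1
        omega
      have hIx : D.Inside a b x := ⟨hx, y, ⟨k, Or.inl h⟩, hy⟩
      have hIy : D.Inside a b y := ⟨hy, x, ⟨k, Or.inr h⟩, hx⟩
      have drop : ∀ u, D.Inside a b u → 
          ¬ P₁ (b + 2 * (b - a) + (u - a)) = true := by
        intro u hu h
        rw [hP₁] at h
        exact h u hu (by ring)
      rw [hX', hc, hout x hx, hout y hy]
      simp only [List.filter_append, List.reverse_cons, List.reverse_nil, List.nil_append,
        List.cons_append]
      rw [List.filter_cons_of_pos (keep x (by omega)), List.filter_cons_of_pos (keep _ (by omega)),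
        List.filter_cons_of_neg (drop x hIx), List.filter_cons_of_neg (drop y hIy),
        List.filter_cons_of_pos (keep _ (by omega)), List.filter_cons_of_pos (keep y (by omega))]
      refine ⟨(spreadCurve a b l).filter P₁ ++ [x], y :: (spreadCurve a b r).filter P₁, Or.inl ?_⟩
      rw [show b + 2 * (b - a) + -1 * (x - a) = b + 2 * (b - a) - (x - a) by ring,
        show b + 2 * (b - a) + -1 * (y - a) = b + 2 * (b - a) - (y - a) by ring]
      simp)
  set P : ℤ → Bool := fun z => P₂ z && P₁ z with hP
  have hPiff : ∀ z, P z = true ↔ ∀ u, D.Inside a b u →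
      z ≠ b + 2 * (b - a) - (u - a) ∧ z ≠ b + 2 * (b - a) + (u - a) := by
    intro z
    simp only [hP, Bool.and_eq_true, hP₁, hP₂]
    constructor
    · rintro ⟨h1, h2⟩ u hu
      have := h1 u hu
      have := h2 u hu
      omega
    · intro h
      constructor <;> intro u hu <;> have := h u hu <;> omega
  have hYc : ∀ j, Y.curve j = ((D.spread a b hab).curve j).filter P := by
    intro j
    rw [hY', hX', List.filter_filter]
  have keep : ∀ z, z ≤ b ∨ z = b + 2 * (b - a) ∨ b + 3 * (b - a) < z → P z = true := by
    intro z hz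
    rw [hPiff]
    intro u hu
    have := hu.1
    omega
  have keep2 : ∀ u, ¬ D.Inside a b u →
      P (b + 2 * (b - a) - (u - a)) = true ∧ P (b + 2 * (b - a) + (u - a)) = true ∨
        ¬ (a < u ∧ u ≤ b) := by
    intro u hu
    by_cases h : a < u ∧ u ≤ b
    · left
      rw [hPiff, hPiff]
      constructor <;> intro u' hu' <;> have := hu'.1 <;>
        have : u ≠ u' := fun h => hu (h ▸ hu')
      all_goals omega
    · exact Or.inr h
  have drop : ∀ u, D.Inside a b u →
      ¬ P (b + 2 * (b - a) - (u - a)) = true ∧ ¬ P (b + 2 * (b - a) + (u - a)) = true := by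
    intro u hu
    rw [hPiff, hPiff]
    exact ⟨fun h => (h u hu).1 rfl, fun h => (h u hu).2 rfl⟩
  have hshift : ∀ u, P (shift a b u) = true := by
    intro u
    apply keep
    unfold shift
    split_ifs <;> omega
  obtain ⟨ka, hka⟩ := ha
  have hfst : ∀ k, ∀ e ∈ overArcs (D.curve k), e.1 ≠ a := fun k e he =>
    hka ▸ D.overArc_fst_ne_terminal he
  have harc : ∀ k, ∀ e ∈ overArcs (D.curve k), ¬ (e.2 = a ∧ a < e.1 ∧ e.1 ≤ b) →
      (outward a b e.1 ++ (outward a b e.2).reverse).filter P = pushOver a b e.1 e.2 := by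
    rintro k ⟨x, y⟩ he hxy
    have hxa := hfst k _ he
    dsimp only at hxa hxy ⊢
    have hj : D.Joined x y := ⟨k, Or.inl he⟩
    unfold pushOver
    by_cases hya : y = a
    · subst hya
      have : outward y b x = [shift y b x] := by
        unfold outward; rw [if_neg hxa, if_neg (by omega)]
      rw [if_pos rfl, this]
      simp [outward, hshift, keep]
    rw [if_neg hya]
    have hox : ¬ (a < x ∧ x ≤ b) → outward a b x = [shift a b x] := by
      intro h; unfold outward; rw [if_neg hxa, if_neg h]
    have hoy : ¬ (a < y ∧ y ≤ b) → outward a b y = [shift a b y] := by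
      intro h; unfold outward; rw [if_neg hya, if_neg h]
    by_cases hx : a < x ∧ x ≤ b <;> by_cases hy : a < y ∧ y ≤ b
    · have dx := drop x ⟨hx, y, hj, hy⟩
      have dy := drop y ⟨hy, x, hj.symm, hx⟩
      rw [if_neg (by tauto), if_neg (by tauto), hout x hx, hout y hy]
      simp only [List.reverse_cons, List.reverse_nil, List.nil_append, List.cons_append]
      rw [List.filter_cons_of_pos (keep x (by omega)), List.filter_cons_of_neg dx.1,
        List.filter_cons_of_neg dx.2, List.filter_cons_of_neg dy.2, List.filter_cons_of_neg dy.1,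
        List.filter_cons_of_pos (keep y (by omega))]
      unfold shift
      rw [if_neg (by omega), if_neg (by omega)]
      rfl
    · have kx := (keep2 x (by
        rintro ⟨_, v, hv, hv'⟩
        exact hy (hj.unique hv ▸ hv'))).resolve_right (by tauto)
      rw [if_pos ⟨hx, hy⟩, hout x hx, hoy hy]
      simp [kx.1, kx.2, hshift, keep x (by omega)]
    · have ky := (keep2 y (by
        rintro ⟨_, v, hv, hv'⟩
        exact hx (hj.symm.unique hv ▸ hv'))).resolve_right (by tauto)
      rw [if_neg (by tauto), if_pos ⟨hy, hx⟩, hout y hy, hox hx]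
      simp [ky.1, ky.2, hshift, keep y (by omega)]
    · rw [if_neg (by tauto), if_neg (by tauto), hox hx, hoy hy]
      simp [hshift]
  refine (hX.trans hY).trans ?_
  by_cases hex : ∃ k x, (x, a) ∈ overArcs (D.curve k) ∧ a < x ∧ x ≤ b
  swap
  · have : Y = D.push a b hab ⟨ka, hka⟩ := by
      apply VCD.ext
      ext1 k
      rw [hYc]
      refine filter_spreadCurve_eq_pushCurve (keep a (by omega)) (keep _ (by omega)) hshift
        fun e he => harc k e he ?_
      rintro ⟨h1, h2⟩
      exact hex ⟨k, e.1, by rw [← h1]; exact he, h2⟩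
    rw [this]
    exact Equivalent.refl _
  -- the turning points on a terminal over arc from `(a, b]` to `a` are adjacent to the terminal point
  obtain ⟨k, x, he, hx⟩ := hex
  obtain ⟨l, r, hl, hle, hlc⟩ := hsplit k x a he
  have hr : r = [] := by
    by_contra hr
    exact ne_terminal_of_curve_eq (l := l ++ [x]) (x := a) (by rw [hl]; simp) hr ka hka
  subst hr
  have hj : D.Joined x a := ⟨k, Or.inl he⟩
  have kx := (keep2 x (by
    rintro ⟨_, v, hv, hv'⟩
    have := hj.unique hv
    omega)).resolve_right (by tauto)
  have hYk : Y.curve k = (spreadCurve a b l).filter P ++ [x] ++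
      [b + 2 * (b - a) - (x - a), b + 2 * (b - a) + (x - a)] ++ [b + 2 * (b - a)] := by
    rw [hYc, hlc, hout x hx]
    simp only [outward, if_true, spreadCurve, List.filter_append, List.reverse_singleton]
    simp [kx.1, kx.2, keep x (by omega), keep (b + 2 * (b - a)) (by omega)]
  have hadj : ∀ y ∈ [b + 2 * (b - a) - (x - a), b + 2 * (b - a) + (x - a)],
      Y.Adjacent y (b + 2 * (b - a)) := by
    rintro y hy z ⟨j, hz⟩ hc
    rw [hYc, List.mem_filter] at hz
    have hz' : b < z ∧ z ≤ b + 3 * (b - a) ∧ z ≠ b + 2 * (b - a) := by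
      simp only [List.mem_cons, List.not_mem_nil, or_false] at hy
      unfold Encloses at hc
      dsimp only at hc
      omega
    obtain ⟨u, v, huv, h1, h2, h3⟩ :=
      isPoint_spread_joined ⟨j, hz.1⟩ hz'.1 hz'.2.1 hz'.2.2
    have hux : Encloses (x, a) u := by
      simp only [List.mem_cons, List.not_mem_nil, or_false] at hy
      unfold Encloses at hc ⊢
      dsimp only at hc ⊢
      omega
    have hvx := hj.encloses huv hux
    have := drop u ⟨⟨h1, h2⟩, v, huv, by unfold Encloses at hvx; dsimp only at hvx; omega⟩
    rcases h3 with rfl | rfl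
    · exact this.1 hz.2
    · exact this.2 hz.2
  obtain ⟨Z, hZ, hZ'⟩ := exists_collapse_terminal hYk hadj
  have : Z = D.push a b hab ⟨ka, hka⟩ := by
    apply VCD.ext
    rw [hZ', Function.update_eq_iff]
    have hn := D.curve_nodup k
    rw [hl] at hn
    constructor
    · show _ = pushCurve a b (D.curve k)
      rw [hl, pushCurve_append hle, filter_spreadCurve_eq_pushCurve (keep a (by omega))
        (keep _ (by omega)) hshift]
      · simp only [pushCurve, pushOver, if_true, shift]
        rw [if_neg (by omega)]
        simp
      · intro e he'
        refine harc k e (by rw [hl, overArcs_append hle]; simp [he']) ?_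
        rintro ⟨h1, _⟩
        have := (mem_of_mem_overArcs he').2
        rw [h1] at this
        simp [List.nodup_append] at hn
        grind
    · intro j hjk
      rw [hYc]
      refine filter_spreadCurve_eq_pushCurve (keep a (by omega)) (keep _ (by omega)) hshift
        fun e he' => harc j e he' ?_
      rintro ⟨h1, _⟩
      have h2 := (mem_of_mem_overArcs he').2
      rw [h1] at h2
      exact D.curve_disjoint j k hjk h2 (by rw [hl]; simp)
  rw [← this]
  exact hZ

end VCD

/-! ### Relabelling and moving the landing place -/

theorem shift_of_le {a b x : ℤ} (h : x ≤ b) : shift a b x = x := if_neg (by omega)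

theorem shift_of_lt {a b x : ℤ} (h : b < x) : shift a b x = x + 3 * (b - a) := if_pos h

theorem outward_self (a b : ℤ) : outward a b a = [b + 2 * (b - a)] := if_pos rfl

theorem outward_of_mem {a b x : ℤ} (h : a < x) (h' : x ≤ b) :
    outward a b x = [x, b + 2 * (b - a) - (x - a), b + 2 * (b - a) + (x - a)] := by
  unfold outward
  rw [if_neg (by omega), if_pos ⟨h, h'⟩]

theorem outward_of_lt {a b x : ℤ} (hab : a < b) (h : x < a) : outward a b x = [x] := by
  unfold outward
  rw [if_neg (by omega), if_neg (by omega), shift_of_le (by omega)]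

theorem outward_of_gt {a b x : ℤ} (hab : a < b) (h : b < x) :
    outward a b x = [x + 3 * (b - a)] := by
  unfold outward
  rw [if_neg (by omega), if_neg (by omega), shift_of_lt h]

/-- A criterion for a uniform push to be compatible with relabelling, in which the points not in `P`
are removed. -/
theorem filter_spreadCurve_map {a b a' b' : ℤ} {g G : ℤ → ℤ} {P : ℤ → Bool} : ∀ {l : List ℤ},
    (∀ x ∈ l, (outward a' b' (g x)).filter P = (outward a b x).map G) →
    (∀ x ∈ l.getLast?, (if g x = a' then [a', b' + 2 * (b' - a')] else [shift a' b' (g x)]).filter P =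
      (if x = a then [a, b + 2 * (b - a)] else [shift a b x]).map G) →
    (spreadCurve a' b' (l.map g)).filter P = (spreadCurve a b l).map G
  | [], _, _ => by simp [spreadCurve]
  | [x], _, h => by simpa only [spreadCurve, List.map_cons, List.map_nil] using h x (by simp)
  | x :: y :: l, h, h' => by
      simp only [spreadCurve, List.map_cons, List.map_append, List.map_reverse, List.filter_append,
        List.filter_reverse]
      rw [h x (by simp), h y (by simp), filter_spreadCurve_map (fun z hz => h z (by simp [hz]))]
      intro z hz
      refine h' z ?_
      have : l ≠ [] := by rintro rfl; simp at hz
      rw [List.getLast?_cons, List.getLast?_cons, Option.mem_def.1 hz]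
      simp

namespace VCD

variable {n : ℕ}

/-- The uniform push respects relabellings; the new points are relabelled by their place relative to
`a` and `b`. -/
theorem Relabel.spread {D E : VCD n} {g : ℤ → ℤ} {a b : ℤ} (hab : a < b)
    (hg : ∀ x y, D.IsPoint x → D.IsPoint y → x < y → g x < g y)
    (hE : ∀ k, E.curve k = (D.curve k).map g) (ha : D.IsPoint a) (hb : D.IsPoint b) :
    Relabel (D.spread a b hab) (E.spread (g a) (g b) (hg a b ha hb hab)) := by
  have hab' := hg a b ha hb hab
  have le : ∀ x y, D.IsPoint x → D.IsPoint y → (g x < g y ↔ x < y) := by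
    intro x y hx hy
    refine ⟨fun h => ?_, hg x y hx hy⟩
    by_contra hc
    rcases (not_lt.1 hc).lt_or_eq with c | c
    · exact absurd (hg y x hy hx c) (by omega)
    · subst c; omega
  refine ⟨fun z => if z ≤ b then g z
    else if z ≤ b + 2 * (b - a) then g b + 2 * (g b - g a) - (g (a + (b + 2 * (b - a) - z)) - g a)
    else if z ≤ b + 3 * (b - a) then g b + 2 * (g b - g a) + (g (a + (z - (b + 2 * (b - a)))) - g a)
    else g (z - 3 * (b - a)) + 3 * (g b - g a), ?_, fun k => ?_⟩
  · have key : ∀ z, (D.spread a b hab).IsPoint z → ∃ u, D.IsPoint u ∧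
      ((u ≤ b ∧ z = u) ∨ (a ≤ u ∧ u ≤ b ∧ z = b + 2 * (b - a) - (u - a)) ∨
      (a < u ∧ u ≤ b ∧ z = b + 2 * (b - a) + (u - a)) ∨ (b < u ∧ z = u + 3 * (b - a))) := by
      intro z hz
      obtain ⟨u, hu, h⟩ := isPoint_spread hz
      exact ⟨u, hu, by omega⟩
    intro z w hz hw hzw
    obtain ⟨u, hu, h⟩ := key z hz
    obtain ⟨v, hv, h'⟩ := key w hw
    have m1 := le u v hu hv
    have m2 := le v u hv hu
    have m3 := le u a hu ha
    have m4 := le a u ha hu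
    have m5 := le u b hu hb
    have m6 := le b u hb hu
    have m7 := le v a hv ha
    have m8 := le a v ha hv
    have m9 := le v b hv hb
    have m10 := le b v hb hv
    have e1 : ∀ u, a + (b + 2 * (b - a) - (b + 2 * (b - a) - (u - a))) = u := fun u => by ring
    have e2 : ∀ u, a + (b + 2 * (b - a) + (u - a) - (b + 2 * (b - a))) = u := fun u => by ring
    have e3 : ∀ u, u + 3 * (b - a) - 3 * (b - a) = u := fun u => by ring
    have val : ∀ u z, ((u ≤ b ∧ z = u) ∨ (a ≤ u ∧ u ≤ b ∧ z = b + 2 * (b - a) - (u - a)) ∨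
      (a < u ∧ u ≤ b ∧ z = b + 2 * (b - a) + (u - a)) ∨ (b < u ∧ z = u + 3 * (b - a))) →
      ∃ c, (if z ≤ b then g z
    else if z ≤ b + 2 * (b - a) then g b + 2 * (g b - g a) - (g (a + (b + 2 * (b - a) - z)) - g a)
    else if z ≤ b + 3 * (b - a) then g b + 2 * (g b - g a) + (g (a + (z - (b + 2 * (b - a)))) - g a)
    else g (z - 3 * (b - a)) + 3 * (g b - g a)) = c ∧ ((u ≤ b ∧ z = u ∧ c = g u) ∨
      (a ≤ u ∧ u ≤ b ∧ z = b + 2 * (b - a) - (u - a) ∧ c = g b + 2 * (g b - g a) - (g u - g a)) ∨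
      (a < u ∧ u ≤ b ∧ z = b + 2 * (b - a) + (u - a) ∧ c = g b + 2 * (g b - g a) + (g u - g a)) ∨
      (b < u ∧ z = u + 3 * (b - a) ∧ c = g u + 3 * (g b - g a))) := by
      intro u z h
      refine ⟨_, rfl, ?_⟩
      rcases h with ⟨h1, rfl⟩ | ⟨h1, h2, rfl⟩ | ⟨h1, h2, rfl⟩ | ⟨h1, rfl⟩
      · left; rw [if_pos h1]; simp [h1]
      · right; left
        rw [if_neg (by omega), if_pos (by omega), e1]
        simp [h1, h2]
      · right; right; left
        rw [if_neg (by omega), if_neg (by omega), if_pos (by omega), e2]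
        simp [h1, h2]
      · right; right; right
        rw [if_neg (by omega), if_neg (by omega), if_neg (by omega), e3]
        simp [h1]
    obtain ⟨c, hc, h⟩ := val u z h
    obtain ⟨c', hc', h'⟩ := val v w h'
    dsimp only
    rw [hc, hc']
    clear hc hc' e1 e2 e3 val key
    rcases h with h | h | h | h <;> rcases h' with h' | h' | h' | h' <;> omega
  · have inj : ∀ x, D.IsPoint x → (g x = g a ↔ x = a) := by
      intro x hx
      have := le x a hx ha
      have := le a x ha hx
      refine ⟨fun h => by omega, fun h => by rw [h]⟩
    rw [spread_curve, spread_curve, hE,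
      ← List.filter_true (spreadCurve (g a) (g b) ((D.curve k).map g))]
    refine filter_spreadCurve_map ?_ ?_
    · intro x hx
      have hx : D.IsPoint x := ⟨k, hx⟩
      rw [List.filter_true]
      have := inj x hx
      have := le a x ha hx
      have := le b x hb hx
      have e1 : a + (b + 2 * (b - a) - (b + 2 * (b - a))) = a := by ring
      have e1' : a + (b + 2 * (b - a) - (b + 2 * (b - a) - (x - a))) = x := by ring
      have e2 : a + (b + 2 * (b - a) + (x - a) - (b + 2 * (b - a))) = x := by ring
      have e3 : x + 3 * (b - a) - 3 * (b - a) = x := by ring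
      rcases lt_trichotomy x a with h1 | rfl | h1
      · rw [outward_of_lt hab' (by omega), outward_of_lt hab h1, List.map_singleton,
          if_pos (by omega)]
      · rw [outward_self, outward_self, List.map_singleton, if_neg (by omega), if_pos le_rfl, e1]
        simp
      · by_cases h2 : x ≤ b
        · rw [outward_of_mem (by omega) (by omega), outward_of_mem h1 h2]
          simp only [List.map_cons, List.map_nil]
          rw [if_pos h2, if_neg (by omega), if_pos (by omega), if_neg (by omega),
            if_neg (by omega), if_pos (by omega), e1', e2]
        · rw [outward_of_gt hab' (by omega), outward_of_gt hab (by omega), List.map_singleton,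
            if_neg (by omega), if_neg (by omega), if_neg (by omega), e3]
    · intro x hx
      have hx : D.IsPoint x := ⟨k, List.mem_of_getLast? hx⟩
      rw [List.filter_true]
      have := inj x hx
      have := le b x hb hx
      have e1 : a + (b + 2 * (b - a) - (b + 2 * (b - a))) = a := by ring
      have e3 : x + 3 * (b - a) - 3 * (b - a) = x := by ring
      by_cases h1 : x = a
      · subst h1
        rw [if_pos rfl, if_pos rfl]
        simp only [List.map_cons, List.map_nil]
        rw [if_pos hab.le, if_neg (by omega), if_pos le_rfl, e1]
        simp
      rw [if_neg h1, if_neg (by omega)]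
      by_cases h3 : b < x
      · rw [shift_of_lt (by omega), shift_of_lt h3, List.map_singleton, if_neg (by omega),
            if_neg (by omega), if_neg (by omega), e3]
      · rw [shift_of_le (by omega), shift_of_le (by omega), List.map_singleton, if_pos (by omega)]

/-- The landing place of the moved terminal point may be shifted to the right, as long as no
terminal point is passed. -/
theorem equivalent_spread_succ (D : VCD n) {a b : ℤ} (hab : a < b) (hb : ∀ k, D.terminal k ≠ b + 1) :
    Equivalent (D.spread a b hab) (D.spread a (b + 1) (by omega)) := by
  have hab' : a < b + 1 := by omega
  -- `E` is obtained by deleting the first two of the three points on an arc from `b + 1`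
  obtain ⟨E, hE, hEc⟩ : ∃ E, Equivalent (D.spread a (b + 1) hab') E ∧ ∀ k, E.curve k =
      ((D.spread a (b + 1) hab').curve k).filter (fun z => decide (z ≠ b + 1 ∧ z ≠ 2 * b + 2 - a)) := by
    have hpt : ∀ z, (D.spread a (b + 1) hab').IsPoint z → ¬ (b + 1 < z ∧ z < 2 * b + 2 - a) := by
      intro z hz
      obtain ⟨u, hu, h⟩ := isPoint_spread hz
      omega
    by_cases hp : D.IsPoint (b + 1)
    swap
    · refine ⟨_, Equivalent.refl _, fun k => ?_⟩
      symm
      rw [List.filter_eq_self]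
      intro z hz
      obtain ⟨u, hu, h⟩ := isPoint_spread ⟨k, hz⟩
      have : u ≠ b + 1 := fun h => hp (h ▸ hu)
      rw [decide_eq_true_eq]
      omega
    obtain ⟨v, k, hv⟩ := exists_joined hp hb
    have hout : outward a (b + 1) (b + 1) = [b + 1, 2 * b + 2 - a, 4 * b + 4 - 3 * a] := by
      rw [outward_of_mem hab' le_rfl]
      simp only [List.cons.injEq]
      exact ⟨trivial, by ring, by ring, trivial⟩
    have hk : ∃ x y l r, (D.spread a (b + 1) hab').curve k = l ++ x :: y :: r ∧ r ≠ [] ∧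
        (x = b + 1 ∧ y = 2 * b + 2 - a ∨ x = 2 * b + 2 - a ∧ y = b + 1) := by
      rcases hv with hv | hv <;> obtain ⟨l, r, hl, hle⟩ := mem_overArcs_iff.1 hv <;>
        rw [spread_curve, hl, spreadCurve_append hle, spreadCurve, hout]
      · refine ⟨b + 1, 2 * b + 2 - a, spreadCurve a (b + 1) l, (4 * b + 4 - 3 * a) ::
          ((outward a (b + 1) v).reverse ++ spreadCurve a (b + 1) r), by simp, by simp, Or.inl ⟨rfl, rfl⟩⟩
      · have hr : r ≠ [] := by
          rintro rfl
          refine hb k (terminal_eq_of_curve_eq (l := l ++ [v]) ?_)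
          rw [hl]; simp
        refine ⟨2 * b + 2 - a, b + 1, spreadCurve a (b + 1) l ++ outward a (b + 1) v ++
          [4 * b + 4 - 3 * a], spreadCurve a (b + 1) r, by simp, spreadCurve_ne_nil hr,
          Or.inr ⟨rfl, rfl⟩⟩
    obtain ⟨x, y, l, r, hc, hr, hxy⟩ := hk
    have hadj : (D.spread a (b + 1) hab').Adjacent x y := by
      intro z hz
      have := hpt z hz
      unfold Encloses
      dsimp only
      omega
    obtain ⟨E, hE⟩ := exists_stepAt hc hadj
    refine ⟨E, hE.equivalent, fun j => ?_⟩
    rw [hE.curve_eq_filter_of_ne_nil hr]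
    apply List.filter_congr
    intro z _
    rw [decide_eq_decide]
    omega
  refine Equivalent.trans ?_ hE.symm
  refine Relabel.equivalent ⟨fun z => if z ≤ b then z else z + 3, ?_, fun k => ?_⟩
  · intro x y _ _ h
    dsimp only
    split_ifs <;> omega
  · rw [hEc, spread_curve, spread_curve]
    conv_lhs => rw [← List.map_id (D.curve k)]
    refine filter_spreadCurve_map ?_ ?_
    · intro x hx
      rw [id]
      rcases lt_trichotomy x a with h1 | rfl | h1
      · rw [outward_of_lt hab' h1, outward_of_lt hab h1, List.filter_cons_of_pos (by simp; omega)]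
        simp only [List.filter_nil, List.map_singleton]
        rw [if_pos (by omega)]
      · rw [outward_self, outward_self, List.filter_cons_of_pos (by simp; omega)]
        simp only [List.filter_nil, List.map_singleton, List.cons.injEq, and_true]
        rw [if_neg (by omega)]
        omega
      rcases lt_trichotomy x (b + 1) with h2 | rfl | h2
      · rw [outward_of_mem h1 (by omega), outward_of_mem h1 (by omega),
          List.filter_cons_of_pos (by simp; omega), List.filter_cons_of_pos (by simp; omega),
          List.filter_cons_of_pos (by simp; omega)]
        simp only [List.filter_nil, List.map_cons, List.map_nil, List.cons.injEq, and_true]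
        rw [if_pos (by omega), if_neg (by omega), if_neg (by omega)]
        omega
      · rw [outward_of_mem h1 le_rfl, outward_of_gt hab (by omega),
          List.filter_cons_of_neg (by simp), List.filter_cons_of_neg (by simp; omega),
          List.filter_cons_of_pos (by simp; omega)]
        simp only [List.filter_nil, List.map_singleton, List.cons.injEq, and_true]
        rw [if_neg (by omega)]
        omega
      · rw [outward_of_gt hab' h2, outward_of_gt hab (by omega),
          List.filter_cons_of_pos (by simp; omega)]
        simp only [List.filter_nil, List.map_singleton, List.cons.injEq, and_true]
        rw [if_neg (by omega)]
        omega
    · intro x hx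
      have hx' : x ≠ b + 1 := by
        rintro rfl
        apply hb k
        rw [List.getLast?_eq_some_getLast (D.curve_ne_nil k)] at hx
        simpa [terminal] using hx
      rw [id]
      by_cases h1 : x = a
      · rw [if_pos h1, if_pos h1, List.filter_cons_of_pos (by simp; omega),
          List.filter_cons_of_pos (by simp; omega)]
        simp only [List.filter_nil, List.map_cons, List.map_nil, List.cons.injEq, and_true]
        rw [if_pos (by omega), if_neg (by omega)]
        omega
      rw [if_neg h1, if_neg h1]
      by_cases h4 : b < x
      · rw [shift_of_lt (by omega), shift_of_lt h4, List.filter_cons_of_pos (by simp; omega)]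
        simp only [List.filter_nil, List.map_singleton, List.cons.injEq, and_true]
        rw [if_neg (by omega)]
        omega
      · rw [shift_of_le (by omega), shift_of_le (by omega),
          List.filter_cons_of_pos (by simp; omega)]
        simp only [List.filter_nil, List.map_singleton]
        rw [if_pos (by omega)]

/-- The landing place may be moved to the right as long as no terminal point is passed. -/
theorem equivalent_push_of_le (D : VCD n) {a b c : ℤ} (hab : a < b) (hbc : b ≤ c)
    (ha : ∃ k, D.terminal k = a) (hT : ∀ k, ¬ (b < D.terminal k ∧ D.terminal k ≤ c)) :
    Equivalent (D.push a b hab ha) (D.push a c (by omega) ha) := by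
  refine ((equivalent_spread_push D hab ha).symm.trans ?_).trans (equivalent_spread_push D _ ha)
  obtain ⟨m, rfl⟩ := Int.le.dest hbc
  induction m with
  | zero => simp [Equivalent.refl]
  | succ m ih =>
    have h1 := ih (by omega) (fun k => by have := hT k; push_cast at this; omega)
    have h2 := D.equivalent_spread_succ (a := a) (b := b + m) (by omega)
      (fun k => by have := hT k; push_cast at this; omega)
    exact h1.trans (by simpa [add_assoc] using h2)

/-! ### The braid generators act on equivalence classes -/

theorem t_succ_not_between (D : VCD n) (i : ℕ) (hi : i + 1 < n) (k : Fin n) :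
    ¬ (D.t ⟨i, by omega⟩ < D.terminal k ∧ D.terminal k < D.t ⟨i + 1, hi⟩) := by
  obtain ⟨j, hj⟩ := D.terminal_eq_t k
  rw [hj, D.t.lt_iff_lt, D.t.lt_iff_lt, Fin.lt_def, Fin.lt_def]
  simp only
  omega

theorem t_lt_t_succ (D : VCD n) (i : ℕ) (hi : i + 1 < n) : D.t ⟨i, by omega⟩ < D.t ⟨i + 1, hi⟩ :=
  D.t.lt_iff_lt.2 (by simp)

theorem equivalent_spread_sigma (D : VCD n) (i : ℕ) (hi : i + 1 < n) :
    Equivalent (D.spread _ _ (D.t_lt_t_succ i hi)) (D.sigma i hi) :=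
  equivalent_spread_push _ _ _

theorem Step.sigma {D E : VCD n} (h : Step D E) (i : ℕ) (hi : i + 1 < n) :
    Equivalent (D.sigma i hi) (E.sigma i hi) := by
  have ht : ∀ j, E.t j = D.t j := by
    obtain ⟨k, x, y, l, r, h⟩ := h
    exact t_congr h.terminal
  refine (equivalent_spread_sigma D i hi).symm.trans (Equivalent.trans ?_ (equivalent_spread_sigma E i hi))
  have := h.spread (hab := D.t_lt_t_succ i hi) (D.exists_terminal_eq _) (D.exists_terminal_eq _)
    (D.t_succ_not_between i hi)
  convert this using 2
  · rw [ht]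
  · rw [ht]

theorem Relabel.sigma {D E : VCD n} (h : Relabel D E) (i : ℕ) (hi : i + 1 < n) :
    Equivalent (D.sigma i hi) (E.sigma i hi) := by
  refine (equivalent_spread_sigma D i hi).symm.trans (Equivalent.trans ?_ (equivalent_spread_sigma E i hi))
  obtain ⟨g, hg, hE⟩ := h
  have := (Relabel.spread (D.t_lt_t_succ i hi) hg hE (D.isPoint_t _) (D.isPoint_t _)).equivalent
  convert this using 2
  · rw [t_relabel hg hE]
  · rw [t_relabel hg hE]

theorem Equivalent.sigma {D E : VCD n} (h : Equivalent D E) (i : ℕ) (hi : i + 1 < n) :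
    Equivalent (D.sigma i hi) (E.sigma i hi) := by
  change Relation.EqvGen _ D E at h
  induction h with
  | rel D E h =>
    rcases h with h | h | h
    · exact h.sigma i hi
    · obtain ⟨F, h1, h2⟩ := h.exists_step_relabel
      exact (h1.sigma i hi).trans (h2.sigma i hi)
    · exact h.step.sigma i hi
  | refl D => exact Equivalent.refl _
  | symm _ _ _ ih => exact ih.symm
  | trans _ _ _ _ _ ih ih' => exact ih.trans ih'

end VCD

/-! ### Points, arcs and terminal points of a pushed diagram -/

theorem pushOver_self (a b x : ℤ) : pushOver a b x a = [shift a b x, b + 2 * (b - a)] :=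
  if_pos rfl

theorem pushOver_of_iff {a b x y : ℤ} (hy : y ≠ a) (h : (a < x ∧ x ≤ b) ↔ (a < y ∧ y ≤ b)) :
    pushOver a b x y = [shift a b x, shift a b y] := by
  unfold pushOver
  rw [if_neg hy, if_neg (by omega), if_neg (by omega)]

theorem pushOver_left {a b x y : ℤ} (hy : y ≠ a) (h : a < x ∧ x ≤ b) (h' : ¬ (a < y ∧ y ≤ b)) :
    pushOver a b x y =
      [x, b + 2 * (b - a) - (x - a), b + 2 * (b - a) + (x - a), shift a b y] := by
  unfold pushOver
  rw [if_neg hy, if_pos ⟨h, h'⟩]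

theorem pushOver_right {a b x y : ℤ} (h' : ¬ (a < x ∧ x ≤ b)) (h : a < y ∧ y ≤ b) :
    pushOver a b x y =
      [shift a b x, b + 2 * (b - a) + (y - a), b + 2 * (b - a) - (y - a), y] := by
  unfold pushOver
  rw [if_neg (by omega), if_neg (by tauto), if_pos ⟨h, h'⟩]

theorem pushOver_cases (a b x y : ℤ) :
    (y = a ∧ pushOver a b x y = [shift a b x, b + 2 * (b - a)]) ∨
    (y ≠ a ∧ ((a < x ∧ x ≤ b) ↔ (a < y ∧ y ≤ b)) ∧
      pushOver a b x y = [shift a b x, shift a b y]) ∨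
    (y ≠ a ∧ (a < x ∧ x ≤ b) ∧ ¬ (a < y ∧ y ≤ b) ∧ pushOver a b x y =
      [x, b + 2 * (b - a) - (x - a), b + 2 * (b - a) + (x - a), shift a b y]) ∨
    (y ≠ a ∧ ¬ (a < x ∧ x ≤ b) ∧ (a < y ∧ y ≤ b) ∧ pushOver a b x y =
      [shift a b x, b + 2 * (b - a) + (y - a), b + 2 * (b - a) - (y - a), y]) := by
  by_cases hy : y = a
  · subst hy; exact Or.inl ⟨rfl, pushOver_self _ _ _⟩
  right
  by_cases h1 : a < x ∧ x ≤ b <;> by_cases h2 : a < y ∧ y ≤ b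
  · exact Or.inl ⟨hy, by tauto, pushOver_of_iff hy (by tauto)⟩
  · exact Or.inr (Or.inl ⟨hy, h1, h2, pushOver_left hy h1 h2⟩)
  · exact Or.inr (Or.inr ⟨hy, h1, h2, pushOver_right h1 h2⟩)
  · exact Or.inl ⟨hy, by tauto, pushOver_of_iff hy (by tauto)⟩

theorem even_length_pushOver (a b x y : ℤ) : Even (pushOver a b x y).length := by
  rcases pushOver_cases a b x y with ⟨_, h⟩ | ⟨_, _, h⟩ | ⟨_, _, _, h⟩ | ⟨_, _, _, h⟩ <;> rw [h]
  · exact ⟨1, rfl⟩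
  · exact ⟨1, rfl⟩
  · exact ⟨2, rfl⟩
  · exact ⟨2, rfl⟩

theorem mem_pushCurve {a b z : ℤ} : ∀ {l : List ℤ}, z ∈ pushCurve a b l →
    (∃ e ∈ overArcs l, z ∈ pushOver a b e.1 e.2) ∨
    ∃ p x, l = p ++ [x] ∧ Even p.length ∧
      (x = a ∧ (z = a ∨ z = b + 2 * (b - a)) ∨ x ≠ a ∧ z = shift a b x)
  | [], h => by simp [pushCurve] at h
  | [x], h => by
      right
      refine ⟨[], x, rfl, by simp, ?_⟩
      unfold pushCurve at h
      split_ifs at h with hx <;> simp at h <;> simp [hx, h]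
  | x :: y :: l, h => by
      simp only [pushCurve, List.mem_append] at h
      rcases h with h | h
      · exact Or.inl ⟨(x, y), by simp [overArcs], h⟩
      · rcases mem_pushCurve h with ⟨e, he, h⟩ | ⟨p, w, rfl, hp, h⟩
        · exact Or.inl ⟨e, by simp [overArcs, he], h⟩
        · exact Or.inr ⟨x :: y :: p, w, by simp, by simpa [Nat.even_add_one] using hp, h⟩

theorem getLast_pushCurve {a b : ℤ} : ∀ {l : List ℤ} (hl : l ≠ []), l.Nodup →
    (∀ e ∈ overArcs l, e.1 ≠ a) →
    (pushCurve a b l).getLast (pushCurve_ne_nil hl) =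
      if l.getLast hl = a then b + 2 * (b - a) else shift a b (l.getLast hl)
  | [x], _, _, _ => by
      by_cases h : x = a <;> simp [pushCurve, h]
  | [x, y], _, _, _ => by
      simp only [pushCurve, List.append_nil, List.getLast_cons_cons, List.getLast_singleton]
      rcases pushOver_cases a b x y with ⟨h1, h⟩ | ⟨h1, _, h⟩ | ⟨h1, _, _, h⟩ | ⟨h1, _, h2, h⟩
      · subst h1; simp [h]
      · simp [h, h1]
      · simp [h, h1]
      · simp [h, h1, shift_of_le h2.2]
  | x :: y :: z :: l, _, hn, h => by
      have := getLast_pushCurve (a := a) (b := b) (l := z :: l) (by simp)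
        (by simp only [List.nodup_cons] at hn ⊢; tauto)
        (fun e he => h e (by rw [overArcs]; exact List.mem_cons_of_mem _ he))
      simp only [pushCurve]
      rw [List.getLast_append_of_ne_nil _ (pushCurve_ne_nil (by simp)), this]
      simp

namespace VCD

variable {n : ℕ}

theorem push_curve (D : VCD n) (a b : ℤ) (hab : a < b) (ha : ∃ k, D.terminal k = a) (k : Fin n) :
    (D.push a b hab ha).curve k = pushCurve a b (D.curve k) := rfl

theorem overArc_fst_ne {D : VCD n} {a : ℤ} (ha : ∃ k, D.terminal k = a) {k : Fin n}
    {e : ℤ × ℤ} (he : e ∈ overArcs (D.curve k)) : e.1 ≠ a := by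
  obtain ⟨j, rfl⟩ := ha
  exact D.overArc_fst_ne_terminal he

theorem terminal_push (D : VCD n) (a b : ℤ) (hab : a < b) (ha : ∃ k, D.terminal k = a) (k : Fin n) :
    (D.push a b hab ha).terminal k =
      if D.terminal k = a then b + 2 * (b - a) else shift a b (D.terminal k) :=
  getLast_pushCurve (D.curve_ne_nil k) (D.curve_nodup k) fun _ he => overArc_fst_ne ha he

theorem push_curve_of_overArc {D : VCD n} {a b : ℤ} (hab : a < b) (ha : ∃ k, D.terminal k = a)
    {k : Fin n} {x y : ℤ} (h : (x, y) ∈ overArcs (D.curve k)) : ∃ l r, Even l.length ∧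
    (D.push a b hab ha).curve k = l ++ pushOver a b x y ++ r := by
  obtain ⟨l, r, h, hl⟩ := mem_overArcs_iff.1 h
  refine ⟨pushCurve a b l, pushCurve a b r, ?_, ?_⟩
  · clear h
    induction l using overArcs.induct with
    | case1 x y l ih =>
      rw [pushCurve, List.length_append]
      exact (even_length_pushOver a b x y).add (ih (by simpa [Nat.even_add_one] using hl))
    | case2 l h =>
      match l, h with
      | [], _ => simp [pushCurve]
      | [x], _ => simp at hl
      | x :: y :: l, h => exact absurd rfl (h x y l)
  · rw [push_curve, h, pushCurve_append hl, pushCurve]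
    simp

/-- The two turning points on a pulled arc. -/
theorem push_curve_of_joined {D : VCD n} {a b : ℤ} (hab : a < b) (ha : ∃ k, D.terminal k = a)
    {u v : ℤ} (h : D.Joined u v) (hu : a < u ∧ u ≤ b) (hv : v < a ∨ b < v) : ∃ k l r,
    (D.push a b hab ha).curve k = l ++ (b + 2 * (b - a) - (u - a)) :: (b + 2 * (b - a) + (u - a)) :: r ∨
    (D.push a b hab ha).curve k =
      l ++ (b + 2 * (b - a) + (u - a)) :: (b + 2 * (b - a) - (u - a)) :: r := by
  obtain ⟨k, h | h⟩ := h <;> obtain ⟨l, r, _, hc⟩ := push_curve_of_overArc hab ha h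
  · rw [pushOver_left (by omega) hu (by omega)] at hc
    exact ⟨k, l ++ [u], shift a b v :: r, Or.inl (by rw [hc]; simp)⟩
  · rw [pushOver_right (by omega) hu] at hc
    exact ⟨k, l ++ [shift a b v], u :: r, Or.inr (by rw [hc]; simp)⟩

theorem isPoint_push {D : VCD n} {a b : ℤ} {hab : a < b} {ha : ∃ k, D.terminal k = a} {z : ℤ}
    (h : (D.push a b hab ha).IsPoint z) :
    (∃ u, D.IsPoint u ∧ u ≠ a ∧ z = shift a b u) ∨ z = b + 2 * (b - a) ∨
    (z = a ∧ ∃ k p, D.curve k = p ++ [a] ∧ Even p.length) ∨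
    ∃ u v, D.Joined u v ∧ (a < u ∧ u ≤ b) ∧ (v < a ∨ b < v) ∧
      (z = b + 2 * (b - a) - (u - a) ∨ z = b + 2 * (b - a) + (u - a)) := by
  obtain ⟨k, h⟩ := h
  rcases mem_pushCurve h with ⟨⟨x, y⟩, he, h⟩ | ⟨p, x, hc, hp, h⟩
  · have hx : D.IsPoint x := ⟨k, (mem_of_mem_overArcs he).1⟩
    have hy : D.IsPoint y := ⟨k, (mem_of_mem_overArcs he).2⟩
    have hxa : x ≠ a := overArc_fst_ne ha he
    have hj : D.Joined x y := ⟨k, Or.inl he⟩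
    dsimp only at h
    rcases pushOver_cases a b x y with ⟨h1, h2⟩ | ⟨h1, h0, h2⟩ | ⟨h1, h0, h3, h2⟩ | ⟨h1, h0, h3, h2⟩ <;>
      rw [h2] at h <;> simp only [List.mem_cons, List.not_mem_nil, or_false] at h
    · rcases h with h | h
      · exact Or.inl ⟨x, hx, hxa, h⟩
      · exact Or.inr (Or.inl h)
    · rcases h with h | h
      · exact Or.inl ⟨x, hx, hxa, h⟩
      · exact Or.inl ⟨y, hy, h1, h⟩
    · rcases h with h | h | h | h
      · exact Or.inl ⟨x, hx, hxa, by rw [shift_of_le h0.2, h]⟩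
      · exact Or.inr (Or.inr (Or.inr ⟨x, y, hj, h0, by omega, Or.inl h⟩))
      · exact Or.inr (Or.inr (Or.inr ⟨x, y, hj, h0, by omega, Or.inr h⟩))
      · exact Or.inl ⟨y, hy, h1, h⟩
    · rcases h with h | h | h | h
      · exact Or.inl ⟨x, hx, hxa, h⟩
      · exact Or.inr (Or.inr (Or.inr ⟨y, x, hj.symm, h3, by omega, Or.inr h⟩))
      · exact Or.inr (Or.inr (Or.inr ⟨y, x, hj.symm, h3, by omega, Or.inl h⟩))
      · exact Or.inl ⟨y, hy, h1, by rw [shift_of_le h3.2, h]⟩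
  · have hx : D.IsPoint x := ⟨k, by rw [hc]; simp⟩
    rcases h with ⟨rfl, h | h⟩ | ⟨h1, h⟩
    · exact Or.inr (Or.inr (Or.inl ⟨h, k, p, hc, hp⟩))
    · exact Or.inr (Or.inl h)
    · exact Or.inl ⟨x, hx, h1, h⟩

/-- The terminal points after the puncture `t i` has been pushed to the right of `t (i + 1)`. -/
theorem t_push (D : VCD n) {i : ℕ} (hi : i + 1 < n) {c : ℤ} (hc : D.t ⟨i + 1, hi⟩ ≤ c)
    (hT : ∀ k, ¬ (D.t ⟨i + 1, hi⟩ < D.terminal k ∧ D.terminal k ≤ c))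
    (hac : D.t ⟨i, by omega⟩ < c) (ha : ∃ k, D.terminal k = D.t ⟨i, by omega⟩) (j : Fin n) :
    (D.push (D.t ⟨i, by omega⟩) c hac ha).t j =
    if (j : ℕ) = i then D.t ⟨i + 1, hi⟩
    else if (j : ℕ) = i + 1 then c + 2 * (c - D.t ⟨i, by omega⟩)
    else shift (D.t ⟨i, by omega⟩) c (D.t j) := by
  have hab := D.t_lt_t_succ i hi
  have lo : ∀ j : Fin n, (j : ℕ) < i → D.t j < D.t ⟨i, by omega⟩ := fun j h => D.t.lt_iff_lt.2 h
  have up : ∀ j : Fin n, i + 1 < (j : ℕ) → c < D.t j := by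
    intro j h
    have : D.t ⟨i + 1, hi⟩ < D.t j := D.t.lt_iff_lt.2 h
    obtain ⟨k, hk⟩ := D.exists_terminal_eq j
    have := hT k
    omega
  refine t_eq (f := fun j : Fin n => if (j : ℕ) = i then D.t ⟨i + 1, hi⟩
    else if (j : ℕ) = i + 1 then c + 2 * (c - D.t ⟨i, by omega⟩)
    else shift (D.t ⟨i, by omega⟩) c (D.t j)) ?_ (fun j => ?_) j
  · intro j k hjk
    have h := D.t.strictMono hjk
    have hjk' : (j : ℕ) < k := hjk
    have := lo j
    have := up j
    have := lo k
    have := up k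
    unfold shift
    dsimp only
    split_ifs <;> omega
  · have key := terminal_push D _ _ hac ha
    split_ifs with h1 h2
    · obtain ⟨k, hk⟩ := D.exists_terminal_eq ⟨i + 1, hi⟩
      refine ⟨k, ?_⟩
      rw [key, hk, if_neg (by omega), shift_of_le hc]
    · obtain ⟨k, hk⟩ := D.exists_terminal_eq ⟨i, by omega⟩
      refine ⟨k, ?_⟩
      rw [key, hk, if_pos rfl]
    · obtain ⟨k, hk⟩ := D.exists_terminal_eq j
      refine ⟨k, ?_⟩
      have := lo j
      have := up j
      rw [key, hk, if_neg (by omega)]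

theorem t_sigma (D : VCD n) (i : ℕ) (hi : i + 1 < n) (j : Fin n) : (D.sigma i hi).t j =
    if (j : ℕ) = i then D.t ⟨i + 1, hi⟩
    else if (j : ℕ) = i + 1 then
      D.t ⟨i + 1, hi⟩ + 2 * (D.t ⟨i + 1, hi⟩ - D.t ⟨i, by omega⟩)
    else shift (D.t ⟨i, by omega⟩) (D.t ⟨i + 1, hi⟩) (D.t j) :=
  t_push D hi le_rfl (fun k => by omega) _ _ j

/-! ### Mirror images -/

theorem mirror_curve (D : VCD n) (k : Fin n) : D.mirror.curve k = (D.curve k).map (fun z => -z) := rfl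

theorem mirror_mirror (D : VCD n) : D.mirror.mirror = D := by
  apply VCD.ext
  ext1 k
  simp [mirror_curve]

theorem isPoint_mirror {D : VCD n} {z : ℤ} : D.mirror.IsPoint z ↔ D.IsPoint (-z) := by
  unfold IsPoint
  simp only [mirror_curve, List.mem_map]
  refine exists_congr fun k => ⟨?_, fun h => ⟨_, h, by simp⟩⟩
  rintro ⟨w, h, rfl⟩
  simpa using h

theorem Adjacent.mirror {D : VCD n} {x y : ℤ} (h : D.Adjacent x y) : D.mirror.Adjacent (-x) (-y) := by
  intro z hz hc
  refine h (-z) (isPoint_mirror.1 hz) ?_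
  unfold Encloses at *
  dsimp only at *
  omega

theorem Equivalent.mirror {D E : VCD n} (h : Equivalent D E) : Equivalent D.mirror E.mirror := by
  have upd : ∀ {D E : VCD n} {k : Fin n} {l : List ℤ}, E.curve = Function.update D.curve k l →
      E.mirror.curve = Function.update D.mirror.curve k (l.map (fun z => -z)) := by
    intro D E k l h
    ext1 j
    rw [mirror_curve, h]
    by_cases hj : j = k
    · subst hj; simp
    · rw [Function.update_of_ne hj, Function.update_of_ne hj, mirror_curve]
  change Relation.EqvGen _ D E at h
  induction h with
  | rel D E h =>
    apply Relation.EqvGen.rel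
    rcases h with ⟨g, hg, hE⟩ | ⟨k, l, x, y, h1, h2, h3⟩ | ⟨k, l, x, y, z, r, h1, h2, h3⟩
    · left
      refine ⟨fun z => -g (-z), fun x y hx hy h => ?_, fun k => ?_⟩
      · have := hg _ _ (isPoint_mirror.1 hy) (isPoint_mirror.1 hx) (by omega)
        dsimp only
        omega
      · simp [mirror_curve, hE]
    · right; left
      exact ⟨k, l.map (fun z => -z), -x, -y, by simp [mirror_curve, h1], h2.mirror, by simp [upd h3]⟩
    · right; right
      exact ⟨k, l.map (fun z => -z), -x, -y, -z, r.map (fun z => -z), by simp [mirror_curve, h1],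
        h2.mirror, by simp [upd h3]⟩
  | refl D => exact Equivalent.refl _
  | symm _ _ _ ih => exact ih.symm
  | trans _ _ _ _ _ ih ih' => exact ih.trans ih'

theorem Simplified.mirror {D : VCD n} (h : D.Simplified) : D.mirror.Simplified := by
  have size : ∀ E : VCD n, E.mirror.size = E.size := fun E => by simp [VCD.size, mirror_curve]
  intro E hE
  have := h E.mirror (by simpa [mirror_mirror] using hE.mirror)
  rwa [size] at this ⊢

theorem t_mirror (D : VCD n) (j : Fin n) : D.mirror.t j = -D.t j.rev := by
  refine t_eq (f := fun j => -D.t j.rev) (fun i j h => ?_) (fun j => ?_) j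
  · exact neg_lt_neg (D.t.strictMono (Fin.rev_lt_rev.2 h))
  · obtain ⟨k, hk⟩ := D.exists_terminal_eq j.rev
    exact ⟨k, by rw [terminal_mirror, hk]⟩

theorem HasTerminalOverArc.mirror {D : VCD n} {i j : Fin n} (h : D.HasTerminalOverArc i j) :
    D.mirror.HasTerminalOverArc i.rev j.rev := by
  obtain ⟨k, x, h1, h2, h3⟩ := h
  refine ⟨k, -x, ?_, ?_, ?_⟩
  · rw [terminal_mirror, mirror_curve, overArcs_map]
    exact List.mem_map_of_mem (f := fun e : ℤ × ℤ => (-e.1, -e.2)) h1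
  · rw [terminal_mirror, t_mirror, h2, Fin.rev_rev]
  · rw [terminal_mirror, t_mirror, Fin.rev_rev]
    unfold Encloses at *
    dsimp only at *
    omega

theorem sigmaInv_eq (D : VCD n) {i j : ℕ} (hi : i + 1 < n) (hj : j + 1 < n) (h : i + j + 2 = n) :
    D.sigmaInv i hi = (D.mirror.sigma j hj).mirror := by
  apply VCD.ext
  ext1 k
  rw [mirror_curve]
  unfold sigma sigmaInv
  rw [mirror_curve, push_curve, push_curve, t_mirror, t_mirror]
  have h1 : Fin.rev ⟨j, by omega⟩ = (⟨i + 1, hi⟩ : Fin n) := by ext; simp [Fin.val_rev]; omega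
  have h2 : Fin.rev ⟨j + 1, hj⟩ = (⟨i, by omega⟩ : Fin n) := by ext; simp [Fin.val_rev]; omega
  rw [h1, h2]

theorem Equivalent.sigmaInv {D E : VCD n} (h : Equivalent D E) (i : ℕ) (hi : i + 1 < n) :
    Equivalent (D.sigmaInv i hi) (E.sigmaInv i hi) := by
  rw [sigmaInv_eq D hi (j := n - 2 - i) (by omega) (by omega),
    sigmaInv_eq E hi (j := n - 2 - i) (by omega) (by omega)]
  exact (h.mirror.sigma _ _).mirror

end VCD

/-! ### The two actions are inverse to each other -/

/-- The effect on the labels of a pushed diagram of pushing the puncture back, in the mirror image,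
up to the place immediately to the right of its original position: no over arc is in the way. -/
theorem pushCurve_map_neg {a b : ℤ} (hab : a < b) : ∀ {l : List ℤ},
    (∀ e ∈ overArcs l, e.1 ≠ a) →
    (pushCurve (-(b + 2 * (b - a))) (-(a + 1)) ((pushCurve a b l).map (fun z => -z))).map
      (fun z => -z) = (pushCurve a b l).map (fun z => if z = b + 2 * (b - a) then
        a + 1 - 2 * (2 * (b - a) + b - a - 1) else if z ≤ a then
        z - 3 * (2 * (b - a) + b - a - 1) else z)
  | [], _ => by simp [pushCurve]
  | [x], _ => by
      by_cases h : x = a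
      · subst h
        simp only [pushCurve, if_pos, List.map_cons, List.map_nil]
        rw [pushOver_self, shift_of_lt (by omega)]
        simp only [List.map_cons, List.map_nil, List.append_nil, List.cons.injEq, and_true]
        rw [if_neg (by omega), if_pos le_rfl]
        constructor <;> ring
      · by_cases h' : b < x
        · simp only [pushCurve, if_neg h, shift_of_lt h', List.map_cons, List.map_nil]
          rw [if_neg (by omega), shift_of_le (by omega), if_neg (by omega), if_neg (by omega)]
          simp
        · simp only [pushCurve, if_neg h, shift_of_le (not_lt.1 h'), List.map_cons, List.map_nil]
          rw [if_neg (by omega), if_neg (by omega)]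
          by_cases h'' : x ≤ a
          · rw [shift_of_lt (by omega), if_pos h'']
            simp only [List.map_cons, List.map_nil, List.cons.injEq, and_true]
            ring
          · rw [shift_of_le (by omega), if_neg h'']
            simp
  | x :: y :: l, h => by
      have hx : x ≠ a := h (x, y) (by simp [overArcs])
      rw [pushCurve, List.map_append, List.map_append,
        pushCurve_append (by rw [List.length_map]; exact even_length_pushOver a b x y),
        List.map_append, pushCurve_map_neg hab fun e he => h e (by simp [overArcs, he])]
      congr 1
      -- both ends of each of the resulting over arcs are treated alike
      have two : ∀ u v, u ≠ b + 2 * (b - a) → v ≠ b + 2 * (b - a) →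
          ((a < u ∧ u < b + 2 * (b - a)) ↔ (a < v ∧ v < b + 2 * (b - a))) →
          (pushOver (-(b + 2 * (b - a))) (-(a + 1)) (-u) (-v)).map (fun z => -z) =
          [u, v].map (fun z => if z = b + 2 * (b - a) then
        a + 1 - 2 * (2 * (b - a) + b - a - 1) else if z ≤ a then
        z - 3 * (2 * (b - a) + b - a - 1) else z) := by
        intro u v hu hv huv
        have one : ∀ u, u ≠ b + 2 * (b - a) → -shift (-(b + 2 * (b - a))) (-(a + 1)) (-u) =
            if u = b + 2 * (b - a) then
        a + 1 - 2 * (2 * (b - a) + b - a - 1) else if u ≤ a then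
        u - 3 * (2 * (b - a) + b - a - 1) else u := by
          intro u hu
          rw [if_neg hu]
          by_cases h : u ≤ a
          · rw [if_pos h, shift_of_lt (by omega)]; ring
          · rw [if_neg h, shift_of_le (by omega)]; ring
        rw [pushOver_of_iff (by omega) (by omega)]
        simp only [List.map_cons, List.map_nil]
        rw [one u hu, one v hv]
      have sh : ∀ u, u ≠ a → shift a b u ≠ b + 2 * (b - a) ∧
          (¬ (a < u ∧ u ≤ b) → ¬ (a < shift a b u ∧ shift a b u < b + 2 * (b - a))) ∧
          ((a < u ∧ u ≤ b) → (a < shift a b u ∧ shift a b u < b + 2 * (b - a))) := by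
        intro u hu
        unfold shift
        split_ifs <;> omega
      have sx := sh x hx
      rcases pushOver_cases a b x y with ⟨h1, h⟩ | ⟨h1, h2, h⟩ | ⟨h1, h2, h3, h⟩ | ⟨h1, h2, h3, h⟩ <;>
        rw [h]
      · simp only [List.map_cons, List.map_nil, pushCurve, pushOver_self, List.append_nil]
        rw [if_neg sx.1, if_pos trivial]
        simp only [List.cons.injEq, and_true]
        constructor
        · unfold shift
          split_ifs <;> omega
        · ring
      · have sy := sh y h1
        have : (a < shift a b x ∧ shift a b x < b + 2 * (b - a)) ↔
            (a < shift a b y ∧ shift a b y < b + 2 * (b - a)) := by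
          by_cases hm : a < x ∧ x ≤ b
          · exact iff_of_true (sx.2.2 hm) (sy.2.2 (h2.1 hm))
          · exact iff_of_false (sx.2.1 hm) (sy.2.1 fun hc => hm (h2.2 hc))
        have := two _ _ sx.1 sy.1 this
        simp only [pushCurve, List.map_cons, List.map_nil, List.append_nil] at this ⊢
        exact this
      · have sy := sh y h1
        have t1 := two x (b + 2 * (b - a) - (x - a)) (by omega) (by omega) (by omega)
        have t2 := two (b + 2 * (b - a) + (x - a)) (shift a b y) (by omega) sy.1 (by
          have := sy.2.1 h3
          omega)
        simp only [List.map_cons, List.map_nil, pushCurve, List.append_nil, List.map_append] at t1 t2 ⊢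
        rw [t1, t2]
        simp only [List.cons_append, List.nil_append]
      · have t1 := two (shift a b x) (b + 2 * (b - a) + (y - a)) sx.1 (by omega) (by
          have := sx.2.1 h2
          omega)
        have t2 := two (b + 2 * (b - a) - (y - a)) y (by omega) (by omega) (by omega)
        simp only [List.map_cons, List.map_nil, pushCurve, List.append_nil, List.map_append] at t1 t2 ⊢
        rw [t1, t2]
        simp only [List.cons_append, List.nil_append]

/-- Deleting the turning points from a pushed curve. -/
theorem filter_map_pushCurve {a b : ℤ} (hab : a < b) {h : ℤ → ℤ} {P : ℤ → Bool}
    (hP : ∀ z, b < z → z ≤ b + 3 * (b - a) → z ≠ b + 2 * (b - a) → P (h z) = false)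
    (ht : P (h (b + 2 * (b - a))) = true) (hP' : ∀ z, z ≤ b ∨ b + 3 * (b - a) < z → P (h z) = true) :
    ∀ {l : List ℤ}, (∀ e ∈ overArcs l, e.1 ≠ a) →
    ((pushCurve a b l).map h).filter P =
      l.map (fun z => if z = a then h (b + 2 * (b - a)) else h (shift a b z)) ∨
    ∃ p, l = p ++ [a] ∧ ((pushCurve a b l).map h).filter P =
      p.map (fun z => if z = a then h (b + 2 * (b - a)) else h (shift a b z)) ++
        [h a, h (b + 2 * (b - a))]
  | [], _ => by simp [pushCurve]
  | [x], _ => by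
      by_cases hx : x = a
      · right
        exact ⟨[], by simp [hx], by simp [pushCurve, hx, ht, hP' a (by omega)]⟩
      · left
        have : P (h (shift a b x)) = true := hP' _ (by unfold shift; split_ifs <;> omega)
        simp [pushCurve, hx, this]
  | x :: y :: l, hl => by
      have hx : x ≠ a := hl (x, y) (by simp [overArcs])
      have sh : ∀ u, P (h (shift a b u)) = true := fun u =>
        hP' _ (by unfold shift; split_ifs <;> omega)
      have block : ((pushOver a b x y).map h).filter P =
          [x, y].map (fun z => if z = a then h (b + 2 * (b - a)) else h (shift a b z)) := by
        rcases pushOver_cases a b x y with ⟨h1, h⟩ | ⟨h1, h2, h⟩ | ⟨h1, h2, h3, h⟩ | ⟨h1, h2, h3, h⟩ <;>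
          rw [h]
        · simp [h1, hx, sh, ht]
        · simp [h1, hx, sh]
        · have e1 := hP (b + 2 * (b - a) - (x - a)) (by omega) (by omega) (by omega)
          have e2 := hP (b + 2 * (b - a) + (x - a)) (by omega) (by omega) (by omega)
          have := sh x
          rw [shift_of_le h2.2] at this
          simp [h1, hx, sh, e1, e2, shift_of_le h2.2, this]
        · have e1 := hP (b + 2 * (b - a) - (y - a)) (by omega) (by omega) (by omega)
          have e2 := hP (b + 2 * (b - a) + (y - a)) (by omega) (by omega) (by omega)
          have := sh y
          rw [shift_of_le h3.2] at this
          simp [h1, hx, sh, e1, e2, shift_of_le h3.2, this]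
      rw [pushCurve, List.map_append, List.filter_append, block]
      rcases filter_map_pushCurve (l := l) hab hP ht hP' (fun e he => hl e (by simp [overArcs, he])) with
        h1 | ⟨p, rfl, h1⟩
      · left; rw [h1]; simp
      · right
        exact ⟨x :: y :: p, by simp, by rw [h1]; simp⟩

namespace VCD

variable {n : ℕ}

open Classical in
/-- Pushing the puncture back to the place immediately to the right of its original position
restores the diagram, up to equivalence: the pairs of turning points are nested around this
place. -/
theorem equivalent_push_back (D : VCD n) {a b : ℤ} (hab : a < b) (ha : ∃ k, D.terminal k = a)
    (hlt : -(b + 2 * (b - a)) < -(a + 1))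
    (ha' : ∃ k, (D.push a b hab ha).mirror.terminal k = -(b + 2 * (b - a))) :
    Equivalent ((D.push a b hab ha).mirror.push _ _ hlt ha').mirror D := by
  set Z := ((D.push a b hab ha).mirror.push _ _ hlt ha').mirror with hZ
  obtain ⟨h, hh⟩ : ∃ h : ℤ → ℤ, h = fun z => if z = b + 2 * (b - a) then
        a + 1 - 2 * (2 * (b - a) + b - a - 1) else if z ≤ a then
        z - 3 * (2 * (b - a) + b - a - 1) else z := ⟨_, rfl⟩
  have ht : h (b + 2 * (b - a)) = a + 1 - 2 * (2 * (b - a) + b - a - 1) := by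
    rw [hh]; exact if_pos rfl
  have hlo : ∀ z, z ≤ a → h z = z - 3 * (2 * (b - a) + b - a - 1) := by
    intro z hz
    simp only [hh]
    rw [if_neg (by omega), if_pos hz]
  have hup : ∀ z, a < z → z ≠ b + 2 * (b - a) → h z = z := by
    intro z hz hz'
    simp only [hh]
    rw [if_neg hz', if_neg (by omega)]
  have hfst : ∀ k, ∀ e ∈ overArcs (D.curve k), e.1 ≠ a := fun k e he => overArc_fst_ne ha he
  have hZc : ∀ k, Z.curve k = ((D.push a b hab ha).curve k).map h := by
    intro k
    rw [hZ, mirror_curve, push_curve, mirror_curve, push_curve, pushCurve_map_neg hab (hfst k), hh]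
  have hZp : ∀ z, Z.IsPoint z → ∃ w, (D.push a b hab ha).IsPoint w ∧ z = h w := by
    rintro z ⟨k, hz⟩
    rw [hZc, List.mem_map] at hz
    obtain ⟨w, hw, rfl⟩ := hz
    exact ⟨w, ⟨k, hw⟩, rfl⟩
  have hZt : ∀ k, Z.terminal k = h ((D.push a b hab ha).terminal k) := Relabel.terminal hZc
  clear_value Z
  set S : Finset ℤ := (Finset.Ioc b (b + 3 * (b - a))).filter Z.IsPoint with hS
  have hmem : ∀ z, z ∈ S ↔ (b < z ∧ z ≤ b + 3 * (b - a)) ∧ Z.IsPoint z := fun z => by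
    rw [hS, Finset.mem_filter, Finset.mem_Ioc]
  have hhS : ∀ z, (b < h z ∧ h z ≤ b + 3 * (b - a)) ↔
      (b < z ∧ z ≤ b + 3 * (b - a) ∧ z ≠ b + 2 * (b - a)) := by
    intro z
    by_cases h1 : z ≤ a
    · rw [hlo z h1]; omega
    · by_cases h2 : z = b + 2 * (b - a)
      · rw [h2, ht]; omega
      · rw [hup z (by omega) h2]; omega
  -- the points of `S` are the turning points
  have key : ∀ z ∈ S, ∃ u, (a < u ∧ u ≤ b) ∧
      (z = b + 2 * (b - a) - (u - a) ∨ z = b + 2 * (b - a) + (u - a)) ∧ ∃ k l r,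
      Z.curve k = l ++ (b + 2 * (b - a) - (u - a)) :: (b + 2 * (b - a) + (u - a)) :: r ∨
      Z.curve k = l ++ (b + 2 * (b - a) + (u - a)) :: (b + 2 * (b - a) - (u - a)) :: r := by
    intro z hz
    obtain ⟨hz1, hz2⟩ := (hmem z).1 hz
    obtain ⟨w, hw, rfl⟩ := hZp z hz2
    rw [hhS] at hz1
    rw [hup w (by omega) hz1.2.2]
    rcases isPoint_push hw with ⟨u, _, _, h1⟩ | h1 | ⟨h1, _⟩ | ⟨u, v, huv, h1, h2, h3⟩
    · unfold shift at h1
      split_ifs at h1 <;> omega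
    · omega
    · omega
    · refine ⟨u, h1, h3, ?_⟩
      obtain ⟨k, l, r, hc⟩ := push_curve_of_joined hab ha huv h1 h2
      refine ⟨k, l.map h, r.map h, ?_⟩
      rw [hZc]
      rcases hc with hc | hc <;> rw [hc, List.map_append, List.map_cons, List.map_cons,
        hup _ (by omega) (by omega), hup _ (by omega) (by omega)]
      · exact Or.inl rfl
      · exact Or.inr rfl
  obtain ⟨R, hR, hRc⟩ := exists_delete_nested (fun z => 2 * (b + 2 * (b - a)) - z) (S := S) (D := Z)
    (by
      intro z hz k hk
      have := ((hmem z).1 hz).1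
      rw [← hk, hZt, hhS, terminal_push] at this
      unfold shift at this
      split_ifs at this <;> omega)
    (by
      intro z hz
      obtain ⟨u, hu, hzu, k, l, r, hc⟩ := key z hz
      refine ⟨k, l, r, ?_⟩
      rcases hzu with rfl | rfl
      · rw [show 2 * (b + 2 * (b - a)) - (b + 2 * (b - a) - (u - a)) =
          b + 2 * (b - a) + (u - a) by ring]
        exact hc
      · rw [show 2 * (b + 2 * (b - a)) - (b + 2 * (b - a) + (u - a)) =
          b + 2 * (b - a) - (u - a) by ring]
        exact hc.symm)
    (by
      intro z hz
      refine ⟨?_, by ring⟩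
      obtain ⟨u, hu, hzu, k, l, r, hc⟩ := key z hz
      rw [hmem]
      refine ⟨by omega, k, ?_⟩
      have : 2 * (b + 2 * (b - a)) - z = b + 2 * (b - a) - (u - a) ∨
        2 * (b + 2 * (b - a)) - z = b + 2 * (b - a) + (u - a) := by omega
      rcases this with h | h <;> rw [h] <;> rcases hc with hc | hc <;> rw [hc] <;> simp)
    (by
      intro z hz w hw hzw
      have hz1 := ((hmem z).1 hz).1
      obtain ⟨u, hu, hzu, -⟩ := key z hz
      unfold Encloses at hzw ⊢
      dsimp only at hzw ⊢
      refine ⟨(hmem w).2 ⟨by omega, hw⟩, by omega⟩)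
  refine hR.trans ?_
  -- the relabelling
  set G : ℤ → ℤ := fun z => if z = a then h (b + 2 * (b - a)) else h (shift a b z) with hG
  have hGmono : ∀ x y, x < y → G x < G y := by
    have val : ∀ x, (x < a ∧ G x = x - 3 * (2 * (b - a) + b - a - 1)) ∨
        (x = a ∧ G x = a + 1 - 2 * (2 * (b - a) + b - a - 1)) ∨
        (a < x ∧ x ≤ b ∧ G x = x) ∨ (b < x ∧ G x = x + 3 * (b - a)) := by
      intro x
      rcases lt_trichotomy x a with h1 | h1 | h1
      · left
        refine ⟨h1, ?_⟩
        rw [hG]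
        dsimp only
        rw [if_neg (by omega), shift_of_le (by omega), hlo x h1.le]
      · right; left
        exact ⟨h1, by rw [hG]; dsimp only; rw [if_pos h1, ht]⟩
      · right; right
        by_cases h2 : x ≤ b
        · left
          refine ⟨h1, h2, ?_⟩
          rw [hG]
          dsimp only
          rw [if_neg (by omega), shift_of_le h2, hup x h1 (by omega)]
        · right
          refine ⟨by omega, ?_⟩
          rw [hG]
          dsimp only
          rw [if_neg (by omega), shift_of_lt (by omega), hup _ (by omega) (by omega)]
    intro x y hxy
    have := val x
    have := val y
    omega
  have hsplit : ∀ k, R.curve k = (D.curve k).map G ∨ ∃ p, D.curve k = p ++ [a] ∧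
      R.curve k = p.map G ++ [h a, h (b + 2 * (b - a))] := by
    intro k
    have : ∀ z ∈ Z.curve k, decide (z ∉ S) = decide (¬ (b < z ∧ z ≤ b + 3 * (b - a))) := by
      intro z hz
      rw [decide_eq_decide, hmem]
      have : Z.IsPoint z := ⟨k, hz⟩
      tauto
    rw [hRc, List.filter_congr this, hZc, push_curve]
    refine filter_map_pushCurve hab ?_ ?_ ?_ (hfst k)
    · intro z h1 h2 h3
      rw [decide_eq_false_iff_not, hhS, not_not]
      exact ⟨h1, h2, h3⟩
    · rw [decide_eq_true_eq, ht]
      omega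
    · intro z hz
      rw [decide_eq_true_eq, hhS]
      omega
  suffices ∃ X : VCD n, Equivalent R X ∧ ∀ k, X.curve k = (D.curve k).map G by
    obtain ⟨X, hX, hXc⟩ := this
    exact hX.trans (Relabel.equivalent ⟨G, fun x y _ _ => hGmono x y, hXc⟩).symm
  by_cases hk : ∃ k p, D.curve k = p ++ [a] ∧ R.curve k = p.map G ++ [h a, h (b + 2 * (b - a))]
  swap
  · push Not at hk
    refine ⟨R, Equivalent.refl R, fun k => (hsplit k).resolve_right ?_⟩
    rintro ⟨p, h1, h2⟩
    exact hk k p h1 h2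
  -- the original position of the puncture is retracted
  obtain ⟨k, p, hc, hRk⟩ := hk
  have hadj : R.Adjacent (h a) (h (b + 2 * (b - a))) := by
    rintro z ⟨j, hz⟩ hc
    rw [hRc, List.mem_filter] at hz
    obtain ⟨w, hw, rfl⟩ := hZp z ⟨j, hz.1⟩
    unfold Encloses at hc
    dsimp only at hc
    rw [ht, hlo a le_rfl] at hc
    by_cases h1 : w ≤ a
    · rw [hlo w h1] at hc; omega
    · by_cases h2 : w = b + 2 * (b - a)
      · rw [h2, ht] at hc; omega
      · rw [hup w (by omega) h2] at hc; omega
  obtain ⟨X, hX⟩ := exists_stepAt (l := p.map G) (r := []) hRk hadj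
  refine ⟨X, hX.equivalent, fun j => ?_⟩
  by_cases hj : j = k
  · subst hj
    rw [hX.curve_self, contract_nil, hc, List.map_append]
    simp [hG]
  · rw [hX.curve_of_ne hj]
    refine (hsplit j).resolve_right ?_
    rintro ⟨q, h1, -⟩
    exact hj (D.eq_of_mem (x := a) (by rw [h1]; simp) (by rw [hc]; simp))

theorem sigmaInv_sigma (D : VCD n) (i : ℕ) (hi : i + 1 < n) :
    Equivalent ((D.sigma i hi).sigmaInv i hi) D := by
  have hab := D.t_lt_t_succ i hi
  have hT := D.t_succ_not_between i hi
  have ha : ∃ k, D.terminal k = D.t ⟨i, by omega⟩ := D.exists_terminal_eq _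
  have hta := D.t_sigma i hi ⟨i, by omega⟩
  have htb := D.t_sigma i hi ⟨i + 1, hi⟩
  rw [if_pos rfl] at hta
  rw [if_neg (by simp), if_pos rfl] at htb
  have hta' : ∃ k, (D.sigma i hi).mirror.terminal k =
      -(D.t ⟨i + 1, hi⟩ + 2 * (D.t ⟨i + 1, hi⟩ - D.t ⟨i, by omega⟩)) := by
    obtain ⟨k, hk⟩ := (D.sigma i hi).exists_terminal_eq ⟨i + 1, hi⟩
    exact ⟨k, by rw [terminal_mirror, hk, htb]⟩
  have h1 : (D.sigma i hi).sigmaInv i hi = ((D.sigma i hi).mirror.push _ (-D.t ⟨i + 1, hi⟩)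
      (by omega) hta').mirror := by
    apply VCD.ext
    ext1 k
    unfold sigmaInv
    rw [mirror_curve, mirror_curve, push_curve, push_curve, hta, htb]
  rw [h1]
  refine Equivalent.trans (Equivalent.mirror
    (equivalent_push_of_le _ (c := -(D.t ⟨i, by omega⟩ + 1)) _ (by omega) hta' fun k => ?_))
    (D.equivalent_push_back hab ha (by omega) hta')
  rw [terminal_mirror]
  unfold sigma
  rw [terminal_push]
  have := hT k
  unfold shift
  split_ifs <;> omega

theorem sigma_sigmaInv (D : VCD n) (i : ℕ) (hi : i + 1 < n) :
    Equivalent ((D.sigmaInv i hi).sigma i hi) D := by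
  have h := (D.mirror.sigmaInv_sigma (n - 2 - i) (by omega)).mirror
  rwa [mirror_mirror, sigmaInv_eq _ (j := i) _ hi (by omega), mirror_mirror,
    ← sigmaInv_eq D hi _ (by omega)] at h

end VCD

/-! ### Arcs of irreducible diagrams and of pushed diagrams -/

theorem exists_pushCurve_eq_cons {a b z : ℤ} (hab : a < b) : ∀ l : List ℤ, ∃ r,
    pushCurve a b (z :: l) = shift a b z :: r
  | [] => by
      by_cases hz : z = a
      · subst hz
        exact ⟨[b + 2 * (b - z)], by simp [pushCurve, shift_of_le hab.le]⟩
      · exact ⟨[], by simp [pushCurve, hz]⟩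
  | y :: l => by
      rw [pushCurve]
      rcases pushOver_cases a b z y with ⟨_, h⟩ | ⟨_, _, h⟩ | ⟨_, h2, _, h⟩ | ⟨_, _, _, h⟩ <;> rw [h]
      · exact ⟨_, rfl⟩
      · exact ⟨_, rfl⟩
      · rw [shift_of_le h2.2]
        exact ⟨_, rfl⟩
      · exact ⟨_, rfl⟩

theorem underArcs_pushCurve {a b : ℤ} (hab : a < b) {e : ℤ × ℤ} : ∀ {l : List ℤ},
    (∀ p r, l = p ++ a :: r → r = []) → e ∈ underArcs (pushCurve a b l) →
    (∃ f ∈ underArcs l, e = (shift a b f.1, shift a b f.2)) ∨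
    ∃ u, (a < u ∧ u ≤ b) ∧
      (e = (b + 2 * (b - a) - (u - a), b + 2 * (b - a) + (u - a)) ∨
       e = (b + 2 * (b - a) + (u - a), b + 2 * (b - a) - (u - a)))
  | [], _, h => by simp [pushCurve, underArcs, overArcs] at h
  | [x], _, h => by
      by_cases hx : x = a <;> simp [pushCurve, underArcs, overArcs, hx] at h
  | [x, y], _, h => by
      rcases pushOver_cases a b x y with ⟨_, h1⟩ | ⟨_, _, h1⟩ | ⟨_, h2, _, h1⟩ | ⟨_, _, h2, h1⟩ <;>
        simp only [pushCurve, h1, underArcs, overArcs, List.append_nil, List.tail_cons,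
          List.not_mem_nil, List.mem_singleton] at h
      · exact Or.inr ⟨x, h2, Or.inl h⟩
      · exact Or.inr ⟨y, h2, Or.inr h⟩
  | x :: y :: z :: l, hl, h => by
      have hy : y ≠ a := by
        rintro rfl
        simpa using hl [x] (z :: l) rfl
      obtain ⟨r, hr⟩ := exists_pushCurve_eq_cons (z := z) hab l
      have hrec : e ∈ overArcs r → e ∈ underArcs (pushCurve a b (z :: l)) := fun h => by
        rw [hr]; exact h
      have h' : (e = (shift a b y, shift a b z) ∨ e ∈ overArcs r) ∨
          ∃ u, (a < u ∧ u ≤ b) ∧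
          (e = (b + 2 * (b - a) - (u - a), b + 2 * (b - a) + (u - a)) ∨
           e = (b + 2 * (b - a) + (u - a), b + 2 * (b - a) - (u - a))) := by
        rcases pushOver_cases a b x y with ⟨h0, h1⟩ | ⟨_, _, h1⟩ | ⟨_, h2, _, h1⟩ | ⟨_, _, h2, h1⟩
        · exact absurd h0 hy
        all_goals
          rw [pushCurve, hr, h1] at h
          simp only [underArcs, overArcs, List.cons_append, List.nil_append, List.tail_cons,
            List.mem_cons] at h
        · exact Or.inl h
        · rcases h with h | h
          · exact Or.inr ⟨x, h2, Or.inl h⟩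
          · exact Or.inl h
        · rcases h with h | h
          · exact Or.inr ⟨y, h2, Or.inr h⟩
          · rw [shift_of_le h2.2]; exact Or.inl h
      rcases h' with (rfl | h') | h'
      · exact Or.inl ⟨(y, z), by simp [underArcs, overArcs], rfl⟩
      · rcases underArcs_pushCurve hab (l := z :: l) (fun p r' hp => hl (x :: y :: p) r' (by simp [hp]))
          (hrec h') with ⟨f, hf, h⟩ | h
        · exact Or.inl ⟨f, by simpa [underArcs, overArcs] using Or.inr hf, h⟩
        · exact Or.inr h
      · exact Or.inr h'

namespace VCD

variable {n : ℕ} {D E : VCD n}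

/-- Every over arc encloses a terminal point. -/
def Separated (D : VCD n) : Prop := ∀ u v, D.Joined u v → ∃ k, Encloses (u, v) (D.terminal k)

theorem encloses_comm {u v z : ℤ} : Encloses (u, v) z ↔ Encloses (v, u) z := by
  unfold Encloses; tauto

theorem Irreducible.not_adjacent (h : D.Irreducible) {k : Fin n} {x y : ℤ} {l r : List ℤ}
    (hc : D.curve k = l ++ x :: y :: r) : ∃ z, D.IsPoint z ∧ Encloses (x, y) z := by
  by_contra hz
  push Not at hz
  obtain ⟨E, hE⟩ := exists_stepAt hc hz
  exact h E hE.step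

/-- An innermost over arc that encloses no terminal point would have adjacent ends. -/
theorem Irreducible.separated (h : D.Irreducible) : D.Separated := by
  have key : ∀ (m : ℕ) u v, D.Joined u v → u < v → v - u ≤ m →
      ∃ k, Encloses (u, v) (D.terminal k) := by
    intro m
    induction m with
    | zero => intro u v _ h1 h2; simp at h2; omega
    | succ m ih =>
      intro u v huv hlt hm
      by_contra hk
      push Not at hk
      obtain ⟨z, hz, hzuv⟩ : ∃ z, D.IsPoint z ∧ Encloses (u, v) z := by
        obtain ⟨k, hc | hc⟩ := huv <;> obtain ⟨p, s, hc, _⟩ := mem_overArcs_iff.1 hc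
        · exact h.not_adjacent hc
        · obtain ⟨z, hz, hz'⟩ := h.not_adjacent hc
          exact ⟨z, hz, encloses_comm.1 hz'⟩
      obtain ⟨w, hzw⟩ := exists_joined hz fun k hc => hk k (hc ▸ hzuv)
      have hw := huv.encloses hzw hzuv
      have hne := hzw.ne
      push_cast at hm
      unfold Encloses at hzuv hw hk
      dsimp only at hzuv hw hk
      rcases lt_or_gt_of_ne hne with c | c
      · obtain ⟨k, hk'⟩ := ih z w hzw c (by omega)
        unfold Encloses at hk'
        dsimp only at hk'
        have := hk k
        omega
      · obtain ⟨k, hk'⟩ := ih w z hzw.symm c (by omega)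
        unfold Encloses at hk'
        dsimp only at hk'
        have := hk k
        omega
  intro u v huv
  rcases lt_or_gt_of_ne huv.ne with c | c
  · exact key (v - u).toNat u v huv c (by omega)
  · obtain ⟨k, hk⟩ := key (u - v).toNat v u huv.symm c (by omega)
    exact ⟨k, encloses_comm.1 hk⟩

/-- If every over arc encloses a terminal point, then only under arcs can be contracted. -/
theorem Separated.odd_of_stepAt (h : D.Separated) {k : Fin n} {x y : ℤ} {l r : List ℤ}
    (hs : StepAt D E k x y l r) : Odd l.length := by
  by_contra hl
  obtain ⟨hc, ha, _⟩ := hs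
  obtain ⟨j, hj⟩ := h x y ⟨k, Or.inl (mem_overArcs_iff.2 ⟨l, r, hc, Nat.not_odd_iff_even.1 hl⟩)⟩
  exact ha _ (D.isPoint_terminal j) hj

theorem Separated.irreducible (h : D.Separated)
    (hu : ∀ k, ∀ e ∈ underArcs (D.curve k), ∃ z, D.IsPoint z ∧ Encloses e z) : D.Irreducible := by
  rintro E ⟨k, x, y, l, r, hs⟩
  obtain ⟨z, hz, hz'⟩ := hu k (x, y) (mem_underArcs_iff.2 ⟨l, r, hs.1, h.odd_of_stepAt hs⟩)
  exact hs.2.1 z hz hz'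

/-- A terminal point at the end of an over arc is not an end of an under arc. -/
theorem Joined.underArc_ne {a u : ℤ} (h : D.Joined u a) (ha : ∃ k, D.terminal k = a) {k : Fin n}
    {e : ℤ × ℤ} (he : e ∈ underArcs (D.curve k)) : e.1 ≠ a ∧ e.2 ≠ a := by
  obtain ⟨x, y⟩ := e
  obtain ⟨p, s, hc, hp⟩ := mem_underArcs_iff.1 he
  obtain ⟨j, rfl⟩ := ha
  refine ⟨fun hx => ne_terminal_of_curve_eq hc (by simp) j hx.symm, ?_⟩
  rintro rfl
  obtain ⟨i, hi | hi⟩ := h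
  · obtain ⟨q, r, hq, hqe⟩ := mem_overArcs_iff.1 hi
    obtain rfl : i = k := D.eq_of_mem (x := D.terminal j) (by rw [hq]; simp) (by rw [hc]; simp)
    have hn := D.curve_nodup i
    have := append_cons_inj (z := D.terminal j) (l := p ++ [x]) (r := s) (l' := q ++ [u]) (r' := r)
      (by simpa [hc] using hn) (by rw [hc] at hq; simpa using hq)
    have := congrArg List.length this.1
    simp only [List.length_append, List.length_singleton] at this
    rw [Nat.even_iff] at hqe
    rw [Nat.odd_iff] at hp
    omega
  · exact D.overArc_fst_ne_terminal hi rfl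

/-- The over arcs of a pushed diagram. -/
theorem joined_push {a b : ℤ} {hab : a < b} {ha : ∃ k, D.terminal k = a} {z w : ℤ}
    (h : (D.push a b hab ha).Joined z w) : ∃ z' w', (z' = z ∧ w' = w ∨ z' = w ∧ w' = z) ∧
    ((∃ x, D.Joined x a ∧ z' = shift a b x ∧ w' = b + 2 * (b - a)) ∨
    (∃ x y, D.Joined x y ∧ x ≠ a ∧ y ≠ a ∧ ((a < x ∧ x ≤ b) ↔ (a < y ∧ y ≤ b)) ∧
      z' = shift a b x ∧ w' = shift a b y) ∨
    (∃ u v, D.Joined u v ∧ (a < u ∧ u ≤ b) ∧ (v < a ∨ b < v) ∧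
      (z' = u ∧ w' = b + 2 * (b - a) - (u - a) ∨
        z' = b + 2 * (b - a) + (u - a) ∧ w' = shift a b v)) ∨
    ((¬ ∃ x, D.Joined x a) ∧ z' = a ∧ w' = b + 2 * (b - a))) := by
  have main : ∀ {j : Fin n} {e : ℤ × ℤ}, e ∈ overArcs ((D.push a b hab ha).curve j) →
      ∃ z' w', (z' = e.1 ∧ w' = e.2 ∨ z' = e.2 ∧ w' = e.1) ∧
    ((∃ x, D.Joined x a ∧ z' = shift a b x ∧ w' = b + 2 * (b - a)) ∨
    (∃ x y, D.Joined x y ∧ x ≠ a ∧ y ≠ a ∧ ((a < x ∧ x ≤ b) ↔ (a < y ∧ y ≤ b)) ∧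
      z' = shift a b x ∧ w' = shift a b y) ∨
    (∃ u v, D.Joined u v ∧ (a < u ∧ u ≤ b) ∧ (v < a ∨ b < v) ∧
      (z' = u ∧ w' = b + 2 * (b - a) - (u - a) ∨
        z' = b + 2 * (b - a) + (u - a) ∧ w' = shift a b v)) ∨
    ((¬ ∃ x, D.Joined x a) ∧ z' = a ∧ w' = b + 2 * (b - a))) := by
    intro j e he
    rcases overArcs_pushCurve he with ⟨⟨x, y⟩, hf, h⟩ | rfl
    · have hxa : x ≠ a := overArc_fst_ne ha hf
      have hj : D.Joined x y := ⟨j, Or.inl hf⟩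
      dsimp only at h
      rcases pushOver_cases a b x y with ⟨h1, h2⟩ | ⟨h1, h0, h2⟩ | ⟨h1, h0, h3, h2⟩ |
        ⟨h1, h0, h3, h2⟩ <;> rw [h2] at h <;>
        simp only [overArcs, List.mem_cons, List.not_mem_nil, or_false] at h
      · subst h h1
        exact ⟨_, _, Or.inl ⟨rfl, rfl⟩, Or.inl ⟨x, hj, rfl, rfl⟩⟩
      · subst h
        exact ⟨_, _, Or.inl ⟨rfl, rfl⟩, Or.inr (Or.inl ⟨x, y, hj, hxa, h1, h0, rfl, rfl⟩)⟩
      · rcases h with rfl | rfl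
        · exact ⟨_, _, Or.inl ⟨rfl, rfl⟩,
            Or.inr (Or.inr (Or.inl ⟨x, y, hj, h0, by omega, Or.inl ⟨rfl, rfl⟩⟩))⟩
        · exact ⟨_, _, Or.inl ⟨rfl, rfl⟩,
            Or.inr (Or.inr (Or.inl ⟨x, y, hj, h0, by omega, Or.inr ⟨rfl, rfl⟩⟩))⟩
      · rcases h with rfl | rfl
        · exact ⟨_, _, Or.inr ⟨rfl, rfl⟩,
            Or.inr (Or.inr (Or.inl ⟨y, x, hj.symm, h3, by omega, Or.inr ⟨rfl, rfl⟩⟩))⟩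
        · exact ⟨_, _, Or.inr ⟨rfl, rfl⟩,
            Or.inr (Or.inr (Or.inl ⟨y, x, hj.symm, h3, by omega, Or.inl ⟨rfl, rfl⟩⟩))⟩
    · refine ⟨_, _, Or.inl ⟨rfl, rfl⟩, Or.inr (Or.inr (Or.inr ⟨?_, rfl, rfl⟩))⟩
      have hp : (D.push a b hab ha).IsPoint a := ⟨j, (mem_of_mem_overArcs he).1⟩
      rcases isPoint_push hp with ⟨u, _, h1, h2⟩ | h | ⟨_, k, p, hc, hp⟩ | ⟨u, v, _, h1, _, h2⟩
      · unfold shift at h2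
        split_ifs at h2 <;> omega
      · omega
      · rintro ⟨x, i, hx | hx⟩
        · exact (overArcs_ne_of_curve_eq hc hp hx).2 rfl
        · exact (overArcs_ne_of_curve_eq hc hp hx).1 rfl
      · omega
  obtain ⟨j, h | h⟩ := h <;> obtain ⟨z', w', h1, h2⟩ := main h
  · exact ⟨z', w', h1, h2⟩
  · exact ⟨z', w', h1.symm, h2⟩

/-- The under arcs of a pushed diagram. -/
theorem underArcs_push {a b : ℤ} {hab : a < b} {ha : ∃ k, D.terminal k = a} {k : Fin n}
    {e : ℤ × ℤ} (he : e ∈ underArcs ((D.push a b hab ha).curve k)) :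
    (∃ f ∈ underArcs (D.curve k), e = (shift a b f.1, shift a b f.2)) ∨
    ∃ u, (a < u ∧ u ≤ b) ∧
      (e = (b + 2 * (b - a) - (u - a), b + 2 * (b - a) + (u - a)) ∨
       e = (b + 2 * (b - a) + (u - a), b + 2 * (b - a) - (u - a))) := by
  refine underArcs_pushCurve hab (fun p r hc => ?_) he
  by_contra hr
  obtain ⟨j, hj⟩ := ha
  exact ne_terminal_of_curve_eq hc hr j hj

/-- Over arcs away from a contracted under arc are not affected. -/
theorem StepAt.mem_overArcs {k : Fin n} {x y : ℤ} {l r : List ℤ} (h : StepAt D E k x y l r)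
    (hl : Odd l.length) {j : Fin n} {e : ℤ × ℤ} (he : e ∈ overArcs (D.curve j))
    (h1 : e.1 ≠ x ∧ e.1 ≠ y) (h2 : e.2 ≠ x ∧ e.2 ≠ y) : e ∈ overArcs (E.curve j) := by
  by_cases hj : j = k
  · subst hj
    rw [h.curve_self]
    rw [h.1] at he
    obtain ⟨l, s, rfl⟩ : ∃ l' s, l = l' ++ [s] := by
      rcases List.eq_nil_or_concat l with rfl | ⟨l', s, rfl⟩
      · simp at hl
      · exact ⟨l', s, by simp⟩
    have hl' : Even l.length := by simpa [Nat.odd_add_one] using hl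
    simp only [List.append_assoc, List.cons_append, List.nil_append] at he
    rw [overArcs_append hl'] at he
    obtain ⟨e1, e2⟩ := e
    dsimp only at h1 h2
    cases r with
    | nil =>
      rw [contract_nil, List.append_assoc, overArcs_append hl']
      simp [overArcs] at he ⊢
      tauto
    | cons z r =>
      rw [contract_cons, List.append_assoc, overArcs_append hl']
      simp [overArcs] at he ⊢
      tauto
  · rwa [h.curve_of_ne hj]

end VCD

namespace VCD

variable {n : ℕ} {D : VCD n} {a b c : ℤ}

/-! ### A push without superfluous over arcs -/

theorem isPoint_push_shift {hab : a < b} {ha : ∃ k, D.terminal k = a} {z : ℤ} (hz : D.IsPoint z)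
    (hza : z ≠ a) : (D.push a b hab ha).IsPoint (shift a b z) := by
  obtain ⟨k, hz⟩ := hz
  refine ⟨k, ?_⟩
  rcases exists_overArc_or_eq_getLast hz with ⟨⟨x, y⟩, he, h⟩ | ⟨p, hp, hpe⟩
  · obtain ⟨l, r, _, hc⟩ := push_curve_of_overArc hab ha he
    rw [hc]
    dsimp only at h
    rcases pushOver_cases a b x y with ⟨h1, h2⟩ | ⟨h1, h0, h2⟩ | ⟨h1, h0, h3, h2⟩ | ⟨h1, h0, h3, h2⟩ <;>
      rw [h2] <;> rcases h with rfl | rfl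
    · simp
    · exact absurd h1 hza
    · simp
    · simp
    · simp [shift_of_le h0.2]
    · simp
    · simp
    · simp [shift_of_le h3.2]
  · rw [push_curve, hp, pushCurve_append hpe]
    simp [pushCurve, hza]

/-- The puncture is the end of an over arc of the pushed diagram, which starts at `a` unless `a` was
already the end of an over arc. -/
theorem exists_overArc_push (hab : a < b) (ha : ∃ k, D.terminal k = a) :
    ∃ k w, (w, b + 2 * (b - a)) ∈ overArcs ((D.push a b hab ha).curve k) ∧
      ((w = a ∧ ¬ ∃ x, D.Joined x a) ∨ ∃ x, D.Joined x a ∧ w = shift a b x) := by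
  obtain ⟨k, hk⟩ := ha
  have ha : ∃ k, D.terminal k = a := ⟨k, hk⟩
  refine ⟨k, ?_⟩
  have hmem : a ∈ D.curve k := hk ▸ D.terminal_mem k
  rcases exists_overArc_or_eq_getLast hmem with ⟨⟨x, y⟩, he, h⟩ | ⟨p, hp, hpe⟩
  · have hy : y = a := (h.resolve_left (overArc_fst_ne ha he).symm).symm
    subst hy
    obtain ⟨l, r, hl, hc⟩ := push_curve_of_overArc hab ha he
    rw [pushOver_self] at hc
    refine ⟨shift y b x, mem_overArcs_iff.2 ⟨l, r, by rw [hc]; simp, hl⟩, Or.inr ⟨x, ⟨k, Or.inl he⟩, rfl⟩⟩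
  · refine ⟨a, ?_, Or.inl ⟨rfl, ?_⟩⟩
    · rw [push_curve, hp, pushCurve_append hpe]
      have : Even (pushCurve a b p).length := by
        clear hp hmem
        induction p using overArcs.induct with
        | case1 x y l ih =>
          rw [pushCurve, List.length_append]
          exact (even_length_pushOver a b x y).add (ih (by simpa [Nat.even_add_one] using hpe))
        | case2 l h =>
          match l, h with
          | [], _ => simp [pushCurve]
          | [x], _ => simp at hpe
          | x :: y :: l, h => exact absurd rfl (h x y l)
      rw [overArcs_append this]
      simp [pushCurve, overArcs]
    · rintro ⟨x, i, hx | hx⟩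
      · exact (overArcs_ne_of_curve_eq hp hpe hx).2 rfl
      · exact (overArcs_ne_of_curve_eq hp hpe hx).1 rfl

theorem Joined.between {u v z w : ℤ} (h : D.Joined u v) (h' : D.Joined z w) (h1 : u < z)
    (h2 : z < v) : u < w ∧ w < v := by
  have := h.encloses h' (Or.inl ⟨h1, h2⟩)
  unfold Encloses at this
  dsimp only at this
  omega

theorem Separated.exists_terminal (h : D.Separated) {u v : ℤ} (huv : D.Joined u v) (hlt : u < v) :
    ∃ k, u < D.terminal k ∧ D.terminal k < v := by
  obtain ⟨k, hk⟩ := h u v huv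
  unfold Encloses at hk
  dsimp only at hk
  exact ⟨k, by omega⟩

theorem exists_le_of_isPoint (D : VCD n) : ∃ M, ∀ z, D.IsPoint z → z ≤ M := by
  have : {z | D.IsPoint z}.Finite := by
    have : {z | D.IsPoint z} = ⋃ k, {z | z ∈ D.curve k} := by ext; simp [IsPoint]
    rw [this]
    exact Set.finite_iUnion fun k => List.finite_toSet _
  obtain ⟨M, hM⟩ := this.bddAbove
  exact ⟨M, fun z hz => hM hz⟩

/-- An over arc from `u` in `(a, b)` to `v` on the right of `b` that encloses no terminal point
besides `b`. The push from `a` to the right of `b` would create the over arc from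
`b + 2 * (b - a) + (u - a)` to the new position of `v`, which encloses no terminal point. -/
def Tight (D : VCD n) (a b u v : ℤ) : Prop :=
  D.Joined u v ∧ a < u ∧ u < b ∧ b < v ∧
    ∀ k, u < D.terminal k → D.terminal k < v → D.terminal k = b

/-- The best landing place of the puncture `a` on the right of `b`: it lies to the right of all
tight over arcs, except for those ending at the next terminal point. -/
structure Landing (D : VCD n) (a b c : ℤ) : Prop where
  le : b ≤ c
  eq_or_tight : c = b ∨ ∃ u, D.Tight a b u c ∧ ∀ k, D.terminal k ≠ c
  max : ∀ u v, D.Tight a b u v → (∀ k, D.terminal k ≠ v) → v ≤ c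

theorem exists_landing (D : VCD n) (a b : ℤ) : ∃ c, D.Landing a b c := by
  obtain ⟨M, hM⟩ := D.exists_le_of_isPoint
  obtain ⟨c, h1, h2⟩ := Int.exists_greatest_of_bdd
    (P := fun c => c = b ∨ ∃ u, D.Tight a b u c ∧ ∀ k, D.terminal k ≠ c)
    ⟨max b M, by
      rintro z (rfl | ⟨u, h, _⟩)
      · exact le_max_left _ _
      · exact le_max_of_le_right (hM z h.1.symm.isPoint)⟩ ⟨b, Or.inl rfl⟩
  exact ⟨c, h2 b (Or.inl rfl), h1, fun u v h h' => h2 v (Or.inr ⟨u, h, h'⟩)⟩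

/-- The other end of an over arc that starts under a tight arc, at a nonterminal point on the
right of `b`. -/
theorem Tight.joined_lt (hs : D.Separated) {u v z w : ℤ} (h : D.Tight a b u v) (hz : D.Joined z w) (h1 : b < z)
    (h2 : z < v) : D.Tight a b w z := by
  obtain ⟨huv, hu, hub, hbv, hT⟩ := h
  have hw := huv.between hz (by omega) h2
  have hwz : w < b := by
    rcases lt_or_gt_of_ne hz.ne with c | c
    · obtain ⟨k, hk1, hk2⟩ := hs.exists_terminal hz c
      have := hT k (by omega) (by omega)
      omega
    · obtain ⟨k, hk1, hk2⟩ := hs.exists_terminal hz.symm c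
      have := hT k (by omega) (by omega)
      omega
  exact ⟨hz.symm, by omega, hwz, h1, fun k h3 h4 => hT k (by omega) (by omega)⟩

theorem Tight.not_joined (hs : D.Separated) {u v w : ℤ} (h : D.Tight a b u v) : ¬ D.Joined b w := by
  intro hw
  obtain ⟨huv, hu, hub, hbv, hT⟩ := h
  have hw' := huv.between hw hub hbv
  rcases lt_or_gt_of_ne hw.ne with c | c
  · obtain ⟨k, hk1, hk2⟩ := hs.exists_terminal hw c
    have := hT k (by omega) (by omega)
    omega
  · obtain ⟨k, hk1, hk2⟩ := hs.exists_terminal hw.symm c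
    have := hT k (by omega) (by omega)
    omega

theorem Landing.not_terminal (h : D.Landing a b c) (k : Fin n) :
    ¬ (b < D.terminal k ∧ D.terminal k ≤ c) := by
  rintro ⟨h1, h2⟩
  rcases h.eq_or_tight with rfl | ⟨u, ⟨huc, hu, hub, hbc, hT⟩, hc⟩
  · omega
  · have := hc k
    have := hT k (by omega) (by omega)
    omega

/-- The points between `b` and the landing place are ends of tight over arcs. -/
theorem Landing.joined_lt (hs : D.Separated) (h : D.Landing a b c) {z w : ℤ} (hz : D.Joined z w) (h1 : b < z)
    (h2 : z ≤ c) : a < w ∧ w < b := by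
  rcases h.eq_or_tight with rfl | ⟨u, ht, hc⟩
  · omega
  · rcases h2.lt_or_eq with h2 | rfl
    · have := ht.joined_lt hs hz h1 h2
      exact ⟨this.2.1, this.2.2.1⟩
    · obtain rfl := hz.unique ht.1.symm
      exact ⟨ht.2.1, ht.2.2.1⟩

theorem Landing.eq_of_joined (hs : D.Separated) (h : D.Landing a b c) {w : ℤ} (hw : D.Joined b w) : c = b := by
  rcases h.eq_or_tight with rfl | ⟨u, ht, hc⟩
  · rfl
  · exact absurd hw (ht.not_joined hs)

end VCD

namespace VCD

variable {n : ℕ} {D : VCD n} {a b c : ℤ}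

/-- After a push to a landing place, there are at most two kinds of over arcs that do not enclose a
terminal point: the one between a turning point and `b`, if `b` is the end of an over arc of `D`,
and the one between a turning point and the end of a tight over arc of `D` at a terminal point. -/
theorem Landing.separated_push_or (hc : D.Landing a b c) (hs : D.Separated) (hab : a < b)
    (ha : ∃ k, D.terminal k = a) (hb : ∃ k, D.terminal k = b)
    (hT : ∀ k, ¬ (a < D.terminal k ∧ D.terminal k < b)) (hx : ∀ x, D.Joined x a → x < a)
    {hac : a < c} {z w : ℤ} (h : (D.push a c hac ha).Joined z w) :
    (∃ k, Encloses (z, w) ((D.push a c hac ha).terminal k)) ∨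
    ((∃ x, D.Joined b x) ∧ c = b ∧
      (z = c + 2 * (c - a) - (b - a) ∨ w = c + 2 * (c - a) - (b - a))) ∨
    ∃ u v, D.Tight a b u v ∧ (∃ k, D.terminal k = v) ∧
      (z = c + 2 * (c - a) + (u - a) ∨ w = c + 2 * (c - a) + (u - a)) := by
  obtain ⟨z', w', hzw, h⟩ := joined_push h
  suffices (∃ k, Encloses (z', w') ((D.push a c hac ha).terminal k)) ∨
    ((∃ x, D.Joined b x) ∧ c = b ∧
      (z' = c + 2 * (c - a) - (b - a) ∨ w' = c + 2 * (c - a) - (b - a))) ∨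
    ∃ u v, D.Tight a b u v ∧ (∃ k, D.terminal k = v) ∧
      (z' = c + 2 * (c - a) + (u - a) ∨ w' = c + 2 * (c - a) + (u - a)) by
    rcases hzw with ⟨rfl, rfl⟩ | ⟨rfl, rfl⟩
    · exact this
    · rcases this with ⟨k, hk⟩ | ⟨h1, h2, h3⟩ | ⟨u, v, h1, h2, h3⟩
      · exact Or.inl ⟨k, encloses_comm.1 hk⟩
      · exact Or.inr (Or.inl ⟨h1, h2, h3.symm⟩)
      · exact Or.inr (Or.inr ⟨u, v, h1, h2, h3.symm⟩)
  clear hzw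
  have hbc := hc.le
  have hTc := hc.not_terminal
  have term := terminal_push D a c hac ha
  have moved : ∃ k, (D.push a c hac ha).terminal k = c + 2 * (c - a) := by
    obtain ⟨k, hk⟩ := ha
    exact ⟨k, by rw [term, if_pos hk]⟩
  have other : ∀ k, D.terminal k ≠ a → (D.push a c hac ha).terminal k = shift a c (D.terminal k) :=
    fun k hk => by rw [term, if_neg hk]
  have atb : ∃ k, (D.push a c hac ha).terminal k = b := by
    obtain ⟨k, hk⟩ := hb
    exact ⟨k, by rw [other k (by omega), hk, shift_of_le hbc]⟩
  have mono : ∀ x y, x < y → shift a c x < shift a c y := fun x y h => by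
    unfold shift; split_ifs <;> omega
  rcases h with ⟨x, hxa, rfl, rfl⟩ | ⟨x, y, hxy, hx1, hy1, hm, rfl, rfl⟩ | ⟨u, v, huv, hu, hv, h⟩ |
    ⟨_, rfl, rfl⟩
  · -- the terminal over arc at the puncture
    left
    have := hx x hxa
    obtain ⟨k, hk1, hk2⟩ := hs.exists_terminal hxa this
    refine ⟨k, ?_⟩
    rw [other k (by omega), shift_of_le (by omega), shift_of_le (by omega)]
    unfold Encloses
    dsimp only
    omega
  · -- over arcs that are not pulled along
    left
    have aux : ∀ x y, D.Joined x y → x < y → x ≠ a → y ≠ a →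
        ((a < x ∧ x ≤ c) ↔ (a < y ∧ y ≤ c)) →
        ∃ k, Encloses (shift a c x, shift a c y) ((D.push a c hac ha).terminal k) := by
      intro x y hxy hlt hxa hya hm
      obtain ⟨k, hk1, hk2⟩ := hs.exists_terminal hxy hlt
      by_cases hk : D.terminal k = a
      · obtain ⟨j, hj⟩ := moved
        refine ⟨j, ?_⟩
        rw [hj, shift_of_le (by omega), shift_of_lt (by omega)]
        unfold Encloses
        dsimp only
        omega
      · exact ⟨k, Or.inl (by rw [other k hk]; exact ⟨mono _ _ hk1, mono _ _ hk2⟩)⟩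
    rcases lt_or_gt_of_ne hxy.ne with hlt | hlt
    · exact aux x y hxy hlt hx1 hy1 hm
    · obtain ⟨k, hk⟩ := aux y x hxy.symm hlt hy1 hx1 hm.symm
      exact ⟨k, encloses_comm.1 hk⟩
  · rcases h with ⟨rfl, rfl⟩ | ⟨rfl, rfl⟩
    · -- the inner part of a pulled arc
      rcases lt_trichotomy z' b with h1 | rfl | h1
      · left
        obtain ⟨k, hk⟩ := atb
        refine ⟨k, ?_⟩
        rw [hk]
        unfold Encloses
        dsimp only
        omega
      · exact Or.inr (Or.inl ⟨⟨v, huv⟩, hc.eq_of_joined hs huv, Or.inr rfl⟩)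
      · have := hc.joined_lt hs huv h1 hu.2
        omega
    · -- the outer part of a pulled arc
      rcases hv with hv | hv
      · left
        obtain ⟨k, hk⟩ := moved
        refine ⟨k, ?_⟩
        rw [hk, shift_of_le (by omega)]
        unfold Encloses
        dsimp only
        omega
      · by_cases hk : ∃ k, u < D.terminal k ∧ D.terminal k < v ∧ D.terminal k ≠ b
        · left
          obtain ⟨k, hk1, hk2, hk3⟩ := hk
          have := hT k
          have := hTc k
          refine ⟨k, Or.inl ?_⟩
          rw [other k (by omega), shift_of_lt hv, shift_of_lt (x := D.terminal k) (by omega)]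
          dsimp only
          omega
        · push Not at hk
          obtain ⟨k, hk1, hk2⟩ := hs.exists_terminal huv (by omega)
          have hkb := hk k hk1 hk2
          have ht : D.Tight a b u v := ⟨huv, hu.1, by omega, by omega, hk⟩
          by_cases hv' : ∃ k, D.terminal k = v
          · exact Or.inr (Or.inr ⟨u, v, ht, hv', Or.inl rfl⟩)
          · push Not at hv'
            have := hc.max u v ht hv'
            omega
  · left
    obtain ⟨k, hk⟩ := atb
    refine ⟨k, ?_⟩
    rw [hk]
    unfold Encloses
    dsimp only
    omega

/-- `G` is equivalent to the push `F`, from the puncture `a` to the landing place `c`, and has no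
superfluous over arcs. -/
structure Tidy (D : VCD n) (a c : ℤ) (F G : VCD n) : Prop where
  equivalent : Equivalent F G
  terminal : ∀ k, G.terminal k = F.terminal k
  separated : G.Separated
  underArcs : ∀ k, ∀ e ∈ underArcs (G.curve k),
    (∃ j, ∃ f ∈ underArcs (D.curve j), e = (shift a c f.1, shift a c f.2)) ∨
      Encloses e (c + 2 * (c - a))
  isPoint : ∀ z, F.IsPoint (shift a c z) → G.IsPoint (shift a c z)
  overArcs : ∀ k, ∀ e ∈ overArcs (G.curve k), e ∈ overArcs (F.curve k)
  overArcs_moved : ∀ k w, (w, c + 2 * (c - a)) ∈ VirtualBraid.overArcs (F.curve k) →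
    (w, c + 2 * (c - a)) ∈ VirtualBraid.overArcs (G.curve k)

theorem encloses_of_underArcs_push {hac : a < c} {ha : ∃ k, D.terminal k = a} (k : Fin n)
    (e : ℤ × ℤ) (he : e ∈ underArcs ((D.push a c hac ha).curve k)) :
    (∃ j, ∃ f ∈ underArcs (D.curve j), e = (shift a c f.1, shift a c f.2)) ∨
      Encloses e (c + 2 * (c - a)) := by
  rcases underArcs_push he with ⟨f, hf, h⟩ | ⟨u, hu, rfl | rfl⟩
  · exact Or.inl ⟨k, f, hf, h⟩
  · right; unfold Encloses; dsimp only; omega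
  · right; unfold Encloses; dsimp only; omega

/-- Contraction of a single superfluous over arc, which is terminal, after a push. -/
theorem exists_tidy_of_terminal {hac : a < c} {ha : ∃ k, D.terminal k = a} {k : Fin n} {y w d : ℤ}
    {l : List ℤ} (hk : (D.push a c hac ha).curve k = l ++ [y, w, d]) (hl : Odd l.length)
    (hadj : (D.push a c hac ha).Adjacent w d) (hw : ∀ z, w ≠ shift a c z)
    (hdt : d ≠ c + 2 * (c - a)) (hy : Encloses (y, d) (c + 2 * (c - a)))
    (hsep : ∀ u v, (D.push a c hac ha).Joined u v → u ≠ w → v ≠ w →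
      ∃ k, Encloses (u, v) ((D.push a c hac ha).terminal k)) :
    ∃ G, D.Tidy a c (D.push a c hac ha) G := by
  set F := D.push a c hac ha with hF
  have hunder := encloses_of_underArcs_push (D := D) (hac := hac) (ha := ha)
  rw [← hF] at hunder
  obtain ⟨G, hG⟩ := exists_stepAt (D := F) (k := k) (x := w) (y := d) (l := l ++ [y]) (r := [])
    (by rw [hk]; simp) hadj
  have hl' : Even (l ++ [y]).length := by simpa using hl.add_one
  have hGk : G.curve k = l ++ [y, d] := by rw [hG.curve_self, contract_nil]; simp
  have hwG : ¬ G.IsPoint w := by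
    rintro ⟨j, hj⟩
    by_cases hjk : j = k
    · subst hjk
      have hn := F.curve_nodup j
      rw [hk] at hn
      rw [hGk] at hj
      simp [List.nodup_append] at hn hj
      grind
    · rw [hG.curve_of_ne hjk] at hj
      exact hjk (F.eq_of_mem hj (by rw [hk]; simp))
  have hover : ∀ j, ∀ e ∈ overArcs (G.curve j), e ∈ overArcs (F.curve j) := by
    intro j e he
    by_cases hjk : j = k
    · subst hjk
      rw [hG.curve_self] at he
      rw [hG.1]
      refine (overArcs_contract (x := w) he).resolve_right ?_
      rintro ⟨h, -⟩
      exact Nat.not_even_iff_odd.2 h hl'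
    · rwa [hG.curve_of_ne hjk] at he
  refine ⟨G, hG.equivalent, hG.terminal, ?_, ?_, ?_, hover, ?_⟩
  · intro u v huv
    have huv' : F.Joined u v := by
      obtain ⟨j, h⟩ := huv
      exact ⟨j, h.imp (hover _ _) (hover _ _)⟩
    obtain ⟨j, hj⟩ := hsep u v huv' (fun h => hwG (h ▸ huv.isPoint))
      (fun h => hwG (h ▸ huv.symm.isPoint))
    exact ⟨j, by rwa [hG.terminal]⟩
  · intro j e he
    by_cases hjk : j = k
    · subst hjk
      rw [hGk] at he
      cases l with
      | nil => simp at hl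
      | cons h l =>
        have hl2 : Even l.length := by simpa [Nat.odd_add_one] using hl
        unfold underArcs at he
        rw [List.cons_append, List.tail_cons, overArcs_append hl2, List.mem_append] at he
        rcases he with he | he
        · refine hunder j e ?_
          unfold underArcs
          rw [hk, List.cons_append, List.tail_cons, overArcs_append hl2]
          exact List.mem_append_left _ he
        · simp only [VirtualBraid.overArcs, List.mem_singleton] at he
          exact Or.inr (he ▸ hy)
    · rw [hG.curve_of_ne hjk] at he
      exact hunder j e he
  · rintro z ⟨j, hj⟩
    by_cases hjk : j = k
    · subst hjk
      refine ⟨j, ?_⟩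
      rw [hGk]
      rw [hk] at hj
      have := hw z
      simp only [List.mem_append, List.mem_cons] at hj ⊢
      grind
    · exact ⟨j, by rwa [hG.curve_of_ne hjk]⟩
  · intro j x he
    by_cases hjk : j = k
    · subst hjk
      rw [hG.curve_self, contract_nil]
      rw [hG.1, overArcs_append hl', List.mem_append] at he
      rw [overArcs_append hl', List.mem_append]
      refine Or.inl (he.resolve_right ?_)
      simp only [VirtualBraid.overArcs, List.mem_singleton, Prod.mk.injEq, not_and]
      intro _
      exact hdt.symm
    · rwa [hG.curve_of_ne hjk]

/-- After at most one contraction, all over arcs of a push to a tight landing place enclose terminal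
points. -/
theorem Landing.exists_tidy (hc : D.Landing a b c) (hs : D.Separated) (hab : a < b)
    (ha : ∃ k, D.terminal k = a) (hb : ∃ k, D.terminal k = b)
    (hT : ∀ k, ¬ (a < D.terminal k ∧ D.terminal k < b)) (hx : ∀ x, D.Joined x a → x < a)
    (hac : a < c) : ∃ G, D.Tidy a c (D.push a c hac ha) G := by
  have hsep := fun z w (h : (D.push a c hac ha).Joined z w) =>
    hc.separated_push_or hs hab ha hb hT hx h
  by_cases hI : ∃ x, D.Joined b x
  · obtain ⟨x, hbx⟩ := hI
    obtain rfl := hc.eq_of_joined hs hbx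
    have hx' : x < a ∨ c < x := by
      by_contra hcon
      have h1 : x ≠ a := by
        rintro rfl
        have := hx _ hbx
        omega
      have h2 := hbx.ne
      obtain ⟨k, hk⟩ := hs.exists_terminal hbx.symm (by omega)
      exact hT k (by omega)
    obtain ⟨k, he⟩ := id hbx
    have he : (x, c) ∈ overArcs (D.curve k) := he.resolve_left fun h => overArc_fst_ne hb h rfl
    obtain ⟨l, r, hl, hk⟩ := push_curve_of_overArc hac ha he
    rw [pushOver_right (by omega) ⟨hac, le_rfl⟩] at hk
    obtain rfl : r = [] := by
      by_contra hr
      obtain ⟨j, hj⟩ := hb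
      refine ne_terminal_of_curve_eq (D := D.push a c hac ha) (k := k) (x := c)
        (l := l ++ [shift a c x, c + 2 * (c - a) + (c - a), c + 2 * (c - a) - (c - a)]) (r := r)
        (by rw [hk]; simp) hr j ?_
      rw [terminal_push, if_neg (by omega), hj, shift_of_le le_rfl]
    refine exists_tidy_of_terminal (k := k) (l := l ++ [shift a c x])
      (y := c + 2 * (c - a) + (c - a)) (w := c + 2 * (c - a) - (c - a)) (d := c)
      (by rw [hk]; simp) (by simpa using hl.add_one) ?_ ?_ (by omega) ?_ ?_
    · intro z hz hcz
      unfold Encloses at hcz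
      dsimp only at hcz
      rcases isPoint_push hz with ⟨u, _, _, h⟩ | h | ⟨h, _⟩ | ⟨u, v, _, h1, _, h⟩
      · unfold shift at h
        split_ifs at h <;> omega
      all_goals omega
    · intro z
      unfold shift
      split_ifs <;> omega
    · unfold Encloses
      dsimp only
      omega
    · intro z w hzw hz hw
      rcases hsep z w hzw with h | ⟨_, _, h⟩ | ⟨u, v, h, _⟩
      · exact h
      · exact absurd h (not_or.2 ⟨hz, hw⟩)
      · exact absurd hbx (h.not_joined hs)
  by_cases hII : ∃ u v, D.Tight a b u v ∧ ∃ k, D.terminal k = v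
  · obtain ⟨u, v, ht, hv⟩ := hII
    obtain ⟨hj, hu, hub, hbv, hTuv⟩ := id ht
    have hcv : c < v := by
      obtain ⟨k, hk⟩ := hv
      have := hc.not_terminal k
      omega
    have hbc := hc.le
    obtain ⟨k, he⟩ := hj
    have he : (u, v) ∈ overArcs (D.curve k) := he.resolve_right fun h => overArc_fst_ne hv h rfl
    obtain ⟨l, r, hl, hk⟩ := push_curve_of_overArc hac ha he
    rw [pushOver_left (by omega) (by omega) (by omega)] at hk
    obtain rfl : r = [] := by
      by_contra hr
      obtain ⟨j, hj⟩ := hv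
      refine ne_terminal_of_curve_eq (D := D.push a c hac ha) (k := k) (x := shift a c v)
        (l := l ++ [u, c + 2 * (c - a) - (u - a), c + 2 * (c - a) + (u - a)]) (r := r)
        (by rw [hk]; simp) hr j ?_
      rw [terminal_push, if_neg (by omega), hj]
    have hvs : shift a c v = v + 3 * (c - a) := shift_of_lt hcv
    refine exists_tidy_of_terminal (k := k) (l := l ++ [u])
      (y := c + 2 * (c - a) - (u - a)) (w := c + 2 * (c - a) + (u - a)) (d := shift a c v)
      (by rw [hk]; simp) (by simpa using hl.add_one) ?_ ?_ (by omega) ?_ ?_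
    · intro z hz hcz
      unfold Encloses at hcz
      dsimp only at hcz
      rw [hvs] at hcz
      have nonterminal : ∀ x, b < x → x < v → ∀ k, D.terminal k ≠ x := by
        rintro x h1 h2 k rfl
        have := hTuv k (by omega) h2
        omega
      rcases isPoint_push hz with ⟨x, hxp, _, h⟩ | h | ⟨h, _⟩ | ⟨x, y, hxy, h1, h2, h⟩
      · have hcx : c < x ∧ x < v := by
          unfold shift at h
          split_ifs at h <;> omega
        have hnt := nonterminal x (by omega) hcx.2
        obtain ⟨y, hxy⟩ := exists_joined hxp hnt
        have := hc.max y x (ht.joined_lt hs hxy (by omega) hcx.2) hnt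
        omega
      · omega
      · omega
      · -- a pulled arc that starts under the tight arc would be tight
        have hyv := ht.1.between hxy (by omega) (by omega)
        have hnt := nonterminal y (by omega) hyv.2
        have := hc.max x y (ht.joined_lt hs hxy.symm (by omega) hyv.2) hnt
        omega
    · intro z
      unfold shift
      split_ifs <;> omega
    · unfold Encloses
      dsimp only
      omega
    · intro z w hzw hz hw
      rcases hsep z w hzw with h | ⟨h, _, _⟩ | ⟨u', v', h, ⟨j', hj'⟩, h'⟩
      · exact h
      · exact absurd h hI
      · -- there is only one such over arc
        obtain ⟨j, hj⟩ := hv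
        have h1 := hTuv j'
        have h2 := h.2.2.2.2 j
        have h3 := h.2.2.1
        have h4 := h.2.2.2.1
        obtain rfl : v = v' := by omega
        obtain rfl := h.1.symm.unique ht.1.symm
        exact absurd h' (not_or.2 ⟨hz, hw⟩)
  · refine ⟨D.push a c hac ha, Equivalent.refl _, fun _ => rfl, ?_, encloses_of_underArcs_push,
      fun _ h => h, fun _ _ h => h, fun _ _ h => h⟩
    intro z w hzw
    rcases hsep z w hzw with h | ⟨h, _, _⟩ | ⟨u, v, h, hv, _⟩
    · exact h
    · exact absurd h hI
    · exact absurd ⟨u, v, h, hv⟩ hII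

end VCD

namespace VCD

variable {n : ℕ} {D F F' : VCD n} {a b c c₀ : ℤ}

/-! ### Reduction of the pushed diagram -/

/-- The properties of the diagrams `F` between the tidy push of `D` and the simplified diagram, if
the puncture `a` is the end of an over arc `(x, a)` of `D` with `x < c₀ < a`, where `c₀` is the
terminal point before `a`, and the puncture is moved to the landing place `c` on the right of the
next terminal point `b`. -/
structure Reduct (D : VCD n) (a b c c₀ : ℤ) (F : VCD n) : Prop where
  terminal : ∀ k, if D.terminal k = a then F.terminal k = c + 2 * (c - a)
    else F.terminal k = shift a c (D.terminal k)
  separated : F.Separated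
  underArcs : ∀ k, ∀ e ∈ underArcs (F.curve k),
    (∃ j, ∃ f ∈ underArcs (D.curve j), e = (shift a c f.1, shift a c f.2)) ∨
      Encloses e (c + 2 * (c - a))
  /-- Only points next to the former position of the puncture have been deleted. -/
  deleted : ∀ d, D.IsPoint d → d ≠ a → ¬ F.IsPoint (shift a c d) →
    ∀ z, F.IsPoint z → ¬ Encloses (shift a c d, a) z
  joined_left : ∀ y w, F.Joined y w → c₀ < y → y < a → w < c₀
  joined_right : ∀ y w, F.Joined y w → a < y → y < b → b < w
  moved : ∃ k w, (w, c + 2 * (c - a)) ∈ overArcs (F.curve k) ∧ w < c₀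

/-- The only arcs that can be contracted are under arcs from a point between `c₀` and `a` to a point
between `a` and `b`; they become adjacent because the puncture has left the place between them. -/
theorem Reduct.straddles (h : D.Reduct a b c c₀ F) (hD : D.Irreducible) (hca : c₀ < a) (hab : a < b)
    (hbc : b ≤ c) (ha : ∃ k, D.terminal k = a) (hb : ∃ k, D.terminal k = b)
    (hc₀ : ∃ k, D.terminal k = c₀) (hover : ∃ x, D.Joined x a) {k : Fin n} {x y : ℤ}
    {l r : List ℤ} (hs : StepAt F F' k x y l r) :
    (c₀ ≤ x ∧ x < a ∧ a < y ∧ y ≤ b) ∨ (c₀ ≤ y ∧ y < a ∧ a < x ∧ x ≤ b) := by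
  have hadj := hs.2.1
  have term : ∀ k, D.terminal k ≠ a → F.IsPoint (shift a c (D.terminal k)) := by
    intro k hk
    have := h.terminal k
    rw [if_neg hk] at this
    exact this ▸ F.isPoint_terminal k
  have hu : (x, y) ∈ VirtualBraid.underArcs (F.curve k) :=
    mem_underArcs_iff.2 ⟨l, r, hs.1, h.separated.odd_of_stepAt hs⟩
  have hpx : F.IsPoint x := ⟨k, (mem_of_mem_underArcs hu).1⟩
  have hpy : F.IsPoint y := ⟨k, (mem_of_mem_underArcs hu).2⟩
  have ht : F.IsPoint (c + 2 * (c - a)) := by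
    obtain ⟨k, hk⟩ := ha
    have := h.terminal k
    rw [if_pos hk] at this
    exact this ▸ F.isPoint_terminal k
  rcases h.underArcs k _ hu with ⟨j, ⟨p, q⟩, hf, he⟩ | he
  swap
  · exact absurd he (hadj _ ht)
  simp only [Prod.mk.injEq] at he
  obtain ⟨rfl, rfl⟩ := he
  obtain ⟨x₀, hx₀⟩ := hover
  obtain ⟨hpa, hqa⟩ := hx₀.underArc_ne ha hf
  dsimp only at hpa hqa
  have hstr : (p < a ∧ a < q) ∨ (q < a ∧ a < p) := by
    by_contra hn
    obtain ⟨l', r', hc', _⟩ := mem_underArcs_iff.1 hf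
    obtain ⟨z, hz, hzpq⟩ := hD.not_adjacent hc'
    unfold Encloses at hzpq
    dsimp only at hzpq
    have hnp : ¬ F.IsPoint (shift a c z) := by
      intro hp
      have := hadj _ hp
      unfold Encloses shift at this
      dsimp only at this
      split_ifs at this <;> omega
    have h1 := h.deleted z hz (by omega) hnp _ hpx
    have h2 := h.deleted z hz (by omega) hnp _ hpy
    unfold Encloses shift at h1 h2
    dsimp only at h1 h2
    split_ifs at h1 h2 <;> omega
  obtain ⟨kb, hkb⟩ := hb
  obtain ⟨kc, hkc⟩ := hc₀
  have h1 := hadj _ (term kb (by omega))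
  have h2 := hadj _ (term kc (by omega))
  rw [hkb, shift_of_le (a := a) hbc] at h1
  rw [hkc, shift_of_le (x := c₀) (by omega)] at h2
  unfold Encloses at h1 h2
  dsimp only at h1 h2
  unfold shift at h1 h2 ⊢
  split_ifs at h1 h2 ⊢ <;> omega

theorem Reduct.step (h : D.Reduct a b c c₀ F) (hD : D.Irreducible) (hca : c₀ < a) (hab : a < b)
    (hbc : b ≤ c) (ha : ∃ k, D.terminal k = a) (hb : ∃ k, D.terminal k = b)
    (hc₀ : ∃ k, D.terminal k = c₀) (hT : ∀ k, ¬ (a < D.terminal k ∧ D.terminal k < b))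
    (hT' : ∀ k, ¬ (c₀ < D.terminal k ∧ D.terminal k < a)) (hover : ∃ x, D.Joined x a)
    (hs : Step F F') : D.Reduct a b c c₀ F' := by
  obtain ⟨k, x, y, l, r, hs⟩ := hs
  have hxy := h.straddles hD hca hab hbc ha hb hc₀ hover hs
  have hl := h.separated.odd_of_stepAt hs
  have hadj := hs.2.1
  have hpt : ∀ z, F'.IsPoint z → F.IsPoint z := fun z ⟨j, hz⟩ => ⟨j, hs.mem hz⟩
  have hterm : ∀ k, F.terminal k ≤ b → F.terminal k = c₀ ∨ F.terminal k < c₀ ∨ F.terminal k = b := by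
    intro k hk
    have h1 := h.terminal k
    have := hT k
    have := hT' k
    split_ifs at h1
    · omega
    · unfold shift at h1
      split_ifs at h1 <;> omega
  have atc₀ : ∃ k, F.terminal k = c₀ := by
    obtain ⟨k, hk⟩ := hc₀
    have := h.terminal k
    rw [if_neg (by omega), hk, shift_of_le (by omega)] at this
    exact ⟨k, this⟩
  have atb : ∃ k, F.terminal k = b := by
    obtain ⟨k, hk⟩ := hb
    have := h.terminal k
    rw [if_neg (by omega), hk, shift_of_le (by omega)] at this
    exact ⟨k, this⟩
  -- the other ends of the over arcs at the contracted under arc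
  have hfar : ∀ z w, F.Joined z w → (∀ k, F.terminal k ≠ z) →
      (c₀ ≤ z ∧ z < a → w < c₀) ∧ (a < z ∧ z ≤ b → b < w) := by
    intro z w hzw hz
    obtain ⟨k1, hk1⟩ := atc₀
    obtain ⟨k2, hk2⟩ := atb
    have := hz k1
    have := hz k2
    exact ⟨fun hz' => h.joined_left z w hzw (by omega) hz'.2,
      fun hz' => h.joined_right z w hzw hz'.1 (by omega)⟩
  have hnew : ∀ j, ∀ e ∈ overArcs (F'.curve j), e ∈ overArcs (F.curve j) ∨
      (e.1 < c₀ ∧ b ≤ e.2) ∨ (e.2 ≤ c₀ ∧ b < e.1) := by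
    intro j e he
    by_cases hj : j = k
    · subst hj
      rw [hs.curve_self] at he
      rcases overArcs_contract (x := x) he with h1 | ⟨_, h1, h2⟩
      · exact Or.inl (hs.1 ▸ h1)
      · right
        rw [← hs.1] at h1 h2
        have f1 := hfar x e.1 ⟨j, Or.inr h1⟩ (ne_terminal_of_curve_eq hs.1 (by simp))
        rcases h2 with ⟨rfl, h2⟩ | h2
        · have hyt := terminal_eq_of_curve_eq (D := F) (k := j) (x := y) (l := l ++ [x])
            (by rw [hs.1]; simp)
          have := hterm j
          omega
        · have f2 := hfar y e.2 ⟨j, Or.inl h2⟩ (fun k => (F.overArc_fst_ne_terminal h2).symm)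
          omega
    · rw [hs.curve_of_ne hj] at he
      exact Or.inl he
  have hjoined : ∀ u v, F'.Joined u v → F.Joined u v ∨ (u ≤ c₀ ∧ b ≤ v ∧ (u < c₀ ∨ b < v)) ∨
      (v ≤ c₀ ∧ b ≤ u ∧ (v < c₀ ∨ b < u)) := by
    rintro u v ⟨j, hj | hj⟩ <;> rcases hnew j _ hj with h1 | h1
    · exact Or.inl ⟨j, Or.inl h1⟩
    · omega
    · exact Or.inl ⟨j, Or.inr h1⟩
    · omega
  refine ⟨fun j => ?_, ?_, ?_, ?_, ?_, ?_, ?_⟩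
  · rw [hs.terminal]
    exact h.terminal j
  · intro u v huv
    have hk : ∃ k, Encloses (u, v) (F.terminal k) := by
      obtain ⟨k1, hk1⟩ := atc₀
      obtain ⟨k2, hk2⟩ := atb
      rcases hjoined u v huv with h1 | h1
      · exact h.separated u v h1
      · by_cases h2 : Encloses (u, v) c₀
        · exact ⟨k1, hk1 ▸ h2⟩
        · refine ⟨k2, hk2 ▸ ?_⟩
          unfold Encloses at h2 ⊢
          dsimp only at h2 ⊢
          omega
    obtain ⟨k, hk⟩ := hk
    exact ⟨k, by rwa [hs.terminal]⟩
  · intro j e he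
    refine h.underArcs j e ?_
    by_cases hj : j = k
    · subst hj
      rw [hs.curve_self] at he
      rw [hs.1]
      exact underArcs_contract hl he
    · rwa [hs.curve_of_ne hj] at he
  · intro d hd hda hdF z hz
    by_cases hdF' : F.IsPoint (shift a c d)
    · -- `d` is an end of the contracted arc
      have hdxy : shift a c d = x ∨ shift a c d = y := by
        by_contra hn
        apply hdF
        obtain ⟨j, hj⟩ := hdF'
        refine ⟨j, ?_⟩
        rw [hs.curve_eq_filter, List.mem_filter]
        refine ⟨hj, ?_⟩
        rw [decide_eq_true_eq]
        left
        omega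
      have := hadj z (hpt z hz)
      unfold Encloses at this ⊢
      dsimp only at this ⊢
      omega
    · exact h.deleted d hd hda hdF' z (hpt z hz)
  · intro z w hzw h1 h2
    rcases hjoined z w hzw with h3 | h3
    · exact h.joined_left z w h3 h1 h2
    · omega
  · intro z w hzw h1 h2
    rcases hjoined z w hzw with h3 | h3
    · exact h.joined_right z w h3 h1 h2
    · omega
  · obtain ⟨j, w, hw, hwc⟩ := h.moved
    exact ⟨j, w, hs.mem_overArcs hl hw (by omega) (by omega), hwc⟩

/-- If the puncture is not the end of an over arc, then the tidy push is irreducible. -/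
theorem Tidy.irreducible {G : VCD n} {hac : a < c} {ha : ∃ k, D.terminal k = a}
    (h : D.Tidy a c (D.push a c hac ha) G) (hD : D.Irreducible) (hover : ¬ ∃ x, D.Joined x a) :
    G.Irreducible := by
  refine h.separated.irreducible fun k e he => ?_
  rcases h.underArcs k e he with ⟨j, ⟨p, q⟩, hf, rfl⟩ | he'
  · obtain ⟨l, r, hc, _⟩ := mem_underArcs_iff.1 hf
    obtain ⟨z, hz, hzpq⟩ := hD.not_adjacent hc
    refine ⟨shift a c z, h.isPoint z ?_, ?_⟩
    · by_cases hza : z = a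
      · obtain ⟨i, w, hw, h1 | ⟨x, hx, _⟩⟩ := exists_overArc_push hac ha
        · have hwp := (mem_of_mem_overArcs hw).1
          dsimp only at hwp
          rw [h1.1] at hwp
          rw [hza, shift_of_le hac.le]
          exact ⟨i, hwp⟩
        · exact absurd ⟨x, hx⟩ hover
      · exact isPoint_push_shift hz hza
    · unfold Encloses shift at *
      dsimp only at *
      split_ifs <;> omega
  · obtain ⟨i, hi⟩ := ha
    refine ⟨_, ?_, he'⟩
    have := h.terminal i
    rw [terminal_push, if_pos hi] at this
    exact this ▸ G.isPoint_terminal i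

/-- A tidy pushed diagram satisfies the invariant of the contractions that follow if the terminal over
arc at `a` encloses the terminal point `c₀` before `a`. -/
theorem Tidy.reduct {G : VCD n} {hac : a < c} {ha : ∃ k, D.terminal k = a}
    (h : D.Tidy a c (D.push a c hac ha) G) (hs : D.Separated) (hab : a < b) (hbc : b ≤ c)
    (hb : ∃ k, D.terminal k = b) (hT : ∀ k, ¬ (b < D.terminal k ∧ D.terminal k ≤ c))
    (hT₁ : ∀ k, ¬ (a < D.terminal k ∧ D.terminal k < b)) (hca : c₀ < a)
    (hT' : ∀ k, ¬ (c₀ < D.terminal k ∧ D.terminal k < a)) {x : ℤ} (hx : D.Joined x a)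
    (hxc : x < c₀) : D.Reduct a b c c₀ G := by
  have hjoined : ∀ u v, G.Joined u v → (D.push a c hac ha).Joined u v := by
    rintro u v ⟨j, hj⟩
    exact ⟨j, hj.imp (h.overArcs _ _) (h.overArcs _ _)⟩
  have hboth : ∀ y w, (D.push a c hac ha).Joined y w → c₀ < y → y < b →
      (y < a → w < c₀) ∧ (a < y → b < w) := by
    intro y w hyw h1 h2
    have pulled : ∀ u v, D.Joined u v → a < u → v < a → ¬ c₀ < v := by
      intro u v huv hu hv hcv
      have := hx.between huv.symm (by omega) (by omega)
      omega
    have same : ∀ p q, D.Joined p q → p ≠ a → q ≠ a → ((a < p ∧ p ≤ c) ↔ (a < q ∧ q ≤ c)) →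
        shift a c p = y → shift a c q = w → (y < a → w < c₀) ∧ (a < y → b < w) := by
      intro p q hpq hpa hqa hm hp hq
      obtain rfl : p = y := by
        unfold shift at hp
        split_ifs at hp <;> omega
      constructor
      · intro hpa'
        have := hx.between hpq (by omega) hpa'
        obtain ⟨k, hk⟩ := hs p q hpq
        have := hT' k
        rw [← hq, shift_of_le (by omega)]
        unfold Encloses at hk
        dsimp only at hk
        omega
      · intro hpa'
        obtain ⟨k, hk⟩ := hs p q hpq
        have := hT k
        have := hT₁ k
        rw [← hq, shift_of_le (by omega)]
        unfold Encloses at hk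
        dsimp only at hk
        omega
    obtain ⟨z', w', hzw, hcases⟩ := joined_push hyw
    rcases hcases with ⟨p, hpa, rfl, rfl⟩ | ⟨p, q, hpq, hp, hq, hm, rfl, rfl⟩ |
      ⟨u, v, huv, hu, hv, hz⟩ | ⟨hn, _⟩
    · obtain rfl := hpa.symm.unique hx.symm
      rw [shift_of_le (by omega)] at hzw
      omega
    · rcases hzw with ⟨e1, e2⟩ | ⟨e1, e2⟩
      · exact same p q hpq hp hq hm e1 e2
      · exact same q p hpq.symm hq hp hm.symm e2 e1
    · rcases hz with ⟨rfl, rfl⟩ | ⟨rfl, rfl⟩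
      · omega
      · have := pulled u v huv hu.1
        unfold shift at hzw
        split_ifs at hzw <;> omega
    · exact absurd ⟨x, hx⟩ hn
  refine ⟨fun k => ?_, h.separated, h.underArcs, ?_, ?_, ?_, ?_⟩
  · rw [h.terminal, terminal_push]
    split_ifs <;> rfl
  · intro d hd hda hdG
    exact absurd (h.isPoint d (isPoint_push_shift hd hda)) hdG
  · exact fun y w hyw h1 h2 => (hboth y w (hjoined y w hyw) h1 (by omega)).1 h2
  · exact fun y w hyw h1 h2 => (hboth y w (hjoined y w hyw) (by omega) h2).2 h1
  · obtain ⟨i, w, hw, ⟨_, hn⟩ | ⟨x', hx', rfl⟩⟩ := exists_overArc_push hac ha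
    · exact absurd ⟨x, hx⟩ hn
    · obtain rfl := hx'.symm.unique hx.symm
      refine ⟨i, _, h.overArcs_moved _ _ hw, ?_⟩
      rw [shift_of_le (by omega)]
      exact hxc

end VCD

namespace VCD

variable {n : ℕ}

/-! ### Reductions -/

/-- The last terminal point in an interval `(x, a)` that contains one. -/
theorem exists_terminal_before (D : VCD n) {a x : ℤ} (h : ∃ k, x < D.terminal k ∧ D.terminal k < a) :
    ∃ c₀, (∃ k, D.terminal k = c₀) ∧ c₀ < a ∧ x < c₀ ∧
      ∀ k, ¬ (c₀ < D.terminal k ∧ D.terminal k < a) := by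
  obtain ⟨k, hk1, hk2⟩ := h
  obtain ⟨c₀, ⟨⟨j, hj⟩, hlt⟩, hmax⟩ := Int.exists_greatest_of_bdd
    (P := fun c => (∃ k, D.terminal k = c) ∧ c < a) ⟨a, fun z hz => hz.2.le⟩
    ⟨D.terminal k, ⟨k, rfl⟩, hk2⟩
  refine ⟨c₀, ⟨j, hj⟩, hlt, ?_, fun i hi => ?_⟩
  · have := hmax _ ⟨⟨k, rfl⟩, hk2⟩
    omega
  · have := hmax _ ⟨⟨i, rfl⟩, hi.2⟩
    omega

theorem Simplified.hasTerminalOverArc_sigma {D E : VCD n} {i : ℕ} {hi : i + 1 < n}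
    (hD : D.Simplified) (hn : ¬ D.HasTerminalOverArc ⟨i + 1, hi⟩ ⟨i, by omega⟩)
    (hDE : Equivalent (D.sigma i hi) E) (hE : E.Simplified) :
    E.HasTerminalOverArc ⟨i, by omega⟩ ⟨i + 1, hi⟩ := by
  have hI := hD.irreducible
  have hs := hI.separated
  have hab := D.t_lt_t_succ i hi
  have hT := D.t_succ_not_between i hi
  have ha := D.exists_terminal_eq ⟨i, by omega⟩
  have hb := D.exists_terminal_eq ⟨i + 1, hi⟩
  have hx : ∀ x, D.Joined x (D.t ⟨i, by omega⟩) → x < D.t ⟨i, by omega⟩ := by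
    intro x hx
    by_contra hlt
    obtain ⟨k, hk1, hk2⟩ := hs.exists_terminal hx.symm (by have := hx.ne; omega)
    have := hT k
    obtain ⟨j, hj | hj⟩ := hx
    swap
    · exact overArc_fst_ne ha hj rfl
    obtain ⟨m, hm⟩ := ha
    obtain rfl : m = j := D.eq_of_mem (x := D.t ⟨i, by omega⟩) (hm ▸ D.terminal_mem m)
      (mem_of_mem_overArcs hj).2
    refine hn ⟨m, x, hm.symm ▸ hj, hm, ?_⟩
    rw [hm]
    unfold Encloses
    dsimp only
    omega
  obtain ⟨c, hc⟩ := D.exists_landing (D.t ⟨i, by omega⟩) (D.t ⟨i + 1, hi⟩)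
  have hbc := hc.le
  have hTc := hc.not_terminal
  have hac : D.t ⟨i, by omega⟩ < c := by omega
  obtain ⟨G, hG⟩ := hc.exists_tidy hs hab ha hb hT hx hac
  have hEG : Equivalent G E :=
    hG.equivalent.symm.trans ((D.equivalent_push_of_le hab hbc ha hTc).symm.trans hDE)
  suffices ∃ F, Equivalent G F ∧ F.Irreducible ∧ (∀ k, F.terminal k = G.terminal k) ∧
      ∃ k w, (w, c + 2 * (c - D.t ⟨i, by omega⟩)) ∈ overArcs (F.curve k) ∧ w < D.t ⟨i + 1, hi⟩ by
    obtain ⟨F, hGF, hF, hterm, k, w, hw, hwb⟩ := this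
    refine HasTerminalOverArc.relabel ?_ (hF.relabel hE.irreducible (hGF.symm.trans hEG))
    have ht : ∀ j, F.t j = (D.push _ c hac ha).t j :=
      t_congr fun k => by rw [hterm, hG.terminal]
    have ht1 := (ht ⟨i + 1, hi⟩).trans (D.t_push hi hbc hTc hac ha _)
    have ht0 := (ht ⟨i, by omega⟩).trans (D.t_push hi hbc hTc hac ha _)
    rw [if_neg (by simp), if_pos rfl] at ht1
    rw [if_pos rfl] at ht0
    obtain ⟨m, hm⟩ := F.exists_terminal_eq ⟨i + 1, hi⟩
    obtain rfl : m = k := F.eq_of_mem (hm ▸ F.terminal_mem m) (ht1 ▸ (mem_of_mem_overArcs hw).2)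
    refine ⟨m, w, ?_, hm, ?_⟩
    · rwa [hm, ht1]
    · rw [hm, ht1, ht0]
      unfold Encloses
      dsimp only
      omega
  by_cases hover : ∃ x, D.Joined x (D.t ⟨i, by omega⟩)
  · obtain ⟨x, hxa⟩ := hover
    obtain ⟨c₀, hc₀, hca, hxc, hT'⟩ := D.exists_terminal_before (hs.exists_terminal hxa (hx x hxa))
    have hR := hG.reduct hs hab hbc hb hTc hT hca hT' hxa hxc
    obtain ⟨F, hGF, hF⟩ := G.exists_irreducible
    have hRF : D.Reduct (D.t ⟨i, by omega⟩) (D.t ⟨i + 1, hi⟩) c c₀ F := by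
      clear hF
      induction hGF with
      | refl => exact hR
      | tail _ hstep ih => exact ih.step hI hca hab hbc ha hb hc₀ hT hT' ⟨x, hxa⟩ hstep
    refine ⟨F, equivalent_of_reflTransGen hGF, hF, fun k => ?_, ?_⟩
    · have h1 := hRF.terminal k
      have h2 := hR.terminal k
      split_ifs at h1 h2 <;> rw [h1, h2]
    · obtain ⟨k, w, hw, hwc⟩ := hRF.moved
      exact ⟨k, w, hw, by omega⟩
  · refine ⟨G, Equivalent.refl G, hG.irreducible hI hover, fun _ => rfl, ?_⟩
    obtain ⟨k, w, hw, h1 | ⟨x, hx, _⟩⟩ := exists_overArc_push hac ha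
    · exact ⟨k, w, hG.overArcs_moved _ _ hw, by omega⟩
    · exact absurd ⟨x, hx⟩ hover

theorem Simplified.hasTerminalOverArc_sigmaInv {D E : VCD n} {i : ℕ} {hi : i + 1 < n}
    (hD : D.Simplified) (hn : ¬ D.HasTerminalOverArc ⟨i, by omega⟩ ⟨i + 1, hi⟩)
    (hDE : Equivalent (D.sigmaInv i hi) E) (hE : E.Simplified) :
    E.HasTerminalOverArc ⟨i + 1, hi⟩ ⟨i, by omega⟩ := by
  have hj : n - 2 - i + 1 < n := by omega
  have r1 : Fin.rev ⟨n - 2 - i, by omega⟩ = (⟨i + 1, hi⟩ : Fin n) := by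
    ext; simp [Fin.val_rev]; omega
  have r2 : Fin.rev ⟨n - 2 - i + 1, hj⟩ = (⟨i, by omega⟩ : Fin n) := by
    ext; simp [Fin.val_rev]; omega
  rw [sigmaInv_eq D hi hj (by omega)] at hDE
  have hDE' := hDE.mirror
  rw [mirror_mirror] at hDE'
  have h := (hD.mirror.hasTerminalOverArc_sigma (hi := hj) (fun h => hn ?_) hDE' hE.mirror).mirror
  · rwa [mirror_mirror, r1, r2] at h
  · have := h.mirror
    rwa [mirror_mirror, r1, r2] at this

theorem quotient_mk_eq {D E : VCD n} (h : Equivalent D E) :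
    Quotient.mk (setoid n) D = Quotient.mk (setoid n) E := Quotient.sound h

theorem reduces_sigma (D : VCD n) (i : ℕ) (hi : i + 1 < n) :
    Reduces (Quotient.mk (setoid n) D) (Quotient.mk (setoid n) (D.sigma i hi)) ∨
      Reduces (Quotient.mk (setoid n) (D.sigma i hi)) (Quotient.mk (setoid n) D) := by
  obtain ⟨D', hD', hs⟩ := D.exists_simplified
  by_cases h : D'.HasTerminalOverArc ⟨i + 1, hi⟩ ⟨i, by omega⟩
  · exact Or.inl ⟨D', i, hi, hs, quotient_mk_eq hD', Or.inr ⟨h, quotient_mk_eq (hD'.sigma i hi)⟩⟩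
  · obtain ⟨E, hE, hEs⟩ := (D'.sigma i hi).exists_simplified
    refine Or.inr ⟨E, i, hi, hEs, quotient_mk_eq ((hD'.sigma i hi).trans hE),
      Or.inl ⟨hs.hasTerminalOverArc_sigma h hE hEs, quotient_mk_eq ?_⟩⟩
    exact hD'.trans ((D'.sigmaInv_sigma i hi).symm.trans (hE.sigmaInv i hi))

theorem reduces_sigmaInv (D : VCD n) (i : ℕ) (hi : i + 1 < n) :
    Reduces (Quotient.mk (setoid n) D) (Quotient.mk (setoid n) (D.sigmaInv i hi)) ∨
      Reduces (Quotient.mk (setoid n) (D.sigmaInv i hi)) (Quotient.mk (setoid n) D) := by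
  obtain ⟨D', hD', hs⟩ := D.exists_simplified
  by_cases h : D'.HasTerminalOverArc ⟨i, by omega⟩ ⟨i + 1, hi⟩
  · exact Or.inl ⟨D', i, hi, hs, quotient_mk_eq hD', Or.inl ⟨h, quotient_mk_eq (hD'.sigmaInv i hi)⟩⟩
  · obtain ⟨E, hE, hEs⟩ := (D'.sigmaInv i hi).exists_simplified
    refine Or.inr ⟨E, i, hi, hEs, quotient_mk_eq ((hD'.sigmaInv i hi).trans hE),
      Or.inr ⟨hs.hasTerminalOverArc_sigmaInv h hE hEs, quotient_mk_eq ?_⟩⟩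
    exact hD'.trans ((D'.sigma_sigmaInv i hi).symm.trans (hE.sigma i hi))

end VCD

end VirtualBraid

theorem proposition4p1 (n i : ℕ) (hi : i + 1 < n) :
    (∀ D : VirtualBraid.VCD n, D.Simplified →
      ¬ D.HasTerminalOverArc ⟨i + 1, hi⟩ ⟨i, by omega⟩ →
      ∀ E : VirtualBraid.VCD n, VirtualBraid.VCD.Equivalent (D.sigma i hi) E → E.Simplified →
        E.HasTerminalOverArc ⟨i, by omega⟩ ⟨i + 1, hi⟩) ∧
    (∀ D : VirtualBraid.VCD n, D.Simplified →
      ¬ D.HasTerminalOverArc ⟨i, by omega⟩ ⟨i + 1, hi⟩ →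
      ∀ E : VirtualBraid.VCD n, VirtualBraid.VCD.Equivalent (D.sigmaInv i hi) E → E.Simplified →
        E.HasTerminalOverArc ⟨i + 1, hi⟩ ⟨i, by omega⟩) ∧
    (∀ D : VirtualBraid.VCD n,
      (VirtualBraid.VCD.Reduces (Quotient.mk (VirtualBraid.VCD.setoid n) D)
          (Quotient.mk (VirtualBraid.VCD.setoid n) (D.sigma i hi)) ∨
        VirtualBraid.VCD.Reduces (Quotient.mk (VirtualBraid.VCD.setoid n) (D.sigma i hi))
          (Quotient.mk (VirtualBraid.VCD.setoid n) D)) ∧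
      (VirtualBraid.VCD.Reduces (Quotient.mk (VirtualBraid.VCD.setoid n) D)
          (Quotient.mk (VirtualBraid.VCD.setoid n) (D.sigmaInv i hi)) ∨
        VirtualBraid.VCD.Reduces (Quotient.mk (VirtualBraid.VCD.setoid n) (D.sigmaInv i hi))
          (Quotient.mk (VirtualBraid.VCD.setoid n) D))) := by
  exact ⟨fun _ hD hn _ hDE hE => hD.hasTerminalOverArc_sigma hn hDE hE,
    fun _ hD hn _ hDE hE => hD.hasTerminalOverArc_sigmaInv hn hDE hE,
    fun D => ⟨D.reduces_sigma i hi, D.reduces_sigmaInv i hi⟩⟩
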